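/- Let $X$ be a complex manifold of complex dimension $3$ whose underlying real smooth manifold is diffeomorphic to the standard six-sphere $S^6$ (that is, $X$ is $S^6$ endowed with a hypothetical complex structure). Let $\mathcal M(X)$ be the $\mathbb C$-algebra of meromorphic functions on $X$, let $a(X) := \operatorname{tr\,deg}_{\mathbb C}\mathcal M(X)$ be the algebraic dimension of $X$, and let $h^{p,q}(X) := \dim_{\mathbb C} H^{p,q}_{\overline\partial}(X)$ be the Hodge numbers of $X$, where $H^{p,q}_{\overline\partial}(X) = \ker(\overline\partial\colon \wedge^{p,q}X\to\wedge^{p,q+1}X)/\operatorname{im}(\overline\partial\colon \wedge^{p,q-1}X\to\wedge^{p,q}X)$ is the Dolbeault cohomology computed with smooth complex-valued $(p,q)$-forms. If $a(X) = 0$, then $$ h^{1,0}(X) \leq 1 . $$ -/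

import Mathlib

set_option maxSynthPendingDepth 3

open scoped Manifold ContDiff Topology

noncomputable section

namespace ComplexManifold

section RealModel

variable (E : Type*) [NormedAddCommGroup E] [NormedSpace ℂ E]

/-- The model of the real manifold underlying a complex manifold modelled on `E`. -/
abbrev realModel : ModelWithCorners ℝ E E := 𝓘(ℝ, E)

end RealModel

section LinearAlgebra

variable {E : Type*} [NormedAddCommGroup E] [NormedSpace ℂ E]
variable {F : Type*} [NormedAddCommGroup F] [NormedSpace ℂ F]

/-- Multiplication by a complex number, as a real-linear map. -/
def mulBy (c : ℂ) : E →L[ℝ] E := c • ContinuousLinearMap.id ℝ E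

/-- The conjugate-linear part `v ↦ (L v + i L (i v)) / 2` of a real-linear map `L`. -/
def conjLinearPart (L : E →L[ℝ] F) : E →L[ℝ] F :=
  (2⁻¹ : ℂ) • (L + Complex.I • L.comp (mulBy Complex.I))

/-- The operator `∂̄` on complex-valued forms on (an open set of) a complex vector space:
`∂̄ (∑ f_{IJ} dz_I ∧ dz̄_J) = ∑ ∑_k (∂f_{IJ}/∂z̄_k) dz̄_k ∧ dz_I ∧ dz̄_J`.  It is obtained from
`extDeriv` by keeping only the conjugate-linear part of the derivative of the form. -/
def flatDbar {k : ℕ} (η : E → E [⋀^Fin k]→L[ℝ] ℂ) (y : E) : E [⋀^Fin (k + 1)]→L[ℝ] ℂ :=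
  ContinuousAlternatingMap.alternatizeUncurryFin (conjLinearPart (fderiv ℝ η y))

theorem conjLinearPart_add (L M : E →L[ℝ] F) :
    conjLinearPart (L + M) = conjLinearPart L + conjLinearPart M := by
  ext v
  simp only [conjLinearPart, ContinuousLinearMap.add_comp, smul_add,
    add_apply]
  abel

theorem conjLinearPart_smul (c : ℂ) (L : E →L[ℝ] F) :
    conjLinearPart (c • L) = c • conjLinearPart L := by
  ext v
  simp only [conjLinearPart, add_apply, smul_apply,
    ContinuousLinearMap.comp_apply, smul_add, smul_smul]
  congr 2 <;> ring

theorem flatDbar_zero {k : ℕ} (y : E) :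
    flatDbar (0 : E → E [⋀^Fin k]→L[ℝ] ℂ) y = 0 := by
  ext v
  simp [flatDbar, conjLinearPart, ContinuousAlternatingMap.alternatizeUncurryFin_apply]

theorem flatDbar_add {k : ℕ} {η θ : E → E [⋀^Fin k]→L[ℝ] ℂ} {y : E}
    (hη : DifferentiableAt ℝ η y) (hθ : DifferentiableAt ℝ θ y) :
    flatDbar (η + θ) y = flatDbar η y + flatDbar θ y := by
  rw [flatDbar, fderiv_add hη hθ, conjLinearPart_add,
    ContinuousAlternatingMap.alternatizeUncurryFin_add]
  rfl

theorem flatDbar_smul {k : ℕ} (c : ℂ) {η : E → E [⋀^Fin k]→L[ℝ] ℂ} {y : E}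
    (hη : DifferentiableAt ℝ η y) :
    flatDbar (c • η) y = c • flatDbar η y := by
  rw [flatDbar, fderiv_const_smul hη, conjLinearPart_smul]
  ext v
  simp [flatDbar, ContinuousAlternatingMap.alternatizeUncurryFin_apply, Finset.mul_sum]

end LinearAlgebra

section Dolbeault

variable (E : Type*) [NormedAddCommGroup E] [NormedSpace ℂ E]
variable (X : Type*) [TopologicalSpace X] [ChartedSpace E X]

/-- Complex-valued differential forms of degree `k` on the real manifold underlying `X`
(without any regularity). -/
abbrev Form (k : ℕ) : Type _ :=
  (x : X) → TangentSpace (realModel E) x [⋀^Fin k]→L[ℝ] ℂ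

variable {E X}

/-- The form on the model space obtained by pulling back `η` along the inverse of the chart `e`
(meaningful on `e.target`). -/
def Form.inChart {k : ℕ} (η : Form E X k) (e : OpenPartialHomeomorph X E) :
    E → E [⋀^Fin k]→L[ℝ] ℂ :=
  fun y => (η (e.symm y)).compContinuousLinearMap
    (mfderiv (realModel E) (realModel E) e.symm y)

/-- A form is smooth if it is so in every chart. -/
def Form.IsSmooth {k : ℕ} (η : Form E X k) : Prop :=
  ∀ e ∈ atlas E X, ContDiffOn ℝ ∞ (η.inChart e) e.target

/-- Multiplication by a complex number on the tangent space at `x`. -/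
def tangentMulBy (x : X) (c : ℂ) :
    TangentSpace (realModel E) x →L[ℝ] TangentSpace (realModel E) x :=
  mulBy (E := E) c

/-- A form of degree `k = p + q` has type `(p, q)` if
`η (c v₁, …, c v_k) = c ^ p * conj c ^ q * η (v₁, …, v_k)` for all complex numbers `c`:  on
`⋀^{p', q'}` with `p' + q' = k` the left-hand side is `c ^ p' * conj c ^ q' * η (v₁, …, v_k)`, and
these are distinct characters of `ℂ^×`. -/
def Form.IsOfType {k : ℕ} (p q : ℕ) (η : Form E X k) : Prop :=
  ∀ (x : X) (c : ℂ),
    (η x).compContinuousLinearMap (tangentMulBy x c) = (c ^ p * (starRingEnd ℂ c) ^ q) • η x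

/-- `θ = ∂̄ η`: this holds in every holomorphic chart. -/
def Form.HasDbar {k : ℕ} (η : Form E X k) (θ : Form E X (k + 1)) : Prop :=
  ∀ e ∈ atlas E X, ∀ y ∈ e.target, flatDbar (η.inChart e) y = θ.inChart e y

theorem Form.inChart_zero {k : ℕ} (e : OpenPartialHomeomorph X E) :
    (0 : Form E X k).inChart e = 0 := by
  rfl

theorem Form.inChart_add {k : ℕ} (η θ : Form E X k) (e : OpenPartialHomeomorph X E) :
    (η + θ).inChart e = η.inChart e + θ.inChart e := by
  rfl

theorem Form.inChart_smul {k : ℕ} (c : ℂ) (η : Form E X k) (e : OpenPartialHomeomorph X E) :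
    (c • η).inChart e = c • η.inChart e := by
  rfl

theorem Form.IsSmooth.differentiableAt {k : ℕ} {η : Form E X k} (h : η.IsSmooth)
    {e : OpenPartialHomeomorph X E} (he : e ∈ atlas E X) {y : E} (hy : y ∈ e.target) :
    DifferentiableAt ℝ (η.inChart e) y :=
  ((h e he).contDiffAt (e.open_target.mem_nhds hy)).differentiableAt (by simp)

theorem Form.HasDbar.zero {k : ℕ} : (0 : Form E X k).HasDbar 0 := by
  intro e _ y _
  rw [Form.inChart_zero, flatDbar_zero, Form.inChart_zero]; rfl

theorem Form.HasDbar.add {k : ℕ} {η η' : Form E X k} {θ θ' : Form E X (k + 1)}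
    (hη : η.IsSmooth) (hη' : η'.IsSmooth) (h : η.HasDbar θ) (h' : η'.HasDbar θ') :
    (η + η').HasDbar (θ + θ') := by
  intro e he y hy
  rw [Form.inChart_add, flatDbar_add (hη.differentiableAt he hy) (hη'.differentiableAt he hy),
    h e he y hy, h' e he y hy, Form.inChart_add]; rfl

theorem Form.HasDbar.smul {k : ℕ} {η : Form E X k} {θ : Form E X (k + 1)}
    (hη : η.IsSmooth) (c : ℂ) (h : η.HasDbar θ) : (c • η).HasDbar (c • θ) := by
  intro e he y hy
  rw [Form.inChart_smul, flatDbar_smul c (hη.differentiableAt he hy), h e he y hy,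
    Form.inChart_smul]; rfl

variable (E X)

/-- The space `∧^{p,q} X` of smooth complex-valued forms of type `(p, q)`. -/
def smoothForms (p q : ℕ) : Submodule ℂ (Form E X (p + q)) where
  carrier := {η | η.IsSmooth ∧ η.IsOfType p q}
  zero_mem' := by
    refine ⟨fun e _ => ?_, fun x c => ?_⟩
    · rw [Form.inChart_zero]; exact contDiffOn_const
    · ext v; simp
  add_mem' := by
    rintro η θ ⟨h1, h2⟩ ⟨h1', h2'⟩
    refine ⟨fun e he => ?_, fun x c => ?_⟩
    · rw [Form.inChart_add]; exact (h1 e he).add (h1' e he)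
    · have a := h2 x c
      have b := h2' x c
      ext v
      have a' := DFunLike.congr_fun a v
      have b' := DFunLike.congr_fun b v
      simp only [ContinuousAlternatingMap.compContinuousLinearMap_apply, Pi.add_apply,
        ContinuousAlternatingMap.add_apply, ContinuousAlternatingMap.smul_apply, smul_add]
        at a' b' ⊢
      rw [a', b']
  smul_mem' := by
    rintro d η ⟨h1, h2⟩
    refine ⟨fun e he => ?_, fun x c => ?_⟩
    · rw [Form.inChart_smul]; exact contDiffOn_const.smul (h1 e he)
    · ext v
      have a' := DFunLike.congr_fun (h2 x c) v
      simp only [ContinuousAlternatingMap.compContinuousLinearMap_apply, Pi.smul_apply,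
        ContinuousAlternatingMap.smul_apply] at a' ⊢
      rw [a', smul_comm]

/-- The `∂̄`-closed smooth forms of type `(p, q)`. -/
def dbarClosed (p q : ℕ) : Submodule ℂ (Form E X (p + q)) where
  carrier := {η | η ∈ smoothForms E X p q ∧ η.HasDbar 0}
  zero_mem' := ⟨zero_mem _, .zero⟩
  add_mem' := by
    rintro η θ ⟨h1, h2⟩ ⟨h1', h2'⟩
    exact ⟨add_mem h1 h1', by simpa using Form.HasDbar.add h1.1 h1'.1 h2 h2'⟩
  smul_mem' := by
    rintro c η ⟨h1, h2⟩
    exact ⟨Submodule.smul_mem _ c h1, by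
      have h := Form.HasDbar.smul h1.1 c h2
      rwa [smul_zero] at h⟩

/-- The `∂̄`-exact smooth forms of type `(p, q)`, that is, `∂̄ (∧^{p,q-1} X)`. -/
def dbarExact (p : ℕ) : (q : ℕ) → Submodule ℂ (Form E X (p + q))
  | 0 => ⊥
  | q + 1 =>
    { carrier := {θ | θ ∈ smoothForms E X p (q + 1) ∧
        ∃ η ∈ smoothForms E X p q, Form.HasDbar η θ}
      zero_mem' := ⟨zero_mem _, 0, zero_mem _, .zero⟩
      add_mem' := by
        rintro θ θ' ⟨h, η, h1, h2⟩ ⟨h', η', h1', h2'⟩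
        exact ⟨add_mem h h', η + η', add_mem h1 h1', Form.HasDbar.add h1.1 h1'.1 h2 h2'⟩
      smul_mem' := by
        rintro c θ ⟨h, η, h1, h2⟩
        exact ⟨Submodule.smul_mem _ c h, c • η, Submodule.smul_mem _ c h1,
          Form.HasDbar.smul h1.1 c h2⟩ }

/-- The Dolbeault cohomology `H^{p,q}_{∂̄}(X)`. -/
abbrev DolbeaultCohomology (p q : ℕ) : Type _ :=
  dbarClosed E X p q ⧸ (dbarExact E X p q).submoduleOf (dbarClosed E X p q)

/-- The Hodge number `h^{p,q}(X)`, as a cardinal number. -/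
def hodgeNumber (p q : ℕ) : Cardinal := Module.rank ℂ (DolbeaultCohomology E X p q)

end Dolbeault

section Meromorphic

variable (E : Type*) [NormedAddCommGroup E] [NormedSpace ℂ E]
variable {X : Type*} [TopologicalSpace X] [ChartedSpace E X]

/-- `f` is holomorphic in a neighbourhood of `x`. -/
def HolomorphicNear (f : X → ℂ) (x : X) : Prop :=
  ∀ᶠ y in 𝓝 x, MDifferentiableAt 𝓘(ℂ, E) 𝓘(ℂ, ℂ) f y

variable {E} in
theorem HolomorphicNear.add {f g : X → ℂ} {x : X} (hf : HolomorphicNear E f x)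
    (hg : HolomorphicNear E g x) : HolomorphicNear E (f + g) x := by
  filter_upwards [hf, hg] with y h h' using h.add h'

variable {E} in
theorem HolomorphicNear.mul {f g : X → ℂ} {x : X} (hf : HolomorphicNear E f x)
    (hg : HolomorphicNear E g x) : HolomorphicNear E (f * g) x := by
  filter_upwards [hf, hg] with y h h' using h.mul h'

theorem HolomorphicNear.const (c : ℂ) (x : X) : HolomorphicNear E (fun _ : X => c) x :=
  .of_forall fun _ => mdifferentiableAt_const

/-- The local ring `𝒪_{X,x}` of germs at `x` of holomorphic functions. -/
def holomorphicGerms (x : X) : Subring (Filter.Germ (𝓝 x) ℂ) where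
  carrier := {φ | ∃ f : X → ℂ, HolomorphicNear E f x ∧ (f : Filter.Germ (𝓝 x) ℂ) = φ}
  zero_mem' := ⟨fun _ => 0, .const E 0 x, rfl⟩
  one_mem' := ⟨fun _ => 1, .const E 1 x, rfl⟩
  add_mem' := by
    rintro _ _ ⟨f, hf, rfl⟩ ⟨g, hg, rfl⟩; exact ⟨f + g, hf.add hg, rfl⟩
  mul_mem' := by
    rintro _ _ ⟨f, hf, rfl⟩ ⟨g, hg, rfl⟩; exact ⟨f * g, hf.mul hg, rfl⟩
  neg_mem' := by
    rintro _ ⟨f, hf, rfl⟩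
    refine ⟨(fun _ => -1) * f, (HolomorphicNear.const E (-1) x).mul hf, ?_⟩
    rw [show (fun _ => -1) * f = -f by ext; simp]; rfl

/-- The germ at `x` of a function which is holomorphic near `x`. -/
def holomorphicGerm {x : X} (f : X → ℂ) (hf : HolomorphicNear E f x) : holomorphicGerms E x :=
  ⟨(f : Filter.Germ (𝓝 x) ℂ), f, hf, rfl⟩

/-- Constant functions make `𝒪_{X,x}` a `ℂ`-algebra. -/
def constGerm (x : X) : ℂ →+* holomorphicGerms E x where
  toFun c := holomorphicGerm E (fun _ => c) (.const E c x)
  map_zero' := rfl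
  map_one' := rfl
  map_add' _ _ := rfl
  map_mul' _ _ := rfl

instance (x : X) : Algebra ℂ (holomorphicGerms E x) := (constGerm E x).toAlgebra

/-- The stalk at `x` of the sheaf of meromorphic functions: the total ring of fractions of
`𝒪_{X,x}`. -/
abbrev MeromorphicGerms (x : X) : Type _ := FractionRing (holomorphicGerms E x)

/-- The family of meromorphic germs `s` is given near `x` by the quotient `g / h` of two
holomorphic functions, the germs of `h` being nonzerodivisors. -/
def IsQuotientNear (s : (x : X) → MeromorphicGerms E x) (x : X) (g h : X → ℂ) : Prop :=
  ∀ᶠ y in 𝓝 x, ∃ (hg : HolomorphicNear E g y) (hh : HolomorphicNear E h y)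
    (h0 : holomorphicGerm E h hh ∈ nonZeroDivisors (holomorphicGerms E y)),
    s y = Localization.mk (holomorphicGerm E g hg) ⟨holomorphicGerm E h hh, h0⟩

variable (X)

/-- The `ℂ`-algebra `ℳ(X)` of meromorphic functions on `X`: families of meromorphic germs which
are locally given by a quotient of two holomorphic functions. -/
def meromorphicFunctions : Subalgebra ℂ ((x : X) → MeromorphicGerms E x) where
  carrier := {s | ∀ x, ∃ g h : X → ℂ, IsQuotientNear E s x g h}
  algebraMap_mem' c x := by
    refine ⟨fun _ => c, fun _ => 1, .of_forall fun y =>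
      ⟨.const E c y, .const E 1 y, one_mem _, ?_⟩⟩
    rw [Pi.algebraMap_apply, IsScalarTower.algebraMap_apply ℂ (holomorphicGerms E y)]
    exact (Localization.mk_one_eq_algebraMap _).symm
  add_mem' := by
    intro s t hs ht x
    obtain ⟨g, h, H⟩ := hs x
    obtain ⟨g', h', H'⟩ := ht x
    refine ⟨h * g' + h' * g, h * h', ?_⟩
    filter_upwards [H, H'] with y ⟨a, b, c, d⟩ ⟨a', b', c', d'⟩
    refine ⟨(b.mul a').add (b'.mul a), b.mul b', mul_mem c c', ?_⟩
    rw [Pi.add_apply, d, d', Localization.add_mk]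
    rfl
  mul_mem' := by
    intro s t hs ht x
    obtain ⟨g, h, H⟩ := hs x
    obtain ⟨g', h', H'⟩ := ht x
    refine ⟨g * g', h * h', ?_⟩
    filter_upwards [H, H'] with y ⟨a, b, c, d⟩ ⟨a', b', c', d'⟩
    refine ⟨a.mul a', b.mul b', mul_mem c c', ?_⟩
    rw [Pi.mul_apply, d, d', Localization.mk_mul]
    rfl

/-- The algebraic dimension `a(X)`: the transcendence degree over `ℂ` of `ℳ(X)`. -/
def algebraicDimension : Cardinal := Algebra.trdeg ℂ (meromorphicFunctions E X)

end Meromorphic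

end ComplexManifold

end

/-! It suffices to find a nontrivial linear relation between any two holomorphic one-forms ω, ω'.
The form T = ω ∧ dω' has type (3,0), and dT = dω ∧ dω' has type (4,0), so it vanishes in dimension
three. A closed three-form on S⁶ is exact, hence ∫ T ∧ T̄ = 0 by Stokes. Locally T = f dz₁ ∧ dz₂ ∧
dz₃, and T ∧ T̄ is |f|² times a volume form whose sign is fixed by the complex orientation, up to a
constant phase. Hence f = 0, that is, ω ∧ dω' = 0 (`AntipodalCharts.wedge_eq_zero`).

Applied to all four pairs, this says that dω and dω' have zero wedge product with both ω and ω'. By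
linear algebra in dimension three they are multiples of ω ∧ ω' wherever the latter is nonzero. If ω
∧ ω' is not identically zero, the ratios are meromorphic functions, which are constant because a(X)
= 0 (`IsHolomorphicTensor.exists_eq_const_mul`). So dω = c ω ∧ ω' and dω' = c' ω ∧ ω', and a
nontrivial combination of ω and ω' is closed. A closed holomorphic one-form on X is the differential
of a holomorphic function, which is constant by compactness, so this combination is zero
(`AntipodalCharts.eq_zero_of_closed`). If ω ∧ ω' = 0 identically, then either ω' = 0 or the ratio ω
/ ω' is itself a constant.

The topology of S⁶ enters through two antipodal stereographic projections. On ℝ⁶ the homotopy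
formula gives a bounded primitive of T, Stokes becomes integration by parts against cutoffs, and
smoothness of T at the missing point becomes the decay ‖T x‖ = O(‖x‖⁻⁶), which makes the boundary
terms O(1/n) (`eq_zero_of_isClosedField_of_decay`). -/

noncomputable section

namespace ComplexManifold

/-! ### The Poincaré lemma for three-forms on a vector space, with a bound on the primitive -/

section PoincareLemma

open MeasureTheory Set

variable {V W : Type*} [NormedAddCommGroup V] [NormedSpace ℝ V] [FiniteDimensional ℝ V]
  [NormedAddCommGroup W] [NormedSpace ℝ W] [CompleteSpace W]

omit [FiniteDimensional ℝ V] [CompleteSpace W] in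
theorem continuous_fderiv_of_contDiff_uncurry {k : V → ℝ → W}
    (hk : ContDiff ℝ 1 (fun p : V × ℝ => k p.1 p.2)) :
    Continuous (fun p : V × ℝ => fderiv ℝ (fun y => k y p.2) p.1) := by
  have h : ContDiff ℝ 1 (Function.uncurry (fun (p : V × ℝ) (y : V) => k y p.2)) :=
    hk.comp (contDiff_snd.prodMk (contDiff_snd.comp contDiff_fst))
  exact (ContDiff.fderiv (n := 0) h contDiff_fst le_rfl).continuous

omit [CompleteSpace W] in
theorem hasFDerivAt_intervalIntegral_of_contDiff {k : V → ℝ → W}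
    (hk : ContDiff ℝ 1 (fun p : V × ℝ => k p.1 p.2)) (x : V) :
    HasFDerivAt (fun y => ∫ t in (0 : ℝ)..1, k y t)
      (∫ t in (0 : ℝ)..1, fderiv ℝ (fun y => k y t) x) x := by
  have hd := continuous_fderiv_of_contDiff_uncurry hk
  have hc (y : V) : Continuous (k y) := hk.continuous.comp (by fun_prop : Continuous fun t => (y, t))
  have hdx (y : V) : Continuous (fun t => fderiv ℝ (fun y => k y t) y) :=
    hd.comp (by fun_prop : Continuous fun t : ℝ => (y, t))
  obtain ⟨C, hC⟩ := ((isCompact_closedBall x 1).prod (isCompact_Icc (a := (0 : ℝ)) (b := 1))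
    ).exists_bound_of_continuousOn hd.continuousOn
  refine intervalIntegral.hasFDerivAt_integral_of_dominated_of_fderiv_le
    (F' := fun y t => fderiv ℝ (fun y => k y t) y) (bound := fun _ => C)
    (Metric.closedBall_mem_nhds x one_pos)
    (.of_forall fun y => (hc y).aestronglyMeasurable)
    ((hc x).intervalIntegrable _ _) (hdx x).aestronglyMeasurable ?_
    intervalIntegrable_const ?_
  · refine .of_forall fun t ht y hy => hC (y, t) ⟨hy, ?_⟩
    rw [uIoc_of_le zero_le_one] at ht
    exact Ioc_subset_Icc_self ht
  · refine .of_forall fun t _ y _ => ?_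
    have : ContDiff ℝ 1 (fun y => k y t) := hk.comp (contDiff_id.prodMk contDiff_const)
    exact (this.differentiable one_ne_zero y).hasFDerivAt

omit [CompleteSpace W] in
theorem contDiff_intervalIntegral_of_contDiff {k : V → ℝ → W}
    (hk : ContDiff ℝ 1 (fun p : V × ℝ => k p.1 p.2)) :
    ContDiff ℝ 1 (fun y => ∫ t in (0 : ℝ)..1, k y t) := by
  refine contDiff_one_iff_fderiv.2
    ⟨fun x => (hasFDerivAt_intervalIntegral_of_contDiff hk x).differentiableAt, ?_⟩
  rw [funext fun x => (hasFDerivAt_intervalIntegral_of_contDiff hk x).fderiv]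
  exact intervalIntegral.continuous_parametric_intervalIntegral_of_continuous'
    (continuous_fderiv_of_contDiff_uncurry hk) 0 1

/-- A field of trilinear forms is alternating. -/
structure IsAlternating (T : V → V →L[ℝ] V →L[ℝ] V →L[ℝ] ℂ) : Prop where
  swap_left : ∀ x u v w, T x v u w = - T x u v w
  swap_right : ∀ x u v w, T x u w v = - T x u v w

/-- The exterior derivative of a field of trilinear forms vanishes. -/
def IsClosedField (T : V → V →L[ℝ] V →L[ℝ] V →L[ℝ] ℂ) : Prop :=
  ∀ x a b c d, fderiv ℝ T x a b c d - fderiv ℝ T x b a c d + fderiv ℝ T x c a b d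
    - fderiv ℝ T x d a b c = 0

/-- The primitive `x ↦ ∫₀¹ t² T(tx)(x, ·, ·) dt` of a closed field of alternating trilinear forms
given by the homotopy formula. -/
def radialPrimitive (T : V → V →L[ℝ] V →L[ℝ] V →L[ℝ] ℂ) (x : V) : V →L[ℝ] V →L[ℝ] ℂ :=
  ∫ t in (0 : ℝ)..1, t ^ 2 • T (t • x) x

variable {T : V → V →L[ℝ] V →L[ℝ] V →L[ℝ] ℂ}

omit [FiniteDimensional ℝ V] in
theorem contDiff_radialPrimitive_integrand (hT : ContDiff ℝ 1 T) :
    ContDiff ℝ 1 (fun p : V × ℝ => p.2 ^ 2 • T (p.2 • p.1) p.1) := by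
  fun_prop

theorem contDiff_radialPrimitive (hT : ContDiff ℝ 1 T) : ContDiff ℝ 1 (radialPrimitive T) :=
  contDiff_intervalIntegral_of_contDiff (contDiff_radialPrimitive_integrand hT)

omit [FiniteDimensional ℝ V] in
theorem fderiv_radialPrimitive_integrand (hT : ContDiff ℝ 1 T) (x w : V) (t : ℝ) :
    fderiv ℝ (fun y => t ^ 2 • T (t • y) y) x w =
      t ^ 2 • T (t • x) w + t ^ 3 • fderiv ℝ T (t • x) w x := by
  have h1 : HasFDerivAt (fun y : V => T (t • y))
      ((fderiv ℝ T (t • x)).comp (t • ContinuousLinearMap.id ℝ V)) x :=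
    (hT.differentiable one_ne_zero (t • x)).hasFDerivAt.comp x ((hasFDerivAt_id x).const_smul t)
  have h2 : HasFDerivAt (fun y => t ^ 2 • T (t • y) y) _ x :=
    (h1.clm_apply (hasFDerivAt_id x)).const_smul (t ^ 2)
  rw [h2.fderiv]
  ext u v
  simp
  ring

theorem fderiv_radialPrimitive_apply (hT : ContDiff ℝ 1 T) (x w u v : V) :
    fderiv ℝ (radialPrimitive T) x w u v =
      ∫ t in (0 : ℝ)..1, (t ^ 2 • T (t • x) w u v + t ^ 3 • fderiv ℝ T (t • x) w x u v) := by
  have hk := contDiff_radialPrimitive_integrand hT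
  have hd : Continuous (fun t : ℝ => fderiv ℝ (fun y => t ^ 2 • T (t • y) y) x) :=
    (continuous_fderiv_of_contDiff_uncurry (k := fun x t => t ^ 2 • T (t • x) x) hk).comp
      (by fun_prop : Continuous fun t : ℝ => (x, t))
  have h1 := (hasFDerivAt_intervalIntegral_of_contDiff
    (k := fun x t => t ^ 2 • T (t • x) x) hk x).fderiv
  change fderiv ℝ (radialPrimitive T) x = _ at h1
  rw [h1, ContinuousLinearMap.intervalIntegral_apply (hd.intervalIntegrable _ _),
    ContinuousLinearMap.intervalIntegral_apply ((hd.clm_apply continuous_const).intervalIntegrable _ _),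
    ContinuousLinearMap.intervalIntegral_apply
      (((hd.clm_apply continuous_const).clm_apply continuous_const).intervalIntegrable _ _)]
  refine intervalIntegral.integral_congr fun t _ => ?_
  simp only [fderiv_radialPrimitive_integrand hT, add_apply, smul_apply]

/-- The Poincaré lemma for fields of alternating trilinear forms. -/
theorem extDeriv_radialPrimitive (hT : ContDiff ℝ 1 T) (ha : IsAlternating T)
    (hc : IsClosedField T) (x u v w : V) :
    fderiv ℝ (radialPrimitive T) x u v w - fderiv ℝ (radialPrimitive T) x v u w
      + fderiv ℝ (radialPrimitive T) x w u v = T x u v w := by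
  have hTc := hT.continuous
  have hDc := hT.continuous_fderiv one_ne_zero
  have hi (a b c : V) : IntervalIntegrable
      (fun t : ℝ => t ^ 2 • T (t • x) a b c + t ^ 3 • fderiv ℝ T (t • x) a x b c) volume 0 1 := by
    apply Continuous.intervalIntegrable
    fun_prop
  rw [fderiv_radialPrimitive_apply hT, fderiv_radialPrimitive_apply hT,
    fderiv_radialPrimitive_apply hT, ← intervalIntegral.integral_sub (hi _ _ _) (hi _ _ _),
    ← intervalIntegral.integral_add ((hi _ _ _).sub (hi _ _ _)) (hi _ _ _)]
  -- Closedness at t • x trades the derivatives in the directions u, v, w for the one in the radial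
  -- direction x; the integrand then becomes the t-derivative of t³ T(tx)(u, v, w).
  have hder (t : ℝ) : HasDerivAt (fun t : ℝ => t ^ 3 • T (t • x) u v w)
      (t ^ 3 • fderiv ℝ T (t • x) x u v w + (3 * t ^ 2) • T (t • x) u v w) t := by
    have h1 : HasDerivAt (fun t : ℝ => T (t • x)) (fderiv ℝ T (t • x) x) t := by
      have := (hT.differentiable one_ne_zero (t • x)).hasFDerivAt.comp_hasDerivAt t
        ((hasDerivAt_id t).smul_const x)
      simpa using! this
    have h2 : HasDerivAt (fun t : ℝ => T (t • x) u v w) (fderiv ℝ T (t • x) x u v w) t := by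
      have e (L : V →L[ℝ] V →L[ℝ] V →L[ℝ] ℂ) : L u v w =
        ((ContinuousLinearMap.apply ℝ ℂ w).comp ((ContinuousLinearMap.apply ℝ (V →L[ℝ] ℂ) v).comp
          (ContinuousLinearMap.apply ℝ (V →L[ℝ] V →L[ℝ] ℂ) u))) L := rfl
      simp only [e]
      exact (ContinuousLinearMap.hasFDerivAt _).comp_hasDerivAt t h1
    have h3 : HasDerivAt (fun t : ℝ => t ^ 3 • T (t • x) u v w) _ t := (hasDerivAt_pow 3 t).smul h2
    convert h3 using 1
    norm_num
  have key := intervalIntegral.integral_eq_sub_of_hasDerivAt (a := 0) (b := 1)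
    (fun t _ => hder t) (Continuous.intervalIntegrable (by fun_prop) _ _)
  simp only [one_pow, one_smul, ne_eq, OfNat.ofNat_ne_zero, not_false_eq_true, zero_pow,
    zero_smul, sub_zero] at key
  rw [← key]
  refine intervalIntegral.integral_congr fun t _ => ?_
  have h1 := hc (t • x) x u v w
  have h2 := ha.swap_left (t • x) u v w
  have h3 : T (t • x) w u v = T (t • x) u v w := by
    rw [ha.swap_left, ha.swap_right, neg_neg]
  simp only [h2, h3, Complex.real_smul]
  push_cast
  linear_combination (-(t : ℂ) ^ 3) * h1

omit [FiniteDimensional ℝ V] in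
-- For 0 < t ≤ 1 the integrand is at most t² ‖x‖ ‖T(tx)‖ ≤ ‖tx‖ ‖T(tx)‖. Decay of first order is
-- thus enough for a bounded primitive.
theorem norm_radialPrimitive_le {C : ℝ} (hC : ∀ x, ‖x‖ * ‖T x‖ ≤ C) (x : V) :
    ‖radialPrimitive T x‖ ≤ C := by
  have := intervalIntegral.norm_integral_le_of_norm_le_const (a := 0) (b := 1)
    (f := fun t : ℝ => t ^ 2 • T (t • x) x) (C := C) ?_
  · simpa using! this
  intro t ht
  rw [uIoc_of_le zero_le_one] at ht
  have h0 := hC (t • x)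
  rw [norm_smul, Real.norm_of_nonneg ht.1.le] at h0
  have h1 : 0 ≤ ‖T (t • x)‖ * ‖x‖ := by positivity
  calc ‖t ^ 2 • T (t • x) x‖ ≤ t ^ 2 * (‖T (t • x)‖ * ‖x‖) := by
        rw [norm_smul, Real.norm_of_nonneg (by positivity)]
        gcongr
        exact (T (t • x)).le_opNorm x
    _ ≤ t * (‖T (t • x)‖ * ‖x‖) := by
        gcongr
        nlinarith [ht.1, ht.2]
    _ ≤ C := by linarith

end PoincareLemma

/-! ### Signed sums over S₆, as a computational form of wedge products in degree six -/

section SignedSum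

open Equiv

/-- The signed sum of a function over all permutations of six letters. -/
def signedSum (Φ : Perm (Fin 6) → ℂ) : ℂ := ∑ π : Perm (Fin 6), ((Perm.sign π : ℤ) : ℂ) * Φ π

/-- Reindexing by right multiplication. Right multiplication permutes the six slots, so each
exchange of slots in the lemmas below costs its sign. -/
theorem signedSum_comp_mul (Φ : Perm (Fin 6) → ℂ) (ρ : Perm (Fin 6)) :
    signedSum (fun π => Φ (π * ρ)) = ((Perm.sign ρ : ℤ) : ℂ) * signedSum Φ := by
  unfold signedSum
  rw [← Equiv.sum_comp (Equiv.mulRight ρ) (fun π => ((Perm.sign π : ℤ) : ℂ) * Φ π), Finset.mul_sum]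
  refine Finset.sum_congr rfl fun π _ => ?_
  have h : ((Perm.sign ρ : ℤ) : ℂ) * ((Perm.sign ρ : ℤ) : ℂ) = 1 := by
    rw [← Int.cast_mul, ← Units.val_mul, Int.units_mul_self]; simp
  simp only [Equiv.coe_mulRight, Perm.sign_mul, Units.val_mul, Int.cast_mul]
  linear_combination (-((Perm.sign π : ℤ) : ℂ) * Φ (π * ρ)) * h

theorem signedSum_add (Φ Ψ : Perm (Fin 6) → ℂ) :
    signedSum (fun π => Φ π + Ψ π) = signedSum Φ + signedSum Ψ := by
  simp only [signedSum, mul_add, Finset.sum_add_distrib]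

theorem signedSum_sub (Φ Ψ : Perm (Fin 6) → ℂ) :
    signedSum (fun π => Φ π - Ψ π) = signedSum Φ - signedSum Ψ := by
  simp only [signedSum, mul_sub, Finset.sum_sub_distrib]

theorem signedSum_const_mul (c : ℂ) (Φ : Perm (Fin 6) → ℂ) :
    signedSum (fun π => c * Φ π) = c * signedSum Φ := by
  simp only [signedSum, Finset.mul_sum]
  exact Finset.sum_congr rfl fun _ _ => by ring

theorem norm_signedSum_le {Φ : Perm (Fin 6) → ℂ} {C : ℝ} (h : ∀ π, ‖Φ π‖ ≤ C) :
    ‖signedSum Φ‖ ≤ 720 * C := by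
  have : ‖signedSum Φ‖ ≤ ∑ _π : Perm (Fin 6), C := by
    refine norm_sum_le_of_le _ fun π _ => ?_
    rw [norm_mul]
    rcases Int.units_eq_one_or (Perm.sign π) with e | e <;> simpa [e] using h π
  refine this.trans_eq ?_
  rw [Finset.sum_const, Finset.card_univ, Fintype.card_perm, Fintype.card_fin]
  norm_num [Nat.factorial]

/-- Antisymmetrizing a function of three letters in the first three slots of a signed sum. -/
theorem signedSum_antisymm_three (f g : Fin 6 → Fin 6 → Fin 6 → ℂ) :
    signedSum (fun π => (f (π 0) (π 1) (π 2) - f (π 1) (π 0) (π 2) + f (π 2) (π 0) (π 1))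
      * g (π 3) (π 4) (π 5)) =
    3 * signedSum (fun π => f (π 0) (π 1) (π 2) * g (π 3) (π 4) (π 5)) := by
  set Φ : Perm (Fin 6) → ℂ := fun π => f (π 0) (π 1) (π 2) * g (π 3) (π 4) (π 5) with hΦ
  have h1 := signedSum_comp_mul Φ (swap 0 1)
  have h2 := signedSum_comp_mul Φ (swap 0 1 * swap 0 2)
  have s1 : Perm.sign (swap (0 : Fin 6) 1) = -1 := by decide
  have s2 : Perm.sign (swap (0 : Fin 6) 1 * swap 0 2) = 1 := by decide
  have e1 : (fun π => Φ (π * swap 0 1)) =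
      fun π => f (π 1) (π 0) (π 2) * g (π 3) (π 4) (π 5) := rfl
  have e2 : (fun π => Φ (π * (swap 0 1 * swap 0 2))) =
      fun π => f (π 2) (π 0) (π 1) * g (π 3) (π 4) (π 5) := rfl
  rw [e1, s1] at h1
  rw [e2, s2] at h2
  simp only [add_mul, sub_mul]
  rw [signedSum_add, signedSum_sub, h1, h2]
  push_cast
  ring

/-- A signed sum vanishes if the antisymmetrization of one of its factors in four slots does. -/
theorem signedSum_eq_zero_of_antisymm_four (f : Fin 6 → Fin 6 → ℂ)
    (g : Fin 6 → Fin 6 → Fin 6 → Fin 6 → ℂ)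
    (hg : ∀ a b c d, g a b c d - g b a c d + g c a b d - g d a b c = 0) :
    signedSum (fun π => f (π 1) (π 2) * g (π 0) (π 3) (π 4) (π 5)) = 0 := by
  set Φ : Perm (Fin 6) → ℂ := fun π => f (π 1) (π 2) * g (π 0) (π 3) (π 4) (π 5) with hΦ
  have h1 := signedSum_comp_mul Φ (swap 0 3)
  have h2 := signedSum_comp_mul Φ (swap 0 3 * swap 0 4)
  have h3 := signedSum_comp_mul Φ (swap 0 3 * swap 0 4 * swap 0 5)
  have s1 : Perm.sign (swap (0 : Fin 6) 3) = -1 := by decide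
  have s2 : Perm.sign (swap (0 : Fin 6) 3 * swap 0 4) = 1 := by decide
  have s3 : Perm.sign (swap (0 : Fin 6) 3 * swap 0 4 * swap 0 5) = -1 := by decide
  have e1 : (fun π => Φ (π * swap 0 3)) =
      fun π => f (π 1) (π 2) * g (π 3) (π 0) (π 4) (π 5) := rfl
  have e2 : (fun π => Φ (π * (swap 0 3 * swap 0 4))) =
      fun π => f (π 1) (π 2) * g (π 4) (π 0) (π 3) (π 5) := rfl
  have e3 : (fun π => Φ (π * (swap 0 3 * swap 0 4 * swap 0 5))) =
      fun π => f (π 1) (π 2) * g (π 5) (π 0) (π 3) (π 4) := rfl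
  rw [e1, s1] at h1
  rw [e2, s2] at h2
  rw [e3, s3] at h3
  have h4 : signedSum (fun π => f (π 1) (π 2) * g (π 0) (π 3) (π 4) (π 5)
      - f (π 1) (π 2) * g (π 3) (π 0) (π 4) (π 5) + f (π 1) (π 2) * g (π 4) (π 0) (π 3) (π 5)
      - f (π 1) (π 2) * g (π 5) (π 0) (π 3) (π 4)) = 0 := by
    unfold signedSum
    refine Finset.sum_eq_zero fun π _ => ?_
    linear_combination (((Perm.sign π : ℤ) : ℂ) * f (π 1) (π 2)) * hg (π 0) (π 3) (π 4) (π 5)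
  -- The signs of the three permutations cancel the alternating signs of `hg`, so the four terms add
  -- up to four copies of the same sum.
  rw [signedSum_sub, signedSum_add, signedSum_sub, h1, h2, h3] at h4
  push_cast at h4
  linear_combination h4 / 4

end SignedSum

/-! ### Stokes' formula for compactly supported forms, by integration by parts -/

section Stokes

open MeasureTheory Set

variable {V : Type*} [NormedAddCommGroup V] [NormedSpace ℝ V] [FiniteDimensional ℝ V]
  [MeasurableSpace V] [BorelSpace V] {μ : Measure V} [μ.IsAddHaarMeasure]

/-- Integration by parts against the constant function 1. -/
theorem integral_fderiv_apply_eq_zero {G : V → ℂ} (hG : ContDiff ℝ 1 G)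
    (hs : HasCompactSupport G) (v : V) : ∫ x, fderiv ℝ G x v ∂μ = 0 := by
  have hd : Integrable (fun x => fderiv ℝ G x v) μ :=
    ((hG.continuous_fderiv one_ne_zero).clm_apply continuous_const).integrable_of_hasCompactSupport
      (hs.fderiv_apply (𝕜 := ℝ) v)
  have h := integral_mul_fderiv_eq_neg_fderiv_mul_of_integrable (μ := μ) (f := fun _ : V => (1 : ℂ))
    (g := G) (v := v) (by simp) (by simpa using hd)
    (by simpa using hG.continuous.integrable_of_hasCompactSupport hs)
    (fun _ _ => differentiableAt_const _) (fun x _ => hG.differentiable one_ne_zero x)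
  simpa using h

variable {T T' : V → V →L[ℝ] V →L[ℝ] V →L[ℝ] ℂ}

/-- The pairing of two fields of trilinear forms: up to a factor, the value of `T ∧ T'` on the
vectors `b`. -/
def wedgePairing (b : Fin 6 → V) (T T' : V → V →L[ℝ] V →L[ℝ] V →L[ℝ] ℂ) (x : V) : ℂ :=
  signedSum fun π => T x (b (π 0)) (b (π 1)) (b (π 2)) * T' x (b (π 3)) (b (π 4)) (b (π 5))

omit [FiniteDimensional ℝ V] [MeasurableSpace V] [BorelSpace V] in
theorem continuous_wedgePairing (b : Fin 6 → V) (hT : Continuous T) (hT' : Continuous T') :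
    Continuous (wedgePairing b T T') := by
  unfold wedgePairing signedSum
  fun_prop

/-- With α the radial primitive of T and T' closed, d(χ α ∧ T') = dχ ∧ α ∧ T' + χ T ∧ T', and the
left side integrates to zero. The factor 3 arises because T = dα is a signed sum of three
derivatives of α, which all contribute equally to the pairing. -/
theorem integral_mul_wedgePairing (hT : ContDiff ℝ 1 T) (ha : IsAlternating T)
    (hc : IsClosedField T) (hT' : ContDiff ℝ 1 T') (hc' : IsClosedField T') (b : Fin 6 → V)
    {χ : V → ℝ} (hχ : ContDiff ℝ 1 χ) (hs : HasCompactSupport χ) :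
    ∫ x, (χ x : ℂ) * wedgePairing b T T' x ∂μ =
      - 3 * ∫ x, signedSum (fun π => (fderiv ℝ χ x (b (π 0)) : ℂ) *
        (radialPrimitive T x (b (π 1)) (b (π 2)) * T' x (b (π 3)) (b (π 4)) (b (π 5)))) ∂μ := by
  set α := radialPrimitive T with hα
  have hαc : ContDiff ℝ 1 α := contDiff_radialPrimitive hT
  have hα0 := hαc.continuous
  have hT0 := hT'.continuous
  have hαd := hαc.continuous_fderiv one_ne_zero
  have hTd := hT'.continuous_fderiv one_ne_zero
  have hχ0 := hχ.continuous
  have hχd := hχ.continuous_fderiv one_ne_zero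
  set G : Equiv.Perm (Fin 6) → V → ℂ := fun π x =>
    (χ x : ℂ) * (α x (b (π 1)) (b (π 2)) * T' x (b (π 3)) (b (π 4)) (b (π 5))) with hG
  have hχC : ContDiff ℝ 1 (fun x => (χ x : ℂ)) := Complex.ofRealCLM.contDiff.comp hχ
  have hGc (π) : ContDiff ℝ 1 (G π) := by
    refine hχC.mul (ContDiff.mul ?_ ?_) <;> fun_prop
  have hsC : HasCompactSupport (fun x => (χ x : ℂ)) :=
    hs.comp_left (g := fun r : ℝ => (r : ℂ)) (by simp)
  have hGs (π) : HasCompactSupport (G π) := hsC.mul_right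
  have hder (π : Equiv.Perm (Fin 6)) (x : V) : fderiv ℝ (G π) x (b (π 0)) =
      (fderiv ℝ χ x (b (π 0)) : ℂ) *
        (α x (b (π 1)) (b (π 2)) * T' x (b (π 3)) (b (π 4)) (b (π 5)))
      + (χ x : ℂ) * (fderiv ℝ α x (b (π 0)) (b (π 1)) (b (π 2)) *
          T' x (b (π 3)) (b (π 4)) (b (π 5)))
      + (χ x : ℂ) * (α x (b (π 1)) (b (π 2)) *
          fderiv ℝ T' x (b (π 0)) (b (π 3)) (b (π 4)) (b (π 5))) := by
    have h1 : HasFDerivAt (fun x => (χ x : ℂ)) (Complex.ofRealCLM.comp (fderiv ℝ χ x)) x :=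
      Complex.ofRealCLM.hasFDerivAt.comp x (hχ.differentiable one_ne_zero x).hasFDerivAt
    have h2 := ((hαc.differentiable one_ne_zero x).hasFDerivAt.clm_apply
      (hasFDerivAt_const (b (π 1)) x)).clm_apply (hasFDerivAt_const (b (π 2)) x)
    have h3 := (((hT'.differentiable one_ne_zero x).hasFDerivAt.clm_apply
      (hasFDerivAt_const (b (π 3)) x)).clm_apply (hasFDerivAt_const (b (π 4)) x)).clm_apply
      (hasFDerivAt_const (b (π 5)) x)
    have h4 : HasFDerivAt (G π) _ x := h1.mul (h2.mul h3)
    rw [h4.fderiv]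
    simp
    ring
  have hint (π) : Integrable (fun x => fderiv ℝ (G π) x (b (π 0))) μ :=
    (((hGc π).continuous_fderiv one_ne_zero).clm_apply
      continuous_const).integrable_of_hasCompactSupport ((hGs π).fderiv_apply (𝕜 := ℝ) _)
  have h0 : ∫ x, signedSum (fun π => fderiv ℝ (G π) x (b (π 0))) ∂μ = 0 := by
    unfold signedSum
    rw [integral_finsetSum _ fun π _ => (hint π).const_mul _]
    refine Finset.sum_eq_zero fun π _ => ?_
    rw [integral_const_mul, integral_fderiv_apply_eq_zero (hGc π) (hGs π), mul_zero]
  -- Of the three terms of the product rule, the one with the derivative of α becomes a third of the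
  -- pairing by the Poincaré lemma, and the one with the derivative of T' vanishes because T' is
  -- closed.
  have hpt (x : V) : signedSum (fun π => fderiv ℝ (G π) x (b (π 0))) =
      signedSum (fun π => (fderiv ℝ χ x (b (π 0)) : ℂ) *
        (α x (b (π 1)) (b (π 2)) * T' x (b (π 3)) (b (π 4)) (b (π 5))))
      + (1 / 3) * ((χ x : ℂ) * wedgePairing b T T' x) := by
    have e1 := signedSum_antisymm_three (fun i j k => fderiv ℝ α x (b i) (b j) (b k))
      (fun i j k => T' x (b i) (b j) (b k))
    simp only [hα, extDeriv_radialPrimitive hT ha hc] at e1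
    have e2 := signedSum_eq_zero_of_antisymm_four (fun i j => α x (b i) (b j))
      (fun i j k l => fderiv ℝ T' x (b i) (b j) (b k) (b l)) (fun i j k l => hc' x _ _ _ _)
    simp only [hder]
    rw [signedSum_add, signedSum_add, signedSum_const_mul, signedSum_const_mul, e2, wedgePairing, e1]
    ring
  simp only [hpt] at h0
  rw [integral_add] at h0
  · rw [integral_const_mul] at h0
    linear_combination 3 * h0
  · refine Continuous.integrable_of_hasCompactSupport (by unfold signedSum; fun_prop) ?_
    refine (hs.fderiv (𝕜 := ℝ)).mono fun x hx => ?_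
    contrapose! hx
    simp only [Function.notMem_support] at hx ⊢
    simp [hx, signedSum]
  · refine (Continuous.integrable_of_hasCompactSupport ?_ hsC.mul_right).const_mul _
    exact hχC.continuous.mul (continuous_wedgePairing b hT.continuous hT0)

end Stokes

/-! ### Cutoffs, and the vanishing of the boundary term at infinity -/

section Decay

open MeasureTheory Set Filter

variable {V : Type*} [NormedAddCommGroup V] [NormedSpace ℝ V] [FiniteDimensional ℝ V]

/-- A smooth function with compact support which is `1` on the ball of radius `n`. -/
def cutoff (V : Type*) [NormedAddCommGroup V] [NormedSpace ℝ V] [FiniteDimensional ℝ V]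
    (n : ℕ) (x : V) : ℝ :=
  (⟨1, 2, one_pos, one_lt_two⟩ : ContDiffBump (0 : V)) ((n : ℝ)⁻¹ • x)

theorem contDiff_cutoff (n : ℕ) : ContDiff ℝ 1 (cutoff V n) :=
  (ContDiffBump.contDiff _).comp (contDiff_const_smul _)

theorem cutoff_nonneg (n : ℕ) (x : V) : 0 ≤ cutoff V n x := ContDiffBump.nonneg _

theorem cutoff_le_one (n : ℕ) (x : V) : cutoff V n x ≤ 1 := ContDiffBump.le_one _

theorem cutoff_eq_one {n : ℕ} (hn : 0 < n) {x : V} (hx : ‖x‖ ≤ n) : cutoff V n x = 1 := by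
  refine ContDiffBump.one_of_mem_closedBall _ ?_
  have : (0 : ℝ) < n := by exact_mod_cast hn
  rw [mem_closedBall_zero_iff, norm_smul, norm_inv, Real.norm_natCast]
  exact (inv_mul_le_one₀ this).2 hx

theorem cutoff_eq_zero {n : ℕ} (hn : 0 < n) {x : V} (hx : 2 * n ≤ ‖x‖) : cutoff V n x = 0 := by
  refine ContDiffBump.zero_of_le_dist _ ?_
  have : (0 : ℝ) < n := by exact_mod_cast hn
  rw [dist_zero_right, norm_smul, norm_inv, Real.norm_natCast]
  change (2 : ℝ) ≤ _
  rw [le_inv_mul_iff₀ this]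
  linarith

/-- For n = 0 the convention 0⁻¹ = 0 makes the cutoff constantly 1, whence the positivity of n. -/
theorem hasCompactSupport_cutoff {n : ℕ} (hn : 0 < n) : HasCompactSupport (cutoff V n) := by
  refine HasCompactSupport.of_support_subset_isCompact (isCompact_closedBall 0 (2 * n)) ?_
  intro x hx
  rw [mem_closedBall_zero_iff]
  by_contra! h
  exact hx (cutoff_eq_zero hn h.le)

theorem fderiv_cutoff_eq_zero_of_lt {n : ℕ} (hn : 0 < n) {x : V} (hx : ‖x‖ < n) :
    fderiv ℝ (cutoff V n) x = 0 := by
  have : cutoff V n =ᶠ[𝓝 x] fun _ => 1 := by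
    filter_upwards [Metric.isOpen_ball.mem_nhds (mem_ball_zero_iff.2 hx)] with y hy
    exact cutoff_eq_one hn (mem_ball_zero_iff.1 hy).le
  rw [this.fderiv_eq]; simp

theorem fderiv_cutoff_eq_zero_of_gt {n : ℕ} (hn : 0 < n) {x : V} (hx : 2 * n < ‖x‖) :
    fderiv ℝ (cutoff V n) x = 0 := by
  have : cutoff V n =ᶠ[𝓝 x] fun _ => 0 := by
    filter_upwards [(continuous_norm.isOpen_preimage _ isOpen_Ioi).mem_nhds hx] with y hy
    exact cutoff_eq_zero hn (le_of_lt hy)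
  rw [this.fderiv_eq]; simp

/-- All cutoffs are rescalings of one bump function, so the chain rule yields the factor 1/n. -/
theorem exists_norm_fderiv_cutoff_le (V : Type*) [NormedAddCommGroup V] [NormedSpace ℝ V]
    [FiniteDimensional ℝ V] : ∃ K : ℝ, 0 ≤ K ∧ ∀ (n : ℕ) (x : V),
    ‖fderiv ℝ (cutoff V n) x‖ ≤ K * (n : ℝ)⁻¹ := by
  set f : ContDiffBump (0 : V) := ⟨1, 2, one_pos, one_lt_two⟩ with hf
  have hfc : ContDiff ℝ 1 f := f.contDiff
  obtain ⟨K, hK⟩ := (hfc.continuous_fderiv one_ne_zero).bounded_above_of_compact_support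
    (f.hasCompactSupport.fderiv (𝕜 := ℝ))
  refine ⟨K, (norm_nonneg _).trans (hK 0), fun n x => ?_⟩
  have h : HasFDerivAt (cutoff V n)
      ((fderiv ℝ f ((n : ℝ)⁻¹ • x)).comp ((n : ℝ)⁻¹ • ContinuousLinearMap.id ℝ V)) x :=
    (hfc.differentiable one_ne_zero _).hasFDerivAt.comp x ((hasFDerivAt_id x).const_smul _)
  rw [h.fderiv, ContinuousLinearMap.comp_smul, ContinuousLinearMap.comp_id, norm_smul, norm_inv,
    Real.norm_natCast, mul_comm]
  gcongr
  exact hK _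

variable [MeasurableSpace V] [BorelSpace V] {μ : Measure V} [μ.IsAddHaarMeasure]
variable {T T' : V → V →L[ℝ] V →L[ℝ] V →L[ℝ] ℂ}

/-- The integral of the wedge product of two closed forms of degree three on a six-dimensional
space vanishes if both decay fast enough at infinity. -/
theorem tendsto_integral_cutoff_mul_wedgePairing (hV : Module.finrank ℝ V = 6)
    (hT : ContDiff ℝ 1 T) (ha : IsAlternating T)
    (hc : IsClosedField T) (hT' : ContDiff ℝ 1 T') (hc' : IsClosedField T') (b : Fin 6 → V)
    {C C' : ℝ} (hC : ∀ x, ‖x‖ * ‖T x‖ ≤ C) (hC' : ∀ x, ‖x‖ ^ 6 * ‖T' x‖ ≤ C') :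
    Tendsto (fun n => ∫ x, (cutoff V n x : ℂ) * wedgePairing b T T' x ∂μ) atTop (𝓝 0) := by
  obtain ⟨K, hK0, hK⟩ := exists_norm_fderiv_cutoff_le V
  obtain ⟨B, hB⟩ : ∃ B, ∀ i, ‖b i‖ ≤ B :=
    ⟨∑ i, ‖b i‖, fun i => Finset.single_le_sum (fun i _ => norm_nonneg (b i)) (Finset.mem_univ i)⟩
  have hB0 : 0 ≤ B := (norm_nonneg _).trans (hB 0)
  have hC0 : 0 ≤ C := by have := hC 0; simpa using this
  have hC0' : 0 ≤ C' := by have := hC' 0; simpa using this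
  -- The derivative of the cutoff lives on the shell n ≤ ‖x‖ ≤ 2n, contained in a ball of volume
  -- (2n)⁶ times that of the unit ball. There dχ is at most K/n, the primitive at most C and T' at
  -- most C' n⁻⁶, so the integral is O(1/n). The factor B⁶ bounds the six vectors b, and 720 counts
  -- the permutations.
  set M : ℝ := 3 * (720 * (K * C * C' * B ^ 6 * (2 ^ 6 * μ.real (Metric.ball 0 1)))) with hM
  refine squeeze_zero_norm' (a := fun n : ℕ => M * (n : ℝ)⁻¹) ?_ ?_
  swap
  · simpa using (tendsto_inv_atTop_nhds_zero_nat (𝕜 := ℝ)).const_mul M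
  filter_upwards [eventually_gt_atTop 0] with n hn
  have hn' : (0 : ℝ) < n := by exact_mod_cast hn
  rw [integral_mul_wedgePairing hT ha hc hT' hc' b (contDiff_cutoff n) (hasCompactSupport_cutoff hn),
    norm_mul]
  set g : V → ℂ := fun x => signedSum (fun π => (fderiv ℝ (cutoff V n) x (b (π 0)) : ℂ) *
    (radialPrimitive T x (b (π 1)) (b (π 2)) * T' x (b (π 3)) (b (π 4)) (b (π 5)))) with hg
  have hg0 (x : V) (hx : x ∉ Metric.closedBall (0 : V) (2 * n)) : g x = 0 := by
    rw [mem_closedBall_zero_iff, not_le] at hx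
    simp [hg, fderiv_cutoff_eq_zero_of_gt hn hx, signedSum]
  have hgb (x : V) : ‖g x‖ ≤ 720 * (K * (n : ℝ)⁻¹ * C * (C' * ((n : ℝ)⁻¹) ^ 6) * B ^ 6) := by
    rcases lt_or_ge ‖x‖ n with h | h
    · have : g x = 0 := by simp [hg, fderiv_cutoff_eq_zero_of_lt hn h, signedSum]
      rw [this, norm_zero]
      positivity
    · refine norm_signedSum_le fun π => ?_
      have hx : ‖T' x‖ ≤ C' * ((n : ℝ)⁻¹) ^ 6 := by
        have h1 : (n : ℝ) ^ 6 * ‖T' x‖ ≤ C' := le_trans (by gcongr) (hC' x)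
        rw [inv_pow, ← div_eq_mul_inv, le_div_iff₀ (by positivity)]
        linarith
      have n1 : ‖(fderiv ℝ (cutoff V n) x (b (π 0)) : ℂ)‖ ≤ K * (n : ℝ)⁻¹ * B := by
        rw [Complex.norm_real]
        exact ((fderiv ℝ (cutoff V n) x).le_opNorm _).trans (by gcongr; exacts [hK n x, hB _])
      have n2 : ‖radialPrimitive T x (b (π 1)) (b (π 2))‖ ≤ C * B * B :=
        ((radialPrimitive T x).le_opNorm₂ _ _).trans
          (by gcongr; exacts [norm_radialPrimitive_le hC x, hB _, hB _])
      have n3 : ‖T' x (b (π 3)) (b (π 4)) (b (π 5))‖ ≤ (C' * ((n : ℝ)⁻¹) ^ 6) * B * B * B := by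
        refine ((T' x (b (π 3))).le_opNorm₂ _ _).trans ?_
        gcongr
        · refine ((T' x).le_opNorm _).trans ?_
          gcongr
          exact hB _
        · exact hB _
        · exact hB _
      rw [norm_mul, norm_mul]
      calc _ ≤ (K * (n : ℝ)⁻¹ * B) * ((C * B * B) * ((C' * ((n : ℝ)⁻¹) ^ 6) * B * B * B)) := by
            gcongr
        _ = _ := by ring
  have hvol : μ.real (Metric.closedBall (0 : V) (2 * n)) = (2 * n) ^ 6 * μ.real (Metric.ball 0 1) := by
    rw [measureReal_def, Measure.addHaar_closedBall μ 0 (by positivity), ENNReal.toReal_mul, hV,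
      ENNReal.toReal_ofReal (by positivity), measureReal_def]
  have hint : ‖∫ x, g x ∂μ‖ ≤ 720 * (K * (n : ℝ)⁻¹ * C * (C' * ((n : ℝ)⁻¹) ^ 6) * B ^ 6) *
      μ.real (Metric.closedBall (0 : V) (2 * n)) := by
    rw [← setIntegral_eq_integral_of_forall_compl_eq_zero hg0]
    exact norm_setIntegral_le_of_norm_le_const measure_closedBall_lt_top fun x _ => hgb x
  rw [hvol] at hint
  have e3 : ‖(-3 : ℂ)‖ = 3 := by simp
  rw [e3, hM]
  refine (mul_le_mul_of_nonneg_left hint (by norm_num)).trans_eq ?_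
  field_simp

/-- If the wedge product of two closed forms of degree three decaying at infinity is a semidefinite
volume form up to a constant factor, then it vanishes. -/
theorem wedgePairing_eq_zero_of_nonneg (hV : Module.finrank ℝ V = 6)
    (hT : ContDiff ℝ 1 T) (ha : IsAlternating T)
    (hc : IsClosedField T) (hT' : ContDiff ℝ 1 T') (hc' : IsClosedField T') (b : Fin 6 → V)
    {C C' : ℝ} (hC : ∀ x, ‖x‖ * ‖T x‖ ≤ C) (hC' : ∀ x, ‖x‖ ^ 6 * ‖T' x‖ ≤ C')
    {c : ℂ} (hc0 : c ≠ 0) {q : V → ℝ} (hq : ∀ x, 0 ≤ q x)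
    (hqc : ∀ x, (q x : ℂ) = c * wedgePairing b T T' x) (x : V) : wedgePairing b T T' x = 0 := by
  have hqcont : Continuous q := by
    have h : Continuous fun x => (c * wedgePairing b T T' x).re :=
      Complex.continuous_re.comp
        (continuous_const.mul (continuous_wedgePairing b hT.continuous hT'.continuous))
    convert h using 1
    ext x
    rw [← hqc, Complex.ofReal_re]
  suffices h : q x = 0 by
    have := hqc x
    rw [h, Complex.ofReal_zero, eq_comm, mul_eq_zero] at this
    exact this.resolve_left hc0
  by_contra hx
  let μ : Measure V := Measure.addHaar
  have hlim : Tendsto (fun n => ∫ x, cutoff V n x * q x ∂μ) atTop (𝓝 0) := by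
    have h1 := (tendsto_integral_cutoff_mul_wedgePairing (μ := μ) hV hT ha hc hT' hc' b hC hC').const_mul c
    rw [mul_zero] at h1
    have h2 : (fun n => c * ∫ x, (cutoff V n x : ℂ) * wedgePairing b T T' x ∂μ) =
        fun n => ((∫ x, cutoff V n x * q x ∂μ : ℝ) : ℂ) := by
      funext n
      rw [← integral_const_mul, ← integral_complex_ofReal]
      refine integral_congr_ae (.of_forall fun x => ?_)
      simp only [Complex.ofReal_mul, hqc]
      ring
    rw [h2] at h1
    exact_mod_cast (Complex.continuous_re.tendsto 0).comp h1
  -- N is so large that the cutoff equals 1 at x, which makes the N-th integral positive.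
  obtain ⟨N, hN⟩ := exists_nat_ge (max ‖x‖ 1)
  have hN0 : 0 < N := by
    have : (1 : ℝ) ≤ N := (le_max_right _ _).trans hN
    exact_mod_cast this
  have hcont (n : ℕ) : Continuous (fun x => cutoff V n x * q x) :=
    (contDiff_cutoff n).continuous.mul hqcont
  have hsupp {n : ℕ} (hn : 0 < n) : HasCompactSupport (fun x => cutoff V n x * q x) :=
    (hasCompactSupport_cutoff hn).mul_right
  have hpos : 0 < ∫ x, cutoff V N x * q x ∂μ := by
    refine (hcont N).integral_pos_of_hasCompactSupport_nonneg_nonzero (x := x) (hsupp hN0)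
      (fun y => mul_nonneg (cutoff_nonneg _ _) (hq y)) ?_
    rw [cutoff_eq_one hN0 ((le_max_left _ _).trans hN), one_mul]
    exact hx
  -- For n ≥ 2N the n-th cutoff is 1 on the support of the N-th one and dominates it, so the
  -- integrals stay above a positive constant.
  refine absurd (ge_of_tendsto hlim (b := ∫ x, cutoff V N x * q x ∂μ) ?_) (not_le.2 hpos)
  filter_upwards [eventually_ge_atTop (2 * N)] with n hn
  have hn0 : 0 < n := by omega
  refine integral_mono ((hcont N).integrable_of_hasCompactSupport (hsupp hN0))
    ((hcont n).integrable_of_hasCompactSupport (hsupp hn0)) fun y => ?_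
  change cutoff V N y * q y ≤ cutoff V n y * q y
  rcases le_or_gt (2 * (N : ℝ)) ‖y‖ with h | h
  · rw [cutoff_eq_zero hN0 h, zero_mul]
    exact mul_nonneg (cutoff_nonneg _ _) (hq y)
  · have h' : ‖y‖ ≤ n := h.le.trans (by exact_mod_cast hn)
    rw [cutoff_eq_one hn0 h', one_mul]
    exact mul_le_of_le_one_left (hq y) (cutoff_le_one _ _)

end Decay

/-! ### Signed sums containing a three-by-three determinant -/

section Antisymmetrization

open Equiv

/-- Each of the six terms of the determinant is a reindexing of the first, with a sign that matches
its sign in the determinant. -/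
theorem signedSum_det_left (p q r : Fin 6 → ℂ) (g : Fin 6 → Fin 6 → Fin 6 → ℂ) :
    signedSum (fun π => (p (π 0) * q (π 1) * r (π 2) - p (π 0) * q (π 2) * r (π 1)
      - p (π 1) * q (π 0) * r (π 2) + p (π 1) * q (π 2) * r (π 0) + p (π 2) * q (π 0) * r (π 1)
      - p (π 2) * q (π 1) * r (π 0)) * g (π 3) (π 4) (π 5)) =
    6 * signedSum (fun π => p (π 0) * q (π 1) * r (π 2) * g (π 3) (π 4) (π 5)) := by
  set Φ : Perm (Fin 6) → ℂ := fun π => p (π 0) * q (π 1) * r (π 2) * g (π 3) (π 4) (π 5) with hΦ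
  have h1 := signedSum_comp_mul Φ (swap 1 2)
  have h2 := signedSum_comp_mul Φ (swap 0 1)
  have h3 := signedSum_comp_mul Φ (swap 0 1 * swap 1 2)
  have h4 := signedSum_comp_mul Φ (swap 0 1 * swap 0 2)
  have h5 := signedSum_comp_mul Φ (swap 0 2)
  rw [show Perm.sign (swap (1 : Fin 6) 2) = -1 by decide, show (fun π => Φ (π * swap 1 2)) =
      fun π => p (π 0) * q (π 2) * r (π 1) * g (π 3) (π 4) (π 5) from rfl] at h1
  rw [show Perm.sign (swap (0 : Fin 6) 1) = -1 by decide, show (fun π => Φ (π * swap 0 1)) =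
      fun π => p (π 1) * q (π 0) * r (π 2) * g (π 3) (π 4) (π 5) from rfl] at h2
  rw [show Perm.sign (swap (0 : Fin 6) 1 * swap 1 2) = 1 by decide,
    show (fun π => Φ (π * (swap 0 1 * swap 1 2))) =
      fun π => p (π 1) * q (π 2) * r (π 0) * g (π 3) (π 4) (π 5) from rfl] at h3
  rw [show Perm.sign (swap (0 : Fin 6) 1 * swap 0 2) = 1 by decide,
    show (fun π => Φ (π * (swap 0 1 * swap 0 2))) =
      fun π => p (π 2) * q (π 0) * r (π 1) * g (π 3) (π 4) (π 5) from rfl] at h4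
  rw [show Perm.sign (swap (0 : Fin 6) 2) = -1 by decide, show (fun π => Φ (π * swap 0 2)) =
      fun π => p (π 2) * q (π 1) * r (π 0) * g (π 3) (π 4) (π 5) from rfl] at h5
  simp only [add_mul, sub_mul]
  simp only [signedSum_add, signedSum_sub, h1, h2, h3, h4, h5]
  push_cast
  ring

/-- The previous statement after exchanging the two blocks of three slots; this permutation is odd,
and the sign appears on both sides. -/
theorem signedSum_det_right (p q r : Fin 6 → ℂ) (g : Fin 6 → Fin 6 → Fin 6 → ℂ) :
    signedSum (fun π => (p (π 3) * q (π 4) * r (π 5) - p (π 3) * q (π 5) * r (π 4)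
      - p (π 4) * q (π 3) * r (π 5) + p (π 4) * q (π 5) * r (π 3) + p (π 5) * q (π 3) * r (π 4)
      - p (π 5) * q (π 4) * r (π 3)) * g (π 0) (π 1) (π 2)) =
    6 * signedSum (fun π => p (π 3) * q (π 4) * r (π 5) * g (π 0) (π 1) (π 2)) := by
  have h := signedSum_det_left p q r g
  have hρ := fun Φ : Perm (Fin 6) → ℂ => signedSum_comp_mul Φ (swap 0 3 * swap 1 4 * swap 2 5)
  have e : ((Perm.sign (swap (0 : Fin 6) 3 * swap 1 4 * swap 2 5) : ℤ) : ℂ) = -1 := by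
    rw [show Perm.sign (swap (0 : Fin 6) 3 * swap 1 4 * swap 2 5) = -1 by decide]; simp
  have h1 := hρ (fun π => (p (π 0) * q (π 1) * r (π 2) - p (π 0) * q (π 2) * r (π 1)
      - p (π 1) * q (π 0) * r (π 2) + p (π 1) * q (π 2) * r (π 0) + p (π 2) * q (π 0) * r (π 1)
      - p (π 2) * q (π 1) * r (π 0)) * g (π 3) (π 4) (π 5))
  have h2 := hρ (fun π => p (π 0) * q (π 1) * r (π 2) * g (π 3) (π 4) (π 5))
  rw [h, e] at h1
  rw [e] at h2
  refine Eq.trans h1 ?_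
  refine Eq.trans ?_ (congrArg (6 * ·) h2.symm)
  ring

end Antisymmetrization

/-! ### The (3,3)-form Ω ∧ Ω̄ in terms of a real determinant -/

section VolumeForm

variable {E : Type*} [AddCommGroup E] [Module ℂ E] [Module ℝ E] [IsScalarTower ℝ ℂ E]

/-- The coordinates of a complex vector space of dimension three together with their conjugates,
as real-linear functions. -/
def coordAndConj (bE : Module.Basis (Fin 3) ℂ E) : Fin 6 → E →ₗ[ℝ] ℂ :=
  ![(bE.coord 0).restrictScalars ℝ, (bE.coord 1).restrictScalars ℝ, (bE.coord 2).restrictScalars ℝ,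
    Complex.conjAe.toLinearMap ∘ₗ (bE.coord 0).restrictScalars ℝ,
    Complex.conjAe.toLinearMap ∘ₗ (bE.coord 1).restrictScalars ℝ,
    Complex.conjAe.toLinearMap ∘ₗ (bE.coord 2).restrictScalars ℝ]

/-- A relation among the coordinates and their conjugates, evaluated at `bE i` and at `Complex.I •
bE i`, yields both the sum and the difference of the coefficients of a coordinate and its conjugate,
so all six are zero. -/
theorem det_coordAndConj_ne_zero (bE : Module.Basis (Fin 3) ℂ E) (r : Module.Basis (Fin 6) ℝ E) :
    (Matrix.of fun m k => coordAndConj bE k (r m)).det ≠ 0 := by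
  intro h
  obtain ⟨c, hc0, hc⟩ := Matrix.exists_mulVec_eq_zero_iff.2 h
  apply hc0
  have h1 : ∑ k, (LinearMap.mulLeft ℝ (c k)) ∘ₗ coordAndConj bE k = 0 := by
    refine r.ext fun m => ?_
    have := congrFun hc m
    simp only [Matrix.mulVec, dotProduct, Matrix.of_apply, Pi.zero_apply] at this
    simp only [LinearMap.sum_apply, LinearMap.comp_apply, LinearMap.mulLeft_apply,
      LinearMap.zero_apply]
    rw [← this]
    exact Finset.sum_congr rfl fun _ _ => mul_comm _ _
  have h2 (e : E) : c 0 * bE.coord 0 e + c 1 * bE.coord 1 e + c 2 * bE.coord 2 e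
      + c 3 * (starRingEnd ℂ) (bE.coord 0 e) + c 4 * (starRingEnd ℂ) (bE.coord 1 e)
      + c 5 * (starRingEnd ℂ) (bE.coord 2 e) = 0 := by
    have := LinearMap.congr_fun h1 e
    simpa [Fin.sum_univ_six, coordAndConj] using this
  have a0 := h2 (bE 0)
  have a1 := h2 (bE 1)
  have a2 := h2 (bE 2)
  have b0 := h2 (Complex.I • bE 0)
  have b1 := h2 (Complex.I • bE 1)
  have b2 := h2 (Complex.I • bE 2)
  simp at a0 a1 a2 b0 b1 b2
  have hI : Complex.I * Complex.I = -1 := Complex.I_mul_I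
  have z0 : c 0 = 0 := by linear_combination a0 / 2 - Complex.I * b0 / 2 + (c 0 - c 3) / 2 * hI
  have z1 : c 1 = 0 := by linear_combination a1 / 2 - Complex.I * b1 / 2 + (c 1 - c 4) / 2 * hI
  have z2 : c 2 = 0 := by linear_combination a2 / 2 - Complex.I * b2 / 2 + (c 2 - c 5) / 2 * hI
  have z3 : c 3 = 0 := by linear_combination a0 / 2 + Complex.I * b0 / 2 - (c 0 - c 3) / 2 * hI
  have z4 : c 4 = 0 := by linear_combination a1 / 2 + Complex.I * b1 / 2 - (c 1 - c 4) / 2 * hI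
  have z5 : c 5 = 0 := by linear_combination a2 / 2 + Complex.I * b2 / 2 - (c 2 - c 5) / 2 * hI
  funext k
  fin_cases k <;> assumption

omit [Module ℝ E] [IsScalarTower ℝ ℂ E] in
theorem basis_det_three (bE : Module.Basis (Fin 3) ℂ E) (a b c : E) : bE.det ![a, b, c] =
    bE.coord 0 a * bE.coord 1 b * bE.coord 2 c - bE.coord 0 a * bE.coord 1 c * bE.coord 2 b
    - bE.coord 0 b * bE.coord 1 a * bE.coord 2 c + bE.coord 0 b * bE.coord 1 c * bE.coord 2 a
    + bE.coord 0 c * bE.coord 1 a * bE.coord 2 b - bE.coord 0 c * bE.coord 1 b * bE.coord 2 a := by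
  rw [Module.Basis.det_apply, Matrix.det_fin_three]
  simp [Module.Basis.toMatrix_apply]

/-- Each of the two determinants may be replaced by 3! times its diagonal term, whence 36; what
remains is the Leibniz formula. -/
theorem signedSum_det_mul_conj_det (bE : Module.Basis (Fin 3) ℂ E) (v : Fin 6 → E) :
    signedSum (fun π => bE.det ![v (π 0), v (π 1), v (π 2)] *
      (starRingEnd ℂ) (bE.det ![v (π 3), v (π 4), v (π 5)])) =
    36 * (Matrix.of fun m k => coordAndConj bE k (v m)).det := by
  have h1 := signedSum_det_left (fun i => bE.coord 0 (v i)) (fun i => bE.coord 1 (v i))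
    (fun i => bE.coord 2 (v i))
    (fun i j k => (starRingEnd ℂ) (bE.det ![v i, v j, v k]))
  have h2 := signedSum_det_right (fun i => (starRingEnd ℂ) (bE.coord 0 (v i)))
    (fun i => (starRingEnd ℂ) (bE.coord 1 (v i))) (fun i => (starRingEnd ℂ) (bE.coord 2 (v i)))
    (fun i j k => bE.coord 0 (v i) * bE.coord 1 (v j) * bE.coord 2 (v k))
  simp only [← basis_det_three] at h1
  rw [h1]
  refine Eq.trans (congrArg (6 * ·) (Eq.trans (congrArg signedSum ?_) h2)) ?_
  · funext π
    rw [basis_det_three]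
    simp only [map_add, map_sub, map_mul]
    ring
  simp only [Matrix.det_apply', signedSum, Finset.mul_sum]
  refine Finset.sum_congr rfl fun π _ => ?_
  simp only [Fin.prod_univ_six, Matrix.of_apply]
  simp [coordAndConj]
  ring

variable {V : Type*} [AddCommGroup V] [Module ℝ V]

/-- The complex factor does not depend on A: the pullback of Ω ∧ Ω̄ by A is a fixed nonzero constant
times a real determinant, so its sign is governed by the orientation behaviour of A. -/
theorem signedSum_det_comp (bE : Module.Basis (Fin 3) ℂ E) (r : Module.Basis (Fin 6) ℝ E)
    (β : Module.Basis (Fin 6) ℝ V) (A : V →ₗ[ℝ] E) :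
    signedSum (fun π => bE.det ![A (β (π 0)), A (β (π 1)), A (β (π 2))] *
      (starRingEnd ℂ) (bE.det ![A (β (π 3)), A (β (π 4)), A (β (π 5))])) =
    36 * (Matrix.of fun m k => coordAndConj bE k (r m)).det * (LinearMap.toMatrix β r A).det := by
  rw [signedSum_det_mul_conj_det bE (fun i => A (β i)), mul_assoc]
  congr 1
  have h : (Matrix.of fun m k => coordAndConj bE k (A (β m))) =
      ((LinearMap.toMatrix β r A).map (algebraMap ℝ ℂ)).transpose *
        (Matrix.of fun m k => coordAndConj bE k (r m)) := by
    ext m k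
    rw [Matrix.mul_apply]
    have : A (β m) = ∑ j, LinearMap.toMatrix β r A j m • r j := by
      simp only [LinearMap.toMatrix_apply]
      exact (r.sum_repr _).symm
    simp only [Matrix.of_apply, this, map_sum, map_smul, Matrix.transpose_apply, Matrix.map_apply,
      Complex.coe_algebraMap, Complex.real_smul]
  rw [h, Matrix.det_mul, Matrix.det_transpose, mul_comm]
  congr 1
  exact ((algebraMap ℝ ℂ).map_det _).symm

end VolumeForm

/-! ### Closed decaying forms of type (3,0) vanish -/

section Vanishing

variable {V : Type*} [NormedAddCommGroup V] [NormedSpace ℝ V]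

/-- Complex conjugation of the values of trilinear forms. -/
def conjForm (V : Type*) [NormedAddCommGroup V] [NormedSpace ℝ V] :
    (V →L[ℝ] V →L[ℝ] V →L[ℝ] ℂ) →L[ℝ] (V →L[ℝ] V →L[ℝ] V →L[ℝ] ℂ) :=
  ContinuousLinearMap.compL ℝ V (V →L[ℝ] V →L[ℝ] ℂ) (V →L[ℝ] V →L[ℝ] ℂ)
    (ContinuousLinearMap.compL ℝ V (V →L[ℝ] ℂ) (V →L[ℝ] ℂ)
      (ContinuousLinearMap.compL ℝ V ℂ ℂ (Complex.conjCLE : ℂ →L[ℝ] ℂ)))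

theorem conjForm_apply (L : V →L[ℝ] V →L[ℝ] V →L[ℝ] ℂ) (u v w : V) :
    conjForm V L u v w = (starRingEnd ℂ) (L u v w) := rfl

variable [FiniteDimensional ℝ V] [MeasurableSpace V] [BorelSpace V]
variable {E : Type*} [AddCommGroup E] [Module ℂ E] [Module ℝ E] [IsScalarTower ℝ ℂ E]
variable {T : V → V →L[ℝ] V →L[ℝ] V →L[ℝ] ℂ}

/-- The field T is f times the pullback of a complex volume form by A, so T ∧ T̄ is a constant times
|f|² det A. The scalar s records that det A has constant sign, which makes T ∧ T̄ semidefinite;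
Stokes forces it to vanish, hence f = 0. The conjugate of T is closed because conjugation is
real-linear, and it inherits the decay. -/
theorem eq_zero_of_isClosedField_of_decay (bE : Module.Basis (Fin 3) ℂ E)
    (r : Module.Basis (Fin 6) ℝ E) (β : Module.Basis (Fin 6) ℝ V)
    (hT : ContDiff ℝ 1 T) (ha : IsAlternating T) (hc : IsClosedField T)
    {C : ℝ} (hC : ∀ x, 1 ≤ ‖x‖ → ‖x‖ ^ 6 * ‖T x‖ ≤ C)
    {A : V → V →ₗ[ℝ] E} {f : V → ℂ}
    (hA : ∀ x u v w, T x u v w = f x * bE.det ![A x u, A x v, A x w])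
    {s : ℝ} (hs : ∀ x, 0 < s * (LinearMap.toMatrix β r (A x)).det) (x : V) : T x = 0 := by
  obtain ⟨B, hB⟩ := (isCompact_closedBall (0 : V) 1).exists_bound_of_continuousOn
    hT.continuous.continuousOn
  have hC1 (x : V) : ‖x‖ * ‖T x‖ ≤ max B C := by
    rcases le_total ‖x‖ 1 with h | h
    · have := hB x (mem_closedBall_zero_iff.2 h)
      exact (mul_le_of_le_one_left (norm_nonneg _) h).trans (this.trans (le_max_left _ _))
    · refine le_trans ?_ ((hC x h).trans (le_max_right _ _))
      gcongr
      exact le_self_pow₀ h (by norm_num)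
  have hC6 (x : V) : ‖x‖ ^ 6 * ‖T x‖ ≤ max B C := by
    rcases le_total ‖x‖ 1 with h | h
    · have := hB x (mem_closedBall_zero_iff.2 h)
      exact (mul_le_of_le_one_left (norm_nonneg _) (pow_le_one₀ (norm_nonneg _) h)).trans
        (this.trans (le_max_left _ _))
    · exact (hC x h).trans (le_max_right _ _)
  set T' : V → V →L[ℝ] V →L[ℝ] V →L[ℝ] ℂ := fun x => conjForm V (T x) with hT'
  have hT'1 : ContDiff ℝ 1 T' := (conjForm V).contDiff.comp hT
  have hT'd (x a b c d) : fderiv ℝ T' x a b c d = (starRingEnd ℂ) (fderiv ℝ T x a b c d) := by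
    have h : HasFDerivAt T' ((conjForm V).comp (fderiv ℝ T x)) x :=
      (conjForm V).hasFDerivAt.comp x (hT.differentiable one_ne_zero x).hasFDerivAt
    rw [h.fderiv]; rfl
  have hT'c : IsClosedField T' := by
    intro x a b c d
    simp only [hT'd]
    rw [← map_sub, ← map_add, ← map_sub, hc, map_zero]
  have hC' (x : V) : ‖x‖ ^ 6 * ‖T' x‖ ≤ ‖conjForm V‖ * max B C := by
    calc ‖x‖ ^ 6 * ‖T' x‖ ≤ ‖x‖ ^ 6 * (‖conjForm V‖ * ‖T x‖) := by
          gcongr; exact (conjForm V).le_opNorm _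
      _ = ‖conjForm V‖ * (‖x‖ ^ 6 * ‖T x‖) := by ring
      _ ≤ _ := by gcongr; exact hC6 x
  set δ := (Matrix.of fun m k => coordAndConj bE k (r m)).det with hδ
  have hδ0 : δ ≠ 0 := det_coordAndConj_ne_zero bE r
  have hs0 : s ≠ 0 := by
    intro h; have := hs 0; rw [h, zero_mul] at this; exact this.false
  have hw (x : V) : wedgePairing β T T' x =
      (36 * δ) * ((‖f x‖ ^ 2 * (LinearMap.toMatrix β r (A x)).det : ℝ) : ℂ) := by
    have h := signedSum_det_comp bE r β (A x)
    have e : wedgePairing β T T' x = signedSum (fun π => (f x * (starRingEnd ℂ) (f x)) *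
        (bE.det ![A x (β (π 0)), A x (β (π 1)), A x (β (π 2))] *
        (starRingEnd ℂ) (bE.det ![A x (β (π 3)), A x (β (π 4)), A x (β (π 5))]))) := by
      unfold wedgePairing
      congr 1
      funext π
      simp only [hT', conjForm_apply, hA, map_mul]
      ring
    rw [e, signedSum_const_mul, h, Complex.mul_conj, Complex.normSq_eq_norm_sq]
    push_cast
    ring
  -- Dividing by 36 δ removes the constant phase, and multiplying by s turns the real factor into a
  -- nonnegative one.
  have h0 := wedgePairing_eq_zero_of_nonneg (by simpa using Module.finrank_eq_card_basis β) hT ha hc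
    hT'1 hT'c β hC1 hC' (c := s / (36 * δ)) (by simp [hs0, hδ0])
    (q := fun x => ‖f x‖ ^ 2 * (s * (LinearMap.toMatrix β r (A x)).det))
    (fun x => mul_nonneg (by positivity) (hs x).le)
    (fun x => by
      rw [hw]
      push_cast
      field_simp) x
  rw [hw] at h0
  have h1 : ‖f x‖ ^ 2 * (LinearMap.toMatrix β r (A x)).det = 0 := by
    have := (mul_eq_zero.1 h0).resolve_left (by simp [hδ0])
    exact_mod_cast this
  have h2 : (LinearMap.toMatrix β r (A x)).det ≠ 0 := by
    intro h; have := hs x; rw [h, mul_zero] at this; exact this.false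
  have h3 : f x = 0 := by
    simpa using (mul_eq_zero.1 h1).resolve_right h2
  ext u v w
  simp [hA, h3]

end Vanishing

/-! ### Complex differentiability from real derivatives -/

section ComplexLinear

variable {E F : Type*} [NormedAddCommGroup E] [NormedSpace ℂ E] [NormedAddCommGroup F]
  [NormedSpace ℂ F]

theorem map_complex_smul_of_map_I_smul {L : E →L[ℝ] F}
    (h : ∀ v, L (Complex.I • v) = Complex.I • L v) (c : ℂ) (v : E) : L (c • v) = c • L v := by
  have hc : c = (c.re : ℂ) + (c.im : ℂ) * Complex.I := (Complex.re_add_im c).symm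
  rw [hc, add_smul, add_smul, map_add, mul_smul, mul_smul, Complex.coe_smul, Complex.coe_smul,
    Complex.coe_smul, Complex.coe_smul, map_smul, map_smul, h]

theorem differentiableAt_complex_of_real {f : E → F} {y : E} (hf : DifferentiableAt ℝ f y)
    (h : ∀ v, fderiv ℝ f y (Complex.I • v) = Complex.I • fderiv ℝ f y v) :
    DifferentiableAt ℂ f y := by
  refine (differentiableAt_iff_restrictScalars ℝ hf).2
    ⟨⟨⟨(fderiv ℝ f y : E →+ F), fun c v => map_complex_smul_of_map_I_smul h c v⟩,
      (fderiv ℝ f y).cont⟩, ?_⟩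
  ext v; rfl

/-- The Cauchy–Riemann equation for g holds on an open set and may be differentiated in the
direction u; symmetry of the second derivative turns the result into the Cauchy–Riemann equation for
the derivative of g along u. -/
theorem differentiableOn_fderiv_apply_of_holomorphic {g : E → ℂ} {U : Set E} (hU : IsOpen U)
    (hg : ContDiffOn ℝ ∞ g U)
    (h : ∀ y ∈ U, ∀ v, fderiv ℝ g y (Complex.I • v) = Complex.I * fderiv ℝ g y v) (u : E) :
    DifferentiableOn ℂ (fun y => fderiv ℝ g y u) U := by
  intro y hy
  have hgy : ContDiffAt ℝ ∞ g y := hg.contDiffAt (hU.mem_nhds hy)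
  have hd : DifferentiableAt ℝ (fderiv ℝ g) y :=
    (hgy.fderiv_right (m := 1) (by norm_cast)).differentiableAt one_ne_zero
  have hsymm : IsSymmSndFDerivAt ℝ g y := hgy.isSymmSndFDerivAt
    (by rw [minSmoothness_of_isRCLikeNormedField]; exact WithTop.coe_le_coe.2 le_top)
  have happ (w : E) : HasFDerivAt (fun y => fderiv ℝ g y w) ((fderiv ℝ (fderiv ℝ g) y).flip w) y := by
    have := hd.hasFDerivAt.clm_apply (hasFDerivAt_const w y)
    rwa [ContinuousLinearMap.comp_zero, zero_add] at this
  refine (differentiableAt_complex_of_real (happ u).differentiableAt fun w => ?_).differentiableWithinAt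
  rw [(happ u).fderiv, ContinuousLinearMap.flip_apply, ContinuousLinearMap.flip_apply,
    hsymm.eq, hsymm.eq w]
  have e : (fun y => fderiv ℝ g y (Complex.I • w)) =ᶠ[𝓝 y] fun y => Complex.I * fderiv ℝ g y w := by
    filter_upwards [hU.mem_nhds hy] with z hz using h z hz w
  have h1 := (happ (Complex.I • w)).congr_of_eventuallyEq e.symm
  have h2 := (happ w).const_mul Complex.I
  have := DFunLike.congr_fun (h1.unique h2) u
  simpa using this

end ComplexLinear

/-! ### The exterior derivative of a one-form and its naturality -/

section ExteriorDerivative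

variable {V W : Type*} [NormedAddCommGroup V] [NormedSpace ℝ V] [NormedAddCommGroup W]
  [NormedSpace ℝ W]

/-- The exterior derivative of a one-form. -/
def dOne (F : V → V →L[ℝ] ℂ) (x u v : V) : ℂ := fderiv ℝ F x u v - fderiv ℝ F x v u

theorem dOne_congr {F G : V → V →L[ℝ] ℂ} {x : V} (h : F =ᶠ[𝓝 x] G) (u v : V) :
    dOne F x u v = dOne G x u v := by
  rw [dOne, dOne, h.fderiv_eq]

/-- The terms with the second derivative of τ are symmetric in u and v and cancel. -/
theorem dOne_comp {F : V → V →L[ℝ] ℂ} {G : W → W →L[ℝ] ℂ} {τ : V → W} {x : V}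
    (hF : F =ᶠ[𝓝 x] fun y => (G (τ y)).comp (fderiv ℝ τ y)) (hG : DifferentiableAt ℝ G (τ x))
    (hτ : ContDiffAt ℝ ∞ τ x) (u v : V) :
    dOne F x u v = dOne G (τ x) (fderiv ℝ τ x u) (fderiv ℝ τ x v) := by
  have hd : DifferentiableAt ℝ (fderiv ℝ τ) x :=
    (hτ.fderiv_right (m := 1) (by norm_cast)).differentiableAt one_ne_zero
  have h1 := (hG.hasFDerivAt.comp x (hτ.differentiableAt (by simp)).hasFDerivAt).clm_comp
    hd.hasFDerivAt
  have hsymm : IsSymmSndFDerivAt ℝ τ x := hτ.isSymmSndFDerivAt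
    (by rw [minSmoothness_of_isRCLikeNormedField]; exact WithTop.coe_le_coe.2 le_top)
  rw [dOne_congr hF, dOne]
  have h2 : fderiv ℝ (fun y => (G (τ y)).comp (fderiv ℝ τ y)) x = _ := h1.fderiv
  rw [h2, dOne]
  simp [hsymm.eq u v]

end ExteriorDerivative

/-! ### Pullbacks of one-forms on X along maps from vector spaces -/

section Pullback

variable {E : Type*} [NormedAddCommGroup E] [NormedSpace ℂ E]
variable {X : Type*} [TopologicalSpace X] [ChartedSpace E X]

theorem hasMFDerivAt_restrictScalars {F : Type*} [NormedAddCommGroup F] [NormedSpace ℂ F]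
    {Y : Type*} [TopologicalSpace Y] [ChartedSpace F Y] {f : Y → X} {y : Y} {f' : F →L[ℂ] E}
    (h : HasMFDerivAt 𝓘(ℂ, F) 𝓘(ℂ, E) f y f') :
    HasMFDerivAt (realModel F) (realModel E) f y (f'.restrictScalars ℝ : F →L[ℝ] E) :=
  ⟨h.1, HasFDerivWithinAt.restrictScalars ℝ h.2⟩

theorem isManifold_realModel (h : IsManifold 𝓘(ℂ, E) ω X) : IsManifold (realModel E) ∞ X := by
  refine isManifold_of_contDiffOn _ _ _ fun e e' he he' => ?_
  have h1 := contMDiffOn_of_mem_contDiffGroupoid (HasGroupoid.compatible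
    (G := contDiffGroupoid ω 𝓘(ℂ, E)) he he')
  have h2 : ContDiffOn ℂ ω (e.symm ≫ₕ e') (e.symm ≫ₕ e').source := contMDiffOn_iff_contDiffOn.1 h1
  have h3 := (h2.of_le (m := ∞) le_top).restrict_scalars ℝ
  simpa using! h3

variable {V W : Type*} [NormedAddCommGroup V] [NormedSpace ℝ V] [NormedAddCommGroup W]
  [NormedSpace ℝ W]

/-- The value of a one-form at a point, as a linear map. -/
def Form.covector (η : Form E X 1) (x : X) : E →L[ℝ] ℂ :=
  (ContinuousAlternatingMap.ofSubsingletonLIE (𝕜 := ℝ) (E := E) (F := ℂ) (0 : Fin 1)).symm (η x)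

/-- The derivative of a map from a vector space to `X`, as a linear map into the model space. -/
def derivInModel (ψ : V → X) (y : V) : V →L[ℝ] E := mfderiv 𝓘(ℝ, V) (realModel E) ψ y

/-- The pullback of a one-form by a map from a vector space. -/
def Form.pull (η : Form E X 1) (ψ : V → X) (y : V) : V →L[ℝ] ℂ :=
  (η.covector (ψ y)).comp (derivInModel ψ y)

theorem Form.inChart_apply_eq_pull (η : Form E X 1) (e : OpenPartialHomeomorph X E) (y : E)
    (v : Fin 1 → E) : η.inChart e y v = η.pull e.symm y (v 0) := by
  have : v = fun _ => v 0 := by ext i; rw [Subsingleton.elim i 0]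
  rw [this]; rfl

theorem Form.pull_comp (η : Form E X 1) {ψ : V → X} {ψ' : W → X} {τ : V → W} {y : V}
    (h : ψ =ᶠ[𝓝 y] ψ' ∘ τ) (hτ : DifferentiableAt ℝ τ y)
    (hψ : MDifferentiableAt 𝓘(ℝ, W) (realModel E) ψ' (τ y)) :
    η.pull ψ y = (η.pull ψ' (τ y)).comp (fderiv ℝ τ y) := by
  have h1 : derivInModel (E := E) ψ y = (derivInModel ψ' (τ y)).comp (fderiv ℝ τ y) := by
    have a : derivInModel (E := E) ψ y = mfderiv 𝓘(ℝ, V) (realModel E) (ψ' ∘ τ) y := h.mfderiv_eq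
    rw [a]
    have b := mfderiv_comp y hψ hτ.mdifferentiableAt
    rw [mfderiv_eq_fderiv] at b
    exact b
  unfold Form.pull
  rw [h1, h.eq_of_nhds]
  rfl

theorem Form.dOne_pull_comp (η : Form E X 1) {ψ : V → X} {ψ' : W → X} {τ : V → W} {y : V}
    (h : ψ =ᶠ[𝓝 y] ψ' ∘ τ) (hτ : ContDiffAt ℝ ∞ τ y)
    (hψ : ∀ᶠ z in 𝓝 (τ y), MDifferentiableAt 𝓘(ℝ, W) (realModel E) ψ' z)
    (hη : DifferentiableAt ℝ (η.pull ψ') (τ y)) (u v : V) :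
    dOne (η.pull ψ) y u v = dOne (η.pull ψ') (τ y) (fderiv ℝ τ y u) (fderiv ℝ τ y v) := by
  refine dOne_comp ?_ hη hτ u v
  filter_upwards [h.eventually_nhds, (hτ.of_le (m := 1) (by norm_cast)).eventually (by simp),
    hτ.continuousAt.eventually hψ] with z h1 h2 h3
  exact η.pull_comp h1 (h2.differentiableAt one_ne_zero) h3

end Pullback

/-! ### Closed (1,0)-forms under ∂̄ have holomorphic coefficients -/

section HolomorphicForms

variable {E : Type*} [NormedAddCommGroup E] [NormedSpace ℂ E] [FiniteDimensional ℂ E]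
variable {X : Type*} [TopologicalSpace X] [ChartedSpace E X] [hX : IsManifold 𝓘(ℂ, E) ω X]
variable {η : Form E X 1} {e : OpenPartialHomeomorph X E}

omit [FiniteDimensional ℂ E] in
theorem mdifferentiableAt_real_symm (he : e ∈ atlas E X) {y : E} (hy : y ∈ e.target) :
    MDifferentiableAt (realModel E) (realModel E) e.symm y :=
  (hasMFDerivAt_restrictScalars
    (mdifferentiableAt_atlas_symm (I := 𝓘(ℂ, E)) he hy).hasMFDerivAt).mdifferentiableAt

omit [FiniteDimensional ℂ E] in
theorem mfderiv_real_symm_smul (he : e ∈ atlas E X) {y : E} (hy : y ∈ e.target) (c : ℂ) (v : E) :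
    derivInModel (E := E) e.symm y (c • v) = c • derivInModel (E := E) e.symm y v := by
  have h := (hasMFDerivAt_restrictScalars
    (mdifferentiableAt_atlas_symm (I := 𝓘(ℂ, E)) he hy).hasMFDerivAt).mfderiv
  rw [derivInModel, h]
  exact (mfderiv 𝓘(ℂ, E) 𝓘(ℂ, E) e.symm y : E →L[ℂ] E).map_smul c v

omit [FiniteDimensional ℂ E] hX in
theorem contDiffOn_pull_symm (hη : η.IsSmooth) (he : e ∈ atlas E X) :
    ContDiffOn ℝ ∞ (η.pull e.symm) e.target :=
  (ContinuousAlternatingMap.ofSubsingletonLIE (𝕜 := ℝ) (E := E) (F := ℂ)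
    (0 : Fin 1)).symm.contDiff.comp_contDiffOn (hη e he)

omit [FiniteDimensional ℂ E] in
theorem pull_symm_smul (hη : η.IsOfType 1 0) (he : e ∈ atlas E X) {y : E} (hy : y ∈ e.target)
    (c : ℂ) (v : E) : η.pull e.symm y (c • v) = c * η.pull e.symm y v := by
  have h (x : X) (w : E) : η.covector x (c • w) = c * η.covector x w := by
    have := DFunLike.congr_fun (hη x c) (fun _ : Fin 1 => (w : E))
    simp only [pow_one, pow_zero, mul_one] at this
    exact this
  change η.covector _ (derivInModel (E := E) e.symm y (c • v)) = _
  rw [mfderiv_real_symm_smul he hy, h]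
  rfl

omit [FiniteDimensional ℂ E] in
-- Let P(a, b) be the conjugate-linear part in a of the derivative, with values evaluated at b. It
-- is conjugate-linear in a, and complex linear in b because the form has type (1,0). The equation
-- ∂̄η = 0 says P(a, b) = P(b, a), so P is also linear in a, hence zero.
theorem fderiv_pull_symm_I_smul (hη : η.IsSmooth) (ht : η.IsOfType 1 0)
    (hd : η.HasDbar 0) (he : e ∈ atlas E X) {y : E} (hy : y ∈ e.target) (u v : E) :
    fderiv ℝ (η.pull e.symm) y (Complex.I • u) v = Complex.I * fderiv ℝ (η.pull e.symm) y u v := by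
  set G := η.pull e.symm with hG
  have hGd : DifferentiableAt ℝ G y :=
    ((contDiffOn_pull_symm hη he).contDiffAt (e.open_target.mem_nhds hy)).differentiableAt (by simp)
  have happ (w : E) : HasFDerivAt (fun z => G z w) ((fderiv ℝ G y).flip w) y := by
    have := hGd.hasFDerivAt.clm_apply (hasFDerivAt_const w y)
    rwa [ContinuousLinearMap.comp_zero, zero_add] at this
  have hI (a b : E) : fderiv ℝ G y a (Complex.I • b) = Complex.I * fderiv ℝ G y a b := by
    have hev : (fun z => G z (Complex.I • b)) =ᶠ[𝓝 y] fun z => Complex.I * G z b := by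
      filter_upwards [e.open_target.mem_nhds hy] with z hz using pull_symm_smul ht he hz _ _
    have h1 := (happ (Complex.I • b)).congr_of_eventuallyEq hev.symm
    have := DFunLike.congr_fun (h1.unique ((happ b).const_mul Complex.I)) a
    simpa using this
  have hfd (a b : E) : fderiv ℝ (η.inChart e) y a (fun _ => b) = fderiv ℝ G y a b := by
    have h1 := (hη.differentiableAt he hy).hasFDerivAt
    have h2 : HasFDerivAt (fun z => η.inChart e z (fun _ => b)) _ y :=
      (ContinuousAlternatingMap.apply ℝ E ℂ (fun _ : Fin 1 => b)).hasFDerivAt.comp y h1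
    have h3 : (fun z => η.inChart e z (fun _ => b)) = fun z => G z b :=
      funext fun z => η.inChart_apply_eq_pull e z _
    rw [h3] at h2
    exact DFunLike.congr_fun (h2.unique (happ b)) a
  have key (a b : E) : fderiv ℝ G y a b + Complex.I * fderiv ℝ G y (Complex.I • a) b =
      fderiv ℝ G y b a + Complex.I * fderiv ℝ G y (Complex.I • b) a := by
    have h0 := DFunLike.congr_fun (hd e he y hy) ![a, b]
    have r0 : (0 : Fin 2).removeNth ![a, b] = fun _ : Fin 1 => b := by
      ext i; rw [Subsingleton.elim i 0]; rfl
    have r1 : (1 : Fin 2).removeNth ![a, b] = fun _ : Fin 1 => a := by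
      ext i; rw [Subsingleton.elim i 0]; rfl
    rw [Form.inChart_zero] at h0
    rw [flatDbar, ContinuousAlternatingMap.alternatizeUncurryFin_apply, Fin.sum_univ_two, r0, r1] at h0
    simp [conjLinearPart, mulBy, hfd] at h0
    linear_combination 2 * h0
  have hII (a b : E) : fderiv ℝ G y (Complex.I • Complex.I • a) b = - fderiv ℝ G y a b := by
    rw [smul_smul, Complex.I_mul_I, neg_one_smul, map_neg]; rfl
  have k1 := key u v
  have k2 := key (Complex.I • u) v
  rw [hII, hI, hI] at k2
  have hII' : Complex.I * Complex.I = -1 := Complex.I_mul_I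
  linear_combination (-(Complex.I) / 2) * k1 + (1 / 2) * k2
    + (1 / 2) * fderiv ℝ G y (Complex.I • u) v * hII'

end HolomorphicForms

/-! ### The identity theorem on convex open sets -/

section UniqueContinuation

variable {E : Type*} [NormedAddCommGroup E] [NormedSpace ℂ E]

/-- The identity theorem for holomorphic functions on a convex open set. -/
theorem eqOn_zero_of_convex_of_eventuallyEq_zero {U : Set E} (hU : IsOpen U) (hc : Convex ℝ U)
    {f : E → ℂ} (hf : DifferentiableOn ℂ f U) {z : E} (hz : z ∈ U) (h0 : ∀ᶠ y in 𝓝 z, f y = 0)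
    {w : E} (hw : w ∈ U) : f w = 0 := by
  -- Restriction to the complex line through z and w reduces to one variable; the preimage of U is
  -- convex, hence connected.
  set ℓ : ℂ → E := fun t => z + t • (w - z) with hℓ
  have hℓd : Differentiable ℂ ℓ := by fun_prop
  have hS : IsOpen (ℓ ⁻¹' U) := hU.preimage hℓd.continuous
  have hSc : Convex ℝ (ℓ ⁻¹' U) := by
    intro s hs t ht a b ha hb hab
    have : ℓ (a • s + b • t) = a • ℓ s + b • ℓ t := by
      simp only [hℓ, smul_add, Complex.real_smul, add_smul, mul_smul, Complex.coe_smul]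
      have : z = a • z + b • z := by rw [← add_smul, hab, one_smul]
      nth_rewrite 1 [this]
      abel
    rw [Set.mem_preimage, this]
    exact hc hs ht ha hb hab
  have han : AnalyticOnNhd ℂ (f ∘ ℓ) (ℓ ⁻¹' U) :=
    (hf.comp hℓd.differentiableOn fun _ h => h).analyticOnNhd hS
  have ez : ℓ 0 = z := by simp [hℓ]
  have ew : ℓ 1 = w := by simp [hℓ]
  have hev : ∀ᶠ t in 𝓝 0, f (ℓ t) = 0 := by
    have h1 : Filter.Tendsto ℓ (𝓝 0) (𝓝 z) := by
      simpa [ez] using hℓd.continuous.tendsto 0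
    exact h1.eventually h0
  have := han.eqOn_zero_of_preconnected_of_eventuallyEq_zero hSc.isPreconnected
    (by simpa [ez] using hz) hev (show (1 : ℂ) ∈ _ by simpa [ew] using hw)
  simpa [ew] using this

end UniqueContinuation

/-! ### Holomorphic tensor fields, unique continuation, and germs of holomorphic functions -/

section Systems

variable {E : Type*} [NormedAddCommGroup E] [NormedSpace ℂ E]
variable {X : Type*} [TopologicalSpace X] [ChartedSpace E X]
variable {κ : Type*}

/-- A holomorphic covariant tensor field on `X`, given by its expressions in charts. -/
structure IsHolomorphicTensor (B : OpenPartialHomeomorph X E → E → (κ → E) → ℂ) : Prop where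
  differentiableOn : ∀ e ∈ atlas E X, ∀ w, DifferentiableOn ℂ (fun y => B e y w) e.target
  transition : ∀ e ∈ atlas E X, ∀ e' ∈ atlas E X, ∀ y ∈ e.target, e.symm y ∈ e'.source → ∀ w,
    B e y w = B e' (e' (e.symm y)) (fun i => fderiv ℝ (e' ∘ e.symm) y (w i))

/-- The value of a tensor field at `x` in the preferred chart at `x`. -/
def tensorAt (B : OpenPartialHomeomorph X E → E → (κ → E) → ℂ) (x : X) : (κ → E) → ℂ :=
  B (chartAt E x) (chartAt E x x)

variable {A B : OpenPartialHomeomorph X E → E → (κ → E) → ℂ}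

theorem IsHolomorphicTensor.sub_smul (hA : IsHolomorphicTensor A) (hB : IsHolomorphicTensor B)
    (c : ℂ) : IsHolomorphicTensor fun e y w => A e y w - c * B e y w where
  differentiableOn e he w :=
    (hA.differentiableOn e he w).sub ((hB.differentiableOn e he w).const_mul c)
  transition e he e' he' y hy h w := by
    rw [hA.transition e he e' he' y hy h, hB.transition e he e' he' y hy h]

theorem IsHolomorphicTensor.tensorAt_apply (hB : IsHolomorphicTensor B)
    {e : OpenPartialHomeomorph X E} (he : e ∈ atlas E X) {x : X} (hx : x ∈ e.source)
    (w : κ → E) : tensorAt B x w =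
      B e (e x) (fun i => fderiv ℝ (e ∘ (chartAt E x).symm) (chartAt E x x) (w i)) := by
  have hs := (chartAt E x).left_inv (mem_chart_source E x)
  have := hB.transition _ (chart_mem_atlas E x) e he (chartAt E x x)
    ((chartAt E x).map_source (mem_chart_source E x)) (by rwa [hs]) w
  rwa [hs] at this

theorem IsHolomorphicTensor.tensorAt_eq_zero_iff (hB : IsHolomorphicTensor B)
    {e : OpenPartialHomeomorph X E} (he : e ∈ atlas E X) {x : X} (hx : x ∈ e.source) :
    tensorAt B x = 0 ↔ ∀ w, B e (e x) w = 0 := by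
  refine ⟨fun h w => ?_, fun h => ?_⟩
  · have := hB.transition e he _ (chart_mem_atlas E x) (e x) (e.map_source hx)
      (by rw [e.left_inv hx]; exact mem_chart_source E x) w
    rw [this, e.left_inv hx]
    exact congrFun h _
  · ext w
    rw [hB.tensorAt_apply he hx, h]; rfl

/-- A neighbourhood of `x` which is a ball in the preferred chart at `x`. -/
theorem exists_chart_ball (x : X) : ∃ U : Set X, IsOpen U ∧ x ∈ U ∧ U ⊆ (chartAt E x).source ∧
    ∀ f : E → ℂ, DifferentiableOn ℂ f (chartAt E x).target →
      (∃ z ∈ U, ∀ᶠ y in 𝓝 z, f (chartAt E x y) = 0) → ∀ z ∈ U, f (chartAt E x z) = 0 := by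
  set e := chartAt E x with he
  have hx : x ∈ e.source := mem_chart_source E x
  obtain ⟨r, hr, hball⟩ := Metric.isOpen_iff.1 e.open_target (e x) (e.map_source hx)
  refine ⟨e.source ∩ e ⁻¹' Metric.ball (e x) r, e.isOpen_inter_preimage Metric.isOpen_ball,
    ⟨hx, Metric.mem_ball_self hr⟩, Set.inter_subset_left, ?_⟩
  rintro f hf ⟨z, hz, hev⟩ y hy
  refine eqOn_zero_of_convex_of_eventuallyEq_zero Metric.isOpen_ball (convex_ball _ _)
    (hf.mono hball) hz.2 ?_ hy.2
  have h1 : Filter.Tendsto e.symm (𝓝 (e z)) (𝓝 z) := by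
    have := e.continuousAt_symm (e.map_source hz.1)
    rwa [ContinuousAt, e.left_inv hz.1] at this
  filter_upwards [h1.eventually hev, e.open_target.mem_nhds (e.map_source hz.1)] with w hw hwt
  rwa [e.right_inv hwt] at hw

/-- The identity theorem for holomorphic tensor fields. -/
theorem IsHolomorphicTensor.eq_zero [PreconnectedSpace X] (hB : IsHolomorphicTensor B) {x : X}
    (h : ∀ᶠ z in 𝓝 x, tensorAt B z = 0) {e : OpenPartialHomeomorph X E} (he : e ∈ atlas E X)
    {y : E} (hy : y ∈ e.target) (w : κ → E) : B e y w = 0 := by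
  set Z : Set X := {x | ∀ᶠ z in 𝓝 x, tensorAt B z = 0} with hZ
  have hZo : IsOpen Z := isOpen_setOfPred_eventually_nhds
  -- A coordinate ball meeting Z lies in Z, by the identity theorem for each component; therefore Z
  -- is closed as well as open.
  have hloc (x : X) : ∃ U : Set X, IsOpen U ∧ x ∈ U ∧ ((U ∩ Z).Nonempty → U ⊆ Z) := by
    obtain ⟨U, hUo, hxU, hUs, hU⟩ := exists_chart_ball (E := E) x
    refine ⟨U, hUo, hxU, ?_⟩
    rintro ⟨z, hzU, hzZ⟩ v hv
    have : ∀ z ∈ U, tensorAt B z = 0 := by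
      intro t ht
      refine (hB.tensorAt_eq_zero_iff (chart_mem_atlas E x) (hUs ht)).2 fun w => ?_
      refine hU (fun y => B (chartAt E x) y w) (hB.differentiableOn _ (chart_mem_atlas E x) w)
        ⟨z, hzU, ?_⟩ t ht
      filter_upwards [hzZ, hUo.mem_nhds hzU] with y hy hyU
      exact (hB.tensorAt_eq_zero_iff (chart_mem_atlas E x) (hUs hyU)).1 hy w
    exact Filter.eventually_of_mem (hUo.mem_nhds hv) this
  have hZc : IsClosed Z := by
    refine isClosed_of_closure_subset fun t ht => ?_
    obtain ⟨U, hUo, htU, hU⟩ := hloc t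
    exact hU (mem_closure_iff.1 ht U hUo htU) htU
  have hZu : Z = Set.univ := IsClopen.eq_univ ⟨hZc, hZo⟩ ⟨x, h⟩
  have h1 : e.symm y ∈ Z := hZu ▸ Set.mem_univ _
  have h2 := (hB.tensorAt_eq_zero_iff he (e.map_target hy)).1 h1.self_of_nhds w
  rwa [e.right_inv hy] at h2

variable [IsManifold 𝓘(ℂ, E) ω X]

theorem holomorphicNear_comp_chart {e : OpenPartialHomeomorph X E} (he : e ∈ atlas E X)
    {f : E → ℂ} (hf : DifferentiableOn ℂ f e.target) {x : X} (hx : x ∈ e.source) :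
    HolomorphicNear E (fun z => f (e z)) x := by
  filter_upwards [e.open_source.mem_nhds hx] with z hz
  have h1 : MDifferentiableAt 𝓘(ℂ, E) 𝓘(ℂ, ℂ) f (e z) :=
    (hf.differentiableAt (e.open_target.mem_nhds (e.map_source hz))).mdifferentiableAt
  exact h1.comp z (mdifferentiableAt_atlas he hz)

omit [IsManifold 𝓘(ℂ, E) ω X] in
-- If f were nonzero at a nearby point y, it would be nonzero around y by continuity, while h is
-- nonzero at points arbitrarily close to y. This elementary cancellation is what makes h a
-- nonzerodivisor.
theorem eventually_eq_zero_of_mul {f h : X → ℂ} {x : X} (hf : HolomorphicNear E f x)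
    (hh : ∀ᶠ y in 𝓝 x, ∃ᶠ z in 𝓝 y, h z ≠ 0) (h0 : ∀ᶠ y in 𝓝 x, f y * h y = 0) :
    ∀ᶠ y in 𝓝 x, f y = 0 := by
  filter_upwards [hf, hh, h0.eventually_nhds] with y h1 h2 h3
  by_contra hy
  have h4 : ∀ᶠ z in 𝓝 y, f z ≠ 0 := h1.continuousAt.eventually_ne hy
  obtain ⟨z, hz, hz', hz''⟩ := (h2.and_eventually (h3.and h4)).exists
  exact (mul_ne_zero hz'' hz) hz'

omit [IsManifold 𝓘(ℂ, E) ω X] in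
theorem holomorphicGerm_eq_zero_iff {f : X → ℂ} {x : X} (hf : HolomorphicNear E f x) :
    holomorphicGerm E f hf = 0 ↔ ∀ᶠ y in 𝓝 x, f y = 0 := by
  rw [← Subtype.coe_inj]
  exact Filter.Germ.coe_eq

omit [IsManifold 𝓘(ℂ, E) ω X] in
theorem holomorphicGerm_mem_nonZeroDivisors {h : X → ℂ} {x : X} (hf : HolomorphicNear E h x)
    (hh : ∀ᶠ y in 𝓝 x, ∃ᶠ z in 𝓝 y, h z ≠ 0) :
    holomorphicGerm E h hf ∈ nonZeroDivisors (holomorphicGerms E x) := by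
  rw [mem_nonZeroDivisors_iff_right]
  rintro ⟨_, f, hfx, rfl⟩ h0
  refine (holomorphicGerm_eq_zero_iff hfx).2 (eventually_eq_zero_of_mul hfx hh ?_)
  exact (holomorphicGerm_eq_zero_iff (hfx.mul hf)).1 h0

end Systems

/-! ### Algebraic dimension zero: ratios of proportional tensor fields are constant -/

section Ratio

variable {E : Type*} [NormedAddCommGroup E] [NormedSpace ℂ E]
variable {X : Type*} [TopologicalSpace X] [ChartedSpace E X]

/-- A meromorphic function on a manifold of algebraic dimension zero is a root of a product of
linear factors. -/
theorem exists_prod_sub_eq_zero (ha : algebraicDimension E X = 0)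
    (s : meromorphicFunctions E X) :
    ∃ S : Multiset ℂ, ∀ x, (S.map fun c => s.1 x - algebraMap ℂ (MeromorphicGerms E x) c).prod = 0 := by
  have halg : Algebra.IsAlgebraic ℂ (meromorphicFunctions E X) := trdeg_eq_zero_iff.1 ha
  obtain ⟨p, hp0, hp⟩ := halg.isAlgebraic s
  refine ⟨p.roots, fun x => ?_⟩
  let ev : meromorphicFunctions E X →ₐ[ℂ] MeromorphicGerms E x :=
    (Pi.evalAlgHom ℂ _ x).comp (meromorphicFunctions E X).val
  have h1 : Polynomial.aeval (s.1 x) p = 0 := by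
    have := congrArg ev hp
    rwa [map_zero, ← Polynomial.aeval_algHom_apply] at this
  rw [(IsAlgClosed.splits p).eq_prod_roots, map_mul, Polynomial.aeval_C, map_multiset_prod,
    Multiset.map_map] at h1
  have hu : IsUnit (algebraMap ℂ (MeromorphicGerms E x) p.leadingCoeff) :=
    (IsUnit.mk0 _ (Polynomial.leadingCoeff_ne_zero.2 hp0)).map _
  have h2 := (hu.mul_right_eq_zero).1 h1
  refine Eq.trans (congrArg _ (Multiset.map_congr rfl fun c _ => ?_)) h2
  simp only [Function.comp_apply, map_sub, Polynomial.aeval_X, Polynomial.aeval_C]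

theorem holomorphicGerms_prod_val {x : X} (S : Multiset ℂ) (g h : X → ℂ)
    (hg : HolomorphicNear E g x) (hh : HolomorphicNear E h x) :
    ((S.map fun c => holomorphicGerm E g hg - constGerm E x c * holomorphicGerm E h hh).prod :
      holomorphicGerms E x).1 =
    ((fun z => (S.map fun c => g z - c * h z).prod : X → ℂ) : Filter.Germ (𝓝 x) ℂ) := by
  induction S using Multiset.induction_on with
  | empty => simp; rfl
  | cons c S ih =>
    simp only [Multiset.map_cons, Multiset.prod_cons]
    rw [Subring.coe_mul, ih]
    rfl

/-- If a quotient of holomorphic functions represents the germ of a meromorphic function on a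
manifold of algebraic dimension zero, then it is locally constant where it is defined. -/
theorem exists_prod_sub_mul_eq_zero {x : X} {σ : MeromorphicGerms E x} {S : Multiset ℂ}
    (hS : (S.map fun c => σ - algebraMap ℂ (MeromorphicGerms E x) c).prod = 0) {g h : X → ℂ}
    {hg : HolomorphicNear E g x} {hh : HolomorphicNear E h x}
    {h0 : holomorphicGerm E h hh ∈ nonZeroDivisors (holomorphicGerms E x)}
    (hσ : σ = Localization.mk (holomorphicGerm E g hg) ⟨holomorphicGerm E h hh, h0⟩) :
    ∀ᶠ z in 𝓝 x, (S.map fun c => g z - c * h z).prod = 0 := by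
  set ι := algebraMap (holomorphicGerms E x) (MeromorphicGerms E x) with hι
  have hσ' : σ * ι (holomorphicGerm E h hh) = ι (holomorphicGerm E g hg) := by
    rw [hσ, Localization.mk_eq_mk']
    exact IsLocalization.mk'_spec _ _ (⟨holomorphicGerm E h hh, h0⟩ : nonZeroDivisors _)
  -- Denominators are cleared by multiplying every factor by h; injectivity into the ring of
  -- fractions then gives the relation for holomorphic germs.
  have h1 : ι ((S.map fun c =>
      holomorphicGerm E g hg - constGerm E x c * holomorphicGerm E h hh).prod) =
      (S.map fun c => σ - algebraMap ℂ (MeromorphicGerms E x) c).prod *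
        ι (holomorphicGerm E h hh) ^ S.card := by
    clear hS
    induction S using Multiset.induction_on with
    | empty => simp
    | cons c S ih =>
      simp only [Multiset.map_cons, Multiset.prod_cons, Multiset.card_cons, map_mul, ih, map_sub]
      rw [← hσ']
      have : algebraMap ℂ (MeromorphicGerms E x) c = ι (constGerm E x c) :=
        IsScalarTower.algebraMap_apply ℂ (holomorphicGerms E x) (MeromorphicGerms E x) c
      rw [this]
      ring
  rw [hS, zero_mul] at h1
  have hinj : Function.Injective ι := IsLocalization.injective _ (le_refl (nonZeroDivisors _))
  have h2 := hinj (h1.trans (map_zero ι).symm)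
  have h3 := congrArg Subtype.val h2
  rw [holomorphicGerms_prod_val] at h3
  exact Filter.Germ.coe_eq.1 h3

variable {κ : Type*} {A B : OpenPartialHomeomorph X E → E → (κ → E) → ℂ}
variable [IsManifold 𝓘(ℂ, E) ω X]

/-- On a connected complex manifold of algebraic dimension zero, two holomorphic tensor fields
which are proportional at every point are proportional. -/
theorem IsHolomorphicTensor.exists_eq_const_mul [PreconnectedSpace X]
    (ha : algebraicDimension E X = 0)
    (hA : IsHolomorphicTensor A) (hB : IsHolomorphicTensor B)
    (hAB : ∀ e ∈ atlas E X, ∀ y ∈ e.target, ∀ w w',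
      B e y w * A e y w' = A e y w * B e y w')
    (hB0 : ∃ e ∈ atlas E X, ∃ y ∈ e.target, ∃ w, B e y w ≠ 0) :
    ∃ c : ℂ, ∀ e ∈ atlas E X, ∀ y ∈ e.target, ∀ w, A e y w = c * B e y w := by
  -- local expressions of the quotient
  have hloc (x : X) : ∃ (U : Set X) (g h : X → ℂ), IsOpen U ∧ x ∈ U ∧
      (∀ y ∈ U, HolomorphicNear E g y) ∧ (∀ y ∈ U, HolomorphicNear E h y) ∧
      (∀ y ∈ U, ∃ᶠ z in 𝓝 y, h z ≠ 0) ∧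
      (∀ y ∈ U, ∀ w, h y * tensorAt A y w = g y * tensorAt B y w) ∧
      (∀ y ∈ U, h y ≠ 0 → tensorAt B y ≠ 0) := by
    have he := chart_mem_atlas E x
    obtain ⟨U, hUo, hxU, hUs, hU⟩ := exists_chart_ball (E := E) x
    -- If every component of B vanished on some open subset of the coordinate ball, each would
    -- vanish on the whole ball, and then B on X by unique continuation. The component along this w
    -- serves as denominator.
    obtain ⟨w, hw⟩ : ∃ w, ∀ y ∈ U, ∃ᶠ z in 𝓝 y, B (chartAt E x) (chartAt E x z) w ≠ 0 := by
      by_contra! hcon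
      have : ∀ z ∈ U, tensorAt B z = 0 := by
        intro z hz
        refine (hB.tensorAt_eq_zero_iff he (hUs hz)).2 fun w => ?_
        refine hU (fun y => B (chartAt E x) y w) (hB.differentiableOn _ he w) ?_ z hz
        obtain ⟨y, hy, h⟩ := hcon w
        exact ⟨y, hy, by simpa using h⟩
      obtain ⟨e, he, y, hy, w, hne⟩ := hB0
      exact hne (hB.eq_zero (Filter.eventually_of_mem (hUo.mem_nhds hxU) this) he hy w)
    refine ⟨U, fun z => A (chartAt E x) (chartAt E x z) w,
      fun z => B (chartAt E x) (chartAt E x z) w, hUo, hxU,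
      fun y hy => holomorphicNear_comp_chart he (hA.differentiableOn _ he w) (hUs hy),
      fun y hy => holomorphicNear_comp_chart he (hB.differentiableOn _ he w) (hUs hy), hw,
      fun y hy w' => ?_, fun y hy hne h0 => ?_⟩
    · rw [hA.tensorAt_apply he (hUs hy), hB.tensorAt_apply he (hUs hy)]
      exact hAB _ he _ ((chartAt E x).map_source (hUs hy)) _ _
    · exact hne ((hB.tensorAt_eq_zero_iff he (hUs hy)).1 h0 w)
  choose U g h hUo hxU hg hh hne hgh hB' using hloc
  have hnz (x y : X) (hy : y ∈ U x) : holomorphicGerm E (h x) (hh x y hy) ∈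
      nonZeroDivisors (holomorphicGerms E y) :=
    holomorphicGerm_mem_nonZeroDivisors _
      (Filter.eventually_of_mem ((hUo x).mem_nhds hy) fun z hz => hne x z hz)
  let s : (x : X) → MeromorphicGerms E x := fun x =>
    Localization.mk (holomorphicGerm E (g x) (hg x x (hxU x)))
      ⟨holomorphicGerm E (h x) (hh x x (hxU x)), hnz x x (hxU x)⟩
  have hs : s ∈ meromorphicFunctions E X := by
    refine fun x => ⟨g x, h x, ?_⟩
    filter_upwards [(hUo x).mem_nhds (hxU x)] with y hy
    refine ⟨hg x y hy, hh x y hy, hnz x y hy, ?_⟩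
    rw [Localization.mk_eq_mk_iff, Localization.r_iff_exists]
    refine ⟨1, ?_⟩
    simp only [OneMemClass.coe_one, one_mul]
    refine Subtype.ext (Filter.Germ.coe_eq.2 ?_)
    -- Two local quotients agree: where the denominator at x is nonzero, so is B, and both quotients
    -- express the same ratio A / B. The points where this denominator is nonzero are dense.
    change ∀ᶠ z in 𝓝 y, h x z * g y z = h y z * g x z
    have hk : HolomorphicNear E (fun z => h x z * g y z - h y z * g x z) y := by
      filter_upwards [hg x y hy, hh x y hy, hg y y (hxU y), hh y y (hxU y)] with z a b c d
      exact (b.mul c).sub (d.mul a)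
    have hk0 := eventually_eq_zero_of_mul hk
      (Filter.eventually_of_mem ((hUo x).mem_nhds hy) fun z hz => hne x z hz) ?_
    · filter_upwards [hk0] with z hz using sub_eq_zero.1 hz
    filter_upwards [(hUo x).mem_nhds hy, (hUo y).mem_nhds (hxU y)] with z hzx hzy
    by_cases hz0 : h x z = 0
    · rw [hz0, mul_zero]
    · obtain ⟨w, hw⟩ := Function.ne_iff.1 (hB' x z hzx hz0)
      have e1 := hgh x z hzx w
      have e2 := hgh y z hzy w
      have : h x z * g y z - h y z * g x z = 0 := by
        refine (mul_eq_zero.1 ?_).resolve_right hw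
        linear_combination (-h x z) * e2 + h y z * e1
      rw [this, zero_mul]
  obtain ⟨S, hS⟩ := exists_prod_sub_eq_zero ha ⟨s, hs⟩
  obtain ⟨e₀, he₀, y₀, hy₀, w₀, -⟩ := hB0
  set x := e₀.symm y₀ with hx
  have hev := exists_prod_sub_mul_eq_zero (hS x) (g := g x) (h := h x) (h0 := hnz x x (hxU x)) rfl
  -- A point close to x where the denominator is nonzero and around which the polynomial relation
  -- holds.
  obtain ⟨z, hz, hzU, hzev, hgz, hhz⟩ := ((hne x x (hxU x)).and_eventually
    ((Filter.eventually_mem_set.2 ((hUo x).mem_nhds (hxU x))).and (hev.eventually_nhds.and ((hg x x (hxU x)).and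
      (hh x x (hxU x)))))).exists
  have hcont : ContinuousAt (fun t => g x t / h x t) z :=
    hgz.continuousAt.div hhz.continuousAt hz
  set c := g x z / h x z with hc
  -- Near z the quotient takes values in the finite set of roots; by continuity it avoids the roots
  -- other than c, so it is constantly c.
  have hfin : ∀ᶠ t in 𝓝 z, g x t / h x t ∉ ((S.toFinset.erase c : Finset ℂ) : Set ℂ) :=
    hcont.eventually ((Finset.finite_toSet _).isClosed.isOpen_compl.mem_nhds (by simp [hc]))
  have hzero : ∀ᶠ t in 𝓝 z, tensorAt (fun e y w => A e y w - c * B e y w) t = 0 := by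
    filter_upwards [hfin, hzev, hhz.continuousAt.eventually_ne hz, (hUo x).mem_nhds hzU]
      with t h1 h2 h3 h4
    rw [Multiset.prod_eq_zero_iff, Multiset.mem_map] at h2
    obtain ⟨a, haS, hat⟩ := h2
    have hqa : g x t / h x t = a := by
      rw [div_eq_iff h3]; exact sub_eq_zero.1 hat
    rw [hqa] at h1
    have hac : a = c := by
      by_contra hne
      exact h1 (by simp [hne, haS])
    funext w
    have e1 := hgh x t h4 w
    have e2 : g x t = c * h x t := by rw [← hac, ← hqa]; field_simp
    have : h x t * (tensorAt A t w - c * tensorAt B t w) = 0 := by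
      rw [e2] at e1
      linear_combination e1
    exact (mul_eq_zero.1 this).resolve_left h3
  exact ⟨c, fun e he y hy w => sub_eq_zero.1 ((hA.sub_smul hB c).eq_zero hzero he hy w)⟩

end Ratio

/-! ### The inversion w ↦ -4 w / ‖w‖² and its derivative -/

section Inversion

variable {V : Type*} [NormedAddCommGroup V] [InnerProductSpace ℝ V]

/-- The transition between antipodal stereographic projections. -/
def antipodalInversion (w : V) : V := (-4 * (‖w‖ ^ 2)⁻¹) • w

theorem norm_antipodalInversion {w : V} (hw : w ≠ 0) : ‖antipodalInversion w‖ = 4 * ‖w‖⁻¹ := by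
  have : ‖w‖ ≠ 0 := norm_ne_zero_iff.2 hw
  rw [antipodalInversion, norm_smul, norm_mul, norm_inv, norm_neg, norm_pow, norm_norm]
  norm_num
  field_simp

theorem antipodalInversion_ne_zero {w : V} (hw : w ≠ 0) : antipodalInversion w ≠ 0 := by
  have : ‖w‖ ≠ 0 := norm_ne_zero_iff.2 hw
  rw [← norm_ne_zero_iff, norm_antipodalInversion hw]
  positivity

theorem contDiffAt_antipodalInversion {w : V} (hw : w ≠ 0) :
    ContDiffAt ℝ ∞ (antipodalInversion (V := V)) w := by
  refine ContDiffAt.smul (contDiffAt_const.mul (ContDiffAt.inv ?_ ?_)) contDiffAt_id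
  · exact (contDiff_norm_sq ℝ).contDiffAt
  · have : ‖w‖ ≠ 0 := norm_ne_zero_iff.2 hw
    positivity

/-- The derivative is v ↦ -4 v / ‖w‖² + 8 ⟨w, v⟩ w / ‖w‖⁴, and 12 = 4 + 8. -/
theorem norm_fderiv_antipodalInversion_le {w : V} (hw : w ≠ 0) :
    ‖w‖ ^ 2 * ‖fderiv ℝ (antipodalInversion (V := V)) w‖ ≤ 12 := by
  have hw0 : ‖w‖ ≠ 0 := norm_ne_zero_iff.2 hw
  have h1 : HasFDerivAt (fun x : V => (‖x‖ ^ 2)⁻¹) _ w :=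
    (hasDerivAt_inv (pow_ne_zero 2 hw0)).comp_hasFDerivAt w
      (hasStrictFDerivAt_norm_sq w).hasFDerivAt
  have h2 : HasFDerivAt (antipodalInversion (V := V)) _ w :=
    (h1.const_mul (-4)).smul (hasFDerivAt_id w)
  rw [h2.fderiv, ← le_div_iff₀' (by positivity)]
  refine ContinuousLinearMap.opNorm_le_bound _ (by positivity) fun v => ?_
  have e : ((-4 * (‖w‖ ^ 2)⁻¹) • ContinuousLinearMap.id ℝ V + ((-4 : ℝ) • (-((‖w‖ ^ 2) ^ 2)⁻¹) •
      (2 • innerSL ℝ w)).smulRight w) v =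
      (-4 * (‖w‖ ^ 2)⁻¹) • v + (8 * ((‖w‖ ^ 2) ^ 2)⁻¹ * inner ℝ w v) • w := by
    simp only [add_apply, smul_apply, ContinuousLinearMap.smulRight_apply,
      ContinuousLinearMap.id_apply, innerSL_apply_apply, smul_eq_mul, nsmul_eq_mul]
    congr 2
    push_cast
    ring
  refine (congrArg norm e).trans_le ?_
  have hin : |inner ℝ w v| ≤ ‖w‖ * ‖v‖ := abs_real_inner_le_norm w v
  calc ‖(-4 * (‖w‖ ^ 2)⁻¹) • v + (8 * ((‖w‖ ^ 2) ^ 2)⁻¹ * inner ℝ w v) • w‖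
      ≤ (4 * (‖w‖ ^ 2)⁻¹) * ‖v‖ + (8 * ((‖w‖ ^ 2) ^ 2)⁻¹ * (‖w‖ * ‖v‖)) * ‖w‖ := by
        refine (norm_add_le _ _).trans ?_
        rw [norm_smul, norm_smul, norm_mul, norm_mul, norm_mul]
        gcongr
        · simp
        · simp
        · simp
        · simp
        · exact hin
    _ = 12 / ‖w‖ ^ 2 * ‖v‖ := by field_simp; norm_num

end Inversion

/-! ### Antipodal stereographic charts -/

section Sphere

local notation "ℝ⁶" => EuclideanSpace ℝ (Fin 6)
local notation "𝕊⁶" => Metric.sphere (0 : EuclideanSpace ℝ (Fin 7)) 1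

/-- Inverse stereographic projection is (4 w + (‖w‖² - 4) v) / (‖w‖² + 4), after the identification
of ℝ⁶ with the hyperplane orthogonal to v; the substitution w ↦ -4 w / ‖w‖² changes its sign. -/
theorem neg_stereographic'_symm [Fact (Module.finrank ℝ (EuclideanSpace ℝ (Fin 7)) = 6 + 1)]
    (v : 𝕊⁶) {w : ℝ⁶} (hw : w ≠ 0) :
    -(stereographic' 6 v).symm w = (stereographic' 6 v).symm (antipodalInversion w) := by
  have hw0 : ‖w‖ ≠ 0 := norm_ne_zero_iff.2 hw
  refine Subtype.ext ?_
  change -((stereographic' 6 v).symm w : EuclideanSpace ℝ (Fin 7)) = _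
  rw [stereographic'_symm_apply, stereographic'_symm_apply]
  dsimp only
  set U := (OrthonormalBasis.fromOrthogonalSpanSingleton (𝕜 := ℝ) 6
    (ne_zero_of_mem_unit_sphere v)).repr with hU
  have n1 : ‖(U.symm w : EuclideanSpace ℝ (Fin 7))‖ = ‖w‖ := U.symm.norm_map w
  have n2 : ‖(U.symm (antipodalInversion w) : EuclideanSpace ℝ (Fin 7))‖ = 4 * ‖w‖⁻¹ :=
    (U.symm.norm_map _).trans (norm_antipodalInversion hw)
  have e2 : (U.symm (antipodalInversion w) : EuclideanSpace ℝ (Fin 7)) =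
      (-4 * (‖w‖ ^ 2)⁻¹) • (U.symm w : EuclideanSpace ℝ (Fin 7)) := by
    rw [antipodalInversion, map_smul]; rfl
  rw [n1, n2, e2]
  simp only [smul_smul, neg_add, ← neg_smul]
  congr 2 <;> · field_simp; ring

variable {E : Type*} [NormedAddCommGroup E] [NormedSpace ℂ E]
variable {X : Type*} [TopologicalSpace X] [ChartedSpace E X]

/-- A pair of smooth charts of a manifold diffeomorphic to the six-sphere which look like
antipodal stereographic projections. -/
structure AntipodalCharts (θ₁ θ₂ : OpenPartialHomeomorph X ℝ⁶) : Prop where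
  target₁ : θ₁.target = Set.univ
  target₂ : θ₂.target = Set.univ
  cover : θ₁.source ∪ θ₂.source = Set.univ
  contMDiffOn₁ : ContMDiffOn (realModel E) 𝓘(ℝ, ℝ⁶) ∞ θ₁ θ₁.source
  contMDiffOn₂ : ContMDiffOn (realModel E) 𝓘(ℝ, ℝ⁶) ∞ θ₂ θ₂.source
  contMDiff_symm₁ : ContMDiff 𝓘(ℝ, ℝ⁶) (realModel E) ∞ θ₁.symm
  contMDiff_symm₂ : ContMDiff 𝓘(ℝ, ℝ⁶) (realModel E) ∞ θ₂.symm
  symm₁ : ∀ w, w ≠ 0 → θ₁.symm w = θ₂.symm (antipodalInversion w)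
  symm₂ : ∀ w, w ≠ 0 → θ₂.symm w = θ₁.symm (antipodalInversion w)
  symm_zero_ne : θ₁.symm 0 ≠ θ₂.symm 0

theorem AntipodalCharts.swap {θ₁ θ₂ : OpenPartialHomeomorph X ℝ⁶}
    (h : AntipodalCharts (E := E) θ₁ θ₂) : AntipodalCharts (E := E) θ₂ θ₁ :=
  ⟨h.target₂, h.target₁, Set.union_comm _ _ ▸ h.cover, h.contMDiffOn₂, h.contMDiffOn₁,
    h.contMDiff_symm₂, h.contMDiff_symm₁, h.symm₂, h.symm₁,
    h.symm_zero_ne.symm⟩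

/-- The second chart is the first stereographic projection preceded by x ↦ -x, rather than
projection from another pole. The transition map is then the same inversion in both directions, and
the two charts play symmetric roles. -/
theorem exists_antipodalCharts (Φ : X ≃ₘ⟮realModel E, 𝓡 6⟯ 𝕊⁶) :
    ∃ θ₁ θ₂ : OpenPartialHomeomorph X ℝ⁶, AntipodalCharts (E := E) θ₁ θ₂ := by
  have : Fact (Module.finrank ℝ (EuclideanSpace ℝ (Fin 7)) = 6 + 1) :=
    ⟨finrank_euclideanSpace_fin⟩
  let v : 𝕊⁶ := ⟨EuclideanSpace.single 0 1, by simp⟩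
  have hv : stereographic' 6 v ∈ atlas ℝ⁶ 𝕊⁶ := ⟨v, rfl⟩
  have hm : stereographic' 6 v ∈ IsManifold.maximalAtlas (𝓡 6) ∞ 𝕊⁶ :=
    IsManifold.subset_maximalAtlas hv
  have hc := contMDiffOn_of_mem_maximalAtlas hm
  have hcs := contMDiffOn_symm_of_mem_maximalAtlas hm
  rw [stereographic'_target] at hcs
  have hcs' : ContMDiff 𝓘(ℝ, ℝ⁶) (𝓡 6) ∞ (stereographic' 6 v).symm := contMDiffOn_univ.1 hcs
  have hneg : ContMDiff (𝓡 6) (𝓡 6) ∞ (fun x : 𝕊⁶ => -x) := contMDiff_neg_sphere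
  let Ψ : X ≃ₜ 𝕊⁶ := Φ.toHomeomorph
  let θ₁ : OpenPartialHomeomorph X ℝ⁶ := Ψ.toOpenPartialHomeomorph ≫ₕ stereographic' 6 v
  let θ₂ : OpenPartialHomeomorph X ℝ⁶ :=
    (Ψ.trans (Homeomorph.neg 𝕊⁶)).toOpenPartialHomeomorph ≫ₕ stereographic' 6 v
  have s1 (w : ℝ⁶) : θ₁.symm w = Φ.symm ((stereographic' 6 v).symm w) := rfl
  have s2 (w : ℝ⁶) : θ₂.symm w = Φ.symm (-(stereographic' 6 v).symm w) := rfl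
  have o1 : θ₁.source = {x | Φ x ≠ v} := by
    ext x
    simp [θ₁, Ψ]
  have o2 : θ₂.source = {x | -Φ x ≠ v} := by
    ext x
    simp [θ₂, Ψ]
  refine ⟨θ₁, θ₂, ⟨?_, ?_, ?_, ?_, ?_, ?_, ?_, ?_, ?_, ?_⟩⟩
  · simp [θ₁]
  · simp [θ₂]
  · ext x
    simp only [o1, o2, Set.mem_union, Set.mem_ofPred_eq, Set.mem_univ, iff_true]
    by_contra! h
    have h1 : -v = v := by rw [← h.1]; exact h.2.trans h.1.symm
    exact ne_neg_of_mem_unit_sphere ℝ v h1.symm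
  · refine hc.comp Φ.contMDiff.contMDiffOn fun x hx => ?_
    rw [o1] at hx
    simpa using! hx
  · refine hc.comp (hneg.comp Φ.contMDiff).contMDiffOn fun x hx => ?_
    rw [o2] at hx
    simpa using! hx
  · exact Φ.symm.contMDiff.comp hcs'
  · exact Φ.symm.contMDiff.comp (hneg.comp hcs')
  · intro w hw
    rw [s1, s2, ← neg_stereographic'_symm v hw, neg_neg]
  · intro w hw
    rw [s1, s2, neg_stereographic'_symm v hw]
  · rw [s1, s2]
    exact fun h => ne_neg_of_mem_unit_sphere ℝ _ (Φ.symm.injective h)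

end Sphere

/-! ### The three-form F ∧ dG on a vector space -/

section WedgeField

variable {V : Type*} [NormedAddCommGroup V] [NormedSpace ℝ V]

/-- The values of `λ ∧ β` for a one-form `λ` and a two-form `β`. -/
def wedgeOneTwo {V : Type*} (l : V → ℂ) (b : V → V → ℂ) (u v w : V) : ℂ :=
  l u * b v w + l v * b w u + l w * b u v

/-- The values of `β ∧ γ` for two-forms `β` and `γ`. -/
def wedgeTwoTwo {V : Type*} (b c : V → V → ℂ) (x y z w : V) : ℂ :=
  b x y * c z w - b x z * c y w + b x w * c y z + b y z * c x w - b y w * c x z + b z w * c x y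

/-- The form `F ∧ dG` of degree three. -/
def wedgeField (F G : V → V →L[ℝ] ℂ) (x : V) : V →L[ℝ] V →L[ℝ] V →L[ℝ] ℂ :=
  -- Here t(u, v, w) = F(u) dG(v, w); the flips supply the other two terms of the cyclic sum.
  let t : V →L[ℝ] V →L[ℝ] V →L[ℝ] ℂ := (F x).smulRight (fderiv ℝ G x - (fderiv ℝ G x).flip)
  t - t.flip + ((ContinuousLinearMap.flipₗᵢ ℝ V V ℂ).toContinuousLinearEquiv :
    (V →L[ℝ] V →L[ℝ] ℂ) →L[ℝ] (V →L[ℝ] V →L[ℝ] ℂ)).comp t.flip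

variable {F G : V → V →L[ℝ] ℂ}

theorem wedgeField_apply (F G : V → V →L[ℝ] ℂ) (x u v w : V) :
    wedgeField F G x u v w = wedgeOneTwo (F x) (dOne G x) u v w := by
  simp [wedgeField, wedgeOneTwo, dOne]
  ring

theorem isAlternating_wedgeField (F G : V → V →L[ℝ] ℂ) : IsAlternating (wedgeField F G) := by
  constructor <;> intro x u v w <;> simp only [wedgeField_apply, wedgeOneTwo, dOne] <;> ring

variable [FiniteDimensional ℝ V]

theorem contDiff_wedgeField (hF : ContDiff ℝ ∞ F) (hG : ContDiff ℝ ∞ G) :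
    ContDiff ℝ 1 (wedgeField F G) := by
  have hF1 : ContDiff ℝ 1 F := hF.of_le (by norm_cast)
  have hG1 : ContDiff ℝ 1 (fderiv ℝ G) := hG.fderiv_right (by norm_cast)
  refine contDiff_clm_apply_iff.2 fun u => contDiff_clm_apply_iff.2 fun v =>
    contDiff_clm_apply_iff.2 fun w => ?_
  simp only [wedgeField_apply, wedgeOneTwo, dOne]
  fun_prop

/-- d(F ∧ dG) = dF ∧ dG, since the second derivatives of G cancel by symmetry. -/
theorem isClosedField_wedgeField (hF : ContDiff ℝ ∞ F) (hG : ContDiff ℝ ∞ G)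
    (h : ∀ x a b c d, wedgeTwoTwo (dOne F x) (dOne G x) a b c d = 0) :
    IsClosedField (wedgeField F G) := by
  intro x a b c d
  set H := fderiv ℝ (fderiv ℝ G) x with hH
  have hF1 : HasFDerivAt F (fderiv ℝ F x) x := (hF.differentiable (by simp) x).hasFDerivAt
  have hG1 : HasFDerivAt (fderiv ℝ G) H x :=
    ((hG.fderiv_right (m := 1) (by norm_cast)).differentiable one_ne_zero x).hasFDerivAt
  have hsymm (u v w : V) : H u v w = H v u w := by
    have : IsSymmSndFDerivAt ℝ G x := hG.contDiffAt.isSymmSndFDerivAt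
      (by rw [minSmoothness_of_isRCLikeNormedField]; exact WithTop.coe_le_coe.2 le_top)
    rw [this.eq u v]
  have hT (t u v w : V) : fderiv ℝ (wedgeField F G) x t u v w =
      fderiv ℝ F x t u * dOne G x v w + F x u * (H t v w - H t w v) +
      (fderiv ℝ F x t v * dOne G x w u + F x v * (H t w u - H t u w)) +
      (fderiv ℝ F x t w * dOne G x u v + F x w * (H t u v - H t v u)) := by
    have hd : HasFDerivAt (wedgeField F G) (fderiv ℝ (wedgeField F G) x) x :=
      ((contDiff_wedgeField hF hG).differentiable one_ne_zero x).hasFDerivAt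
    have h1 : HasFDerivAt (fun y => wedgeField F G y u v w) _ x :=
      ((hd.clm_apply (hasFDerivAt_const u x)).clm_apply (hasFDerivAt_const v x)).clm_apply
        (hasFDerivAt_const w x)
    have f1 (u : V) := hF1.clm_apply (hasFDerivAt_const u x)
    have g1 (u v : V) := (hG1.clm_apply (hasFDerivAt_const u x)).clm_apply (hasFDerivAt_const v x)
    have h2 : HasFDerivAt (fun y => wedgeOneTwo (F y) (dOne G y) u v w) _ x :=
      (((f1 u).mul ((g1 v w).sub (g1 w v))).add ((f1 v).mul ((g1 w u).sub (g1 u w)))).add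
        ((f1 w).mul ((g1 u v).sub (g1 v u)))
    simp only [← wedgeField_apply] at h2
    have h3 := DFunLike.congr_fun (h1.unique h2) t
    simp at h3
    rw [h3]
    simp only [dOne]
    ring
  simp only [hT]
  have h0 := h x a b c d
  simp only [wedgeTwoTwo, dOne] at h0 ⊢
  simp only [hsymm b a, hsymm c a, hsymm d a, hsymm c b, hsymm d b, hsymm d c]
  linear_combination h0

end WedgeField

/-! ### Complex linear algebra in dimension three -/

section ThreeDimensional

variable {E : Type*} [NormedAddCommGroup E] [NormedSpace ℂ E]

/-- The two-form in dimension three with the given coefficients. -/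
def twoFormOfCoeff (bE : Module.Basis (Fin 3) ℂ E) (b : Fin 3 → ℂ) (u v : E) : ℂ :=
  b 0 * (bE.coord 1 u * bE.coord 2 v - bE.coord 2 u * bE.coord 1 v) +
  b 1 * (bE.coord 2 u * bE.coord 0 v - bE.coord 0 u * bE.coord 2 v) +
  b 2 * (bE.coord 0 u * bE.coord 1 v - bE.coord 1 u * bE.coord 0 v)

theorem sum_three_smul (bE : Module.Basis (Fin 3) ℂ E) (u : E) :
    u = bE.coord 0 u • bE 0 + bE.coord 1 u • bE 1 + bE.coord 2 u • bE 2 := by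
  have h := bE.sum_repr u
  rw [Fin.sum_univ_three] at h
  exact h.symm

theorem exists_coeff_of_map_I_smul (bE : Module.Basis (Fin 3) ℂ E) {L : E →L[ℝ] ℂ}
    (h : ∀ v, L (Complex.I • v) = Complex.I * L v) :
    ∃ l : Fin 3 → ℂ, ∀ u, L u = l 0 * bE.coord 0 u + l 1 * bE.coord 1 u + l 2 * bE.coord 2 u := by
  refine ⟨fun i => L (bE i), fun u => ?_⟩
  conv_lhs => rw [sum_three_smul bE u]
  simp only [map_add, map_complex_smul_of_map_I_smul h, smul_eq_mul]
  ring

theorem exists_twoFormOfCoeff (bE : Module.Basis (Fin 3) ℂ E) {D : E →L[ℝ] E →L[ℝ] ℂ}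
    (h : ∀ u v, D (Complex.I • u) v = Complex.I * D u v)
    (h' : ∀ u v, D u (Complex.I • v) = Complex.I * D u v) :
    ∃ b : Fin 3 → ℂ, ∀ u v, D u v - D v u = twoFormOfCoeff bE b u v := by
  have hs (c : ℂ) (u : E) : D (c • u) = c • D u :=
    map_complex_smul_of_map_I_smul (fun v => by ext w; exact h v w) c u
  have hs' (c : ℂ) (u v : E) : D u (c • v) = c • D u v :=
    map_complex_smul_of_map_I_smul (h' u) c v
  refine ⟨![D (bE 1) (bE 2) - D (bE 2) (bE 1), D (bE 2) (bE 0) - D (bE 0) (bE 2),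
    D (bE 0) (bE 1) - D (bE 1) (bE 0)], fun u v => ?_⟩
  conv_lhs => rw [sum_three_smul bE u, sum_three_smul bE v]
  simp only [map_add, hs, hs', add_apply, smul_apply, smul_eq_mul, twoFormOfCoeff,
    Matrix.cons_val_zero, Matrix.cons_val_one, Matrix.cons_val]
  ring

variable {bE : Module.Basis (Fin 3) ℂ E}

/-- There are no complex four-forms in dimension three. -/
theorem wedgeTwoTwo_twoFormOfCoeff (b c : Fin 3 → ℂ) (x y z w : E) :
    wedgeTwoTwo (twoFormOfCoeff bE b) (twoFormOfCoeff bE c) x y z w = 0 := by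
  simp only [wedgeTwoTwo, twoFormOfCoeff]
  ring

theorem wedgeOneTwo_twoFormOfCoeff {L : E → ℂ} {l : Fin 3 → ℂ}
    (hL : ∀ u, L u = l 0 * bE.coord 0 u + l 1 * bE.coord 1 u + l 2 * bE.coord 2 u)
    (b : Fin 3 → ℂ) (u v w : E) :
    wedgeOneTwo L (twoFormOfCoeff bE b) u v w =
      (l 0 * b 0 + l 1 * b 1 + l 2 * b 2) * bE.det ![u, v, w] := by
  rw [basis_det_three, wedgeOneTwo, hL, hL, hL]
  simp only [twoFormOfCoeff]
  ring

/-- Two-forms in dimension three whose wedge products with two given covectors vanish are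
proportional to the wedge product of these covectors. -/
theorem twoForm_proportional {L L' : E → ℂ} {l l' b : Fin 3 → ℂ}
    (hL : ∀ u, L u = l 0 * bE.coord 0 u + l 1 * bE.coord 1 u + l 2 * bE.coord 2 u)
    (hL' : ∀ u, L' u = l' 0 * bE.coord 0 u + l' 1 * bE.coord 1 u + l' 2 * bE.coord 2 u)
    (h : l 0 * b 0 + l 1 * b 1 + l 2 * b 2 = 0)
    (h' : l' 0 * b 0 + l' 1 * b 1 + l' 2 * b 2 = 0) (u v u' v' : E) :
    (L u * L' v - L v * L' u) * twoFormOfCoeff bE b u' v' =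
      twoFormOfCoeff bE b u v * (L u' * L' v' - L v' * L' u') := by
  -- The coefficient vector of L ∧ L' is the cross product m = l × l'. Since b has zero products
  -- with l and l', the identity b × (l × l') = (b · l') l - (b · l) l' shows that b and m are
  -- parallel.
  set m : Fin 3 → ℂ := ![l 1 * l' 2 - l 2 * l' 1, l 2 * l' 0 - l 0 * l' 2,
    l 0 * l' 1 - l 1 * l' 0] with hm
  have hw (u v : E) : L u * L' v - L v * L' u = twoFormOfCoeff bE m u v := by
    rw [hL, hL, hL', hL']
    simp only [twoFormOfCoeff, hm, Matrix.cons_val_zero, Matrix.cons_val_one, Matrix.cons_val]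
    ring
  have m01 : b 0 * m 1 = b 1 * m 0 := by
    simp only [hm, Matrix.cons_val_zero, Matrix.cons_val_one]
    linear_combination l 2 * h' - l' 2 * h
  have m12 : b 1 * m 2 = b 2 * m 1 := by
    simp only [hm, Matrix.cons_val_zero, Matrix.cons_val_one, Matrix.cons_val]
    linear_combination l 0 * h' - l' 0 * h
  have m20 : b 2 * m 0 = b 0 * m 2 := by
    simp only [hm, Matrix.cons_val_zero, Matrix.cons_val]
    linear_combination l 1 * h' - l' 1 * h
  rw [hw, hw]
  simp only [twoFormOfCoeff]
  set p0 := bE.coord 1 u * bE.coord 2 v - bE.coord 2 u * bE.coord 1 v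
  set p1 := bE.coord 2 u * bE.coord 0 v - bE.coord 0 u * bE.coord 2 v
  set p2 := bE.coord 0 u * bE.coord 1 v - bE.coord 1 u * bE.coord 0 v
  set q0 := bE.coord 1 u' * bE.coord 2 v' - bE.coord 2 u' * bE.coord 1 v'
  set q1 := bE.coord 2 u' * bE.coord 0 v' - bE.coord 0 u' * bE.coord 2 v'
  set q2 := bE.coord 0 u' * bE.coord 1 v' - bE.coord 1 u' * bE.coord 0 v'
  linear_combination (p1 * q0 - p0 * q1) * m01 + (p2 * q1 - p1 * q2) * m12
    + (p0 * q2 - p2 * q0) * m20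

end ThreeDimensional

/-! ### One-forms pulled back along smooth parametrizations, read in holomorphic charts -/

section Parametrization

variable {E : Type*} [NormedAddCommGroup E] [NormedSpace ℂ E]
variable {X : Type*} [TopologicalSpace X] [ChartedSpace E X] [hX : IsManifold 𝓘(ℂ, E) ω X]
variable {V : Type*} [NormedAddCommGroup V] [NormedSpace ℝ V]
variable {ψ : V → X} {e : OpenPartialHomeomorph X E} {η η' : Form E X 1}

theorem contDiffAt_chart_comp (hψ : ContMDiff 𝓘(ℝ, V) (realModel E) ∞ ψ) (he : e ∈ atlas E X)
    {x : V} (hx : ψ x ∈ e.source) : ContDiffAt ℝ ∞ (e ∘ ψ) x := by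
  have := isManifold_realModel hX
  have h := (contMDiffOn_of_mem_maximalAtlas (I := realModel E) (n := ∞)
    (IsManifold.subset_maximalAtlas he)).contMDiffAt (e.open_source.mem_nhds hx)
  exact (h.comp x hψ.contMDiffAt).contDiffAt

omit hX in
theorem eventuallyEq_symm_comp_chart (hψ : ContMDiff 𝓘(ℝ, V) (realModel E) ∞ ψ)
    {x : V} (hx : ψ x ∈ e.source) : ψ =ᶠ[𝓝 x] e.symm ∘ (e ∘ ψ) := by
  filter_upwards [hψ.continuous.continuousAt.preimage_mem_nhds (e.open_source.mem_nhds hx)] with z hz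
  exact (e.left_inv hz).symm

theorem pull_eq_comp_chart (η : Form E X 1) (hψ : ContMDiff 𝓘(ℝ, V) (realModel E) ∞ ψ)
    (he : e ∈ atlas E X) {x : V} (hx : ψ x ∈ e.source) :
    η.pull ψ x = (η.pull e.symm (e (ψ x))).comp (fderiv ℝ (e ∘ ψ) x) :=
  η.pull_comp (eventuallyEq_symm_comp_chart hψ hx)
    ((contDiffAt_chart_comp hψ he hx).differentiableAt (by simp))
    (mdifferentiableAt_real_symm he (e.map_source hx))

omit hX in
theorem differentiableAt_pull_symm (hη : η.IsSmooth) (he : e ∈ atlas E X) {y : E}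
    (hy : y ∈ e.target) : DifferentiableAt ℝ (η.pull e.symm) y :=
  ((contDiffOn_pull_symm hη he).contDiffAt (e.open_target.mem_nhds hy)).differentiableAt (by simp)

theorem dOne_pull_eq_comp_chart (hη : η.IsSmooth) (hψ : ContMDiff 𝓘(ℝ, V) (realModel E) ∞ ψ)
    (he : e ∈ atlas E X) {x : V} (hx : ψ x ∈ e.source) (u v : V) :
    dOne (η.pull ψ) x u v = dOne (η.pull e.symm) (e (ψ x)) (fderiv ℝ (e ∘ ψ) x u)
      (fderiv ℝ (e ∘ ψ) x v) := by
  refine η.dOne_pull_comp (eventuallyEq_symm_comp_chart hψ hx) (contDiffAt_chart_comp hψ he hx) ?_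
    (differentiableAt_pull_symm hη he (e.map_source hx)) u v
  filter_upwards [e.open_target.mem_nhds (e.map_source hx)] with z hz
    using mdifferentiableAt_real_symm he hz

theorem contDiff_pull (hη : η.IsSmooth) (hψ : ContMDiff 𝓘(ℝ, V) (realModel E) ∞ ψ) :
    ContDiff ℝ ∞ (η.pull ψ) := by
  refine contDiff_iff_contDiffAt.2 fun x => ?_
  set e := chartAt E (ψ x)
  have he : e ∈ atlas E X := chart_mem_atlas E _
  have hx : ψ x ∈ e.source := mem_chart_source E _
  have hc := contDiffAt_chart_comp hψ he hx
  have h1 : ContDiffAt ℝ ∞ (fun z => (η.pull e.symm ((e ∘ ψ) z)).comp (fderiv ℝ (e ∘ ψ) z)) x :=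
    (ContDiffAt.comp (g := η.pull e.symm) x ((contDiffOn_pull_symm hη he).contDiffAt
      (e.open_target.mem_nhds (e.map_source hx))) hc).clm_comp (hc.fderiv_right le_rfl)
  refine h1.congr_of_eventuallyEq ?_
  filter_upwards [hψ.continuous.continuousAt.preimage_mem_nhds (e.open_source.mem_nhds hx)] with z hz
  exact pull_eq_comp_chart η hψ he hz

end Parametrization

/-! ### Holomorphic one-forms in charts -/

section Holomorphic

variable {E : Type*} [NormedAddCommGroup E] [NormedSpace ℂ E]
variable {X : Type*} [TopologicalSpace X] [ChartedSpace E X] [hX : IsManifold 𝓘(ℂ, E) ω X]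
variable {e e' : OpenPartialHomeomorph X E} {η η' : Form E X 1}

/-- Holomorphic one-forms, as smooth forms of type `(1, 0)` which are `∂̄`-closed. -/
structure Form.IsHolomorphicOneForm (η : Form E X 1) : Prop where
  isSmooth : η.IsSmooth
  isOfType : η.IsOfType 1 0
  hasDbar : η.HasDbar 0

theorem Form.IsHolomorphicOneForm.exists_coeff (hη : η.IsHolomorphicOneForm)
    (bE : Module.Basis (Fin 3) ℂ E) (he : e ∈ atlas E X) {y : E} (hy : y ∈ e.target) :
    ∃ l : Fin 3 → ℂ, ∀ u, η.pull e.symm y u =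
      l 0 * bE.coord 0 u + l 1 * bE.coord 1 u + l 2 * bE.coord 2 u :=
  exists_coeff_of_map_I_smul bE fun v => pull_symm_smul hη.isOfType he hy _ v

theorem Form.IsHolomorphicOneForm.fderiv_I_smul (hη : η.IsHolomorphicOneForm)
    (he : e ∈ atlas E X) {y : E} (hy : y ∈ e.target) (u v : E) :
    fderiv ℝ (η.pull e.symm) y (Complex.I • u) v = Complex.I * fderiv ℝ (η.pull e.symm) y u v :=
  fderiv_pull_symm_I_smul hη.isSmooth hη.isOfType hη.hasDbar he hy u v

theorem Form.IsHolomorphicOneForm.fderiv_apply_I_smul (hη : η.IsHolomorphicOneForm)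
    (he : e ∈ atlas E X) {y : E} (hy : y ∈ e.target) (u v : E) :
    fderiv ℝ (η.pull e.symm) y u (Complex.I • v) = Complex.I * fderiv ℝ (η.pull e.symm) y u v := by
  have happ (w : E) : HasFDerivAt (fun z => η.pull e.symm z w)
      ((fderiv ℝ (η.pull e.symm) y).flip w) y := by
    have := (differentiableAt_pull_symm hη.isSmooth he hy).hasFDerivAt.clm_apply
      (hasFDerivAt_const w y)
    rwa [ContinuousLinearMap.comp_zero, zero_add] at this
  have hev : (fun z => η.pull e.symm z (Complex.I • v)) =ᶠ[𝓝 y]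
      fun z => Complex.I * η.pull e.symm z v := by
    filter_upwards [e.open_target.mem_nhds hy] with z hz
      using pull_symm_smul hη.isOfType he hz _ _
  have h1 := (happ (Complex.I • v)).congr_of_eventuallyEq hev.symm
  have := DFunLike.congr_fun (h1.unique ((happ v).const_mul Complex.I)) u
  simpa using this

theorem Form.IsHolomorphicOneForm.exists_dOne_coeff (hη : η.IsHolomorphicOneForm)
    (bE : Module.Basis (Fin 3) ℂ E) (he : e ∈ atlas E X) {y : E} (hy : y ∈ e.target) :
    ∃ b : Fin 3 → ℂ, ∀ u v, dOne (η.pull e.symm) y u v = twoFormOfCoeff bE b u v :=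
  exists_twoFormOfCoeff bE (hη.fderiv_I_smul he hy) (hη.fderiv_apply_I_smul he hy)

theorem fderiv_transition (he : e ∈ atlas E X) (he' : e' ∈ atlas E X) {y : E}
    (hy : y ∈ e.target) (hy' : e.symm y ∈ e'.source) :
    ContDiffAt ℝ ∞ (e' ∘ e.symm) y ∧ ∃ D : E →L[ℂ] E,
      fderiv ℝ (e' ∘ e.symm) y = D.restrictScalars ℝ := by
  have h1 := contMDiffOn_of_mem_contDiffGroupoid (HasGroupoid.compatible
    (G := contDiffGroupoid ω 𝓘(ℂ, E)) he he')
  have h2 : ContDiffOn ℂ ω (e.symm ≫ₕ e') (e.symm ≫ₕ e').source := contMDiffOn_iff_contDiffOn.1 h1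
  have h3 : ContDiffAt ℂ ω (e' ∘ e.symm) y :=
    h2.contDiffAt ((e.symm ≫ₕ e').open_source.mem_nhds (by simp [hy, hy']))
  exact ⟨(h3.of_le le_top).restrict_scalars ℝ, _,
    ((h3.differentiableAt (by simp)).hasFDerivAt.restrictScalars ℝ).fderiv⟩

end Holomorphic

/-! ### Type considerations on parametrized forms, and the complex orientation -/

section Orientation

variable {E : Type*} [NormedAddCommGroup E] [NormedSpace ℂ E] [FiniteDimensional ℂ E]
variable {X : Type*} [TopologicalSpace X] [ChartedSpace E X] [hX : IsManifold 𝓘(ℂ, E) ω X]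
variable {V : Type*} [NormedAddCommGroup V] [NormedSpace ℝ V] [FiniteDimensional ℝ V]
variable {ψ : V → X} {e : OpenPartialHomeomorph X E} {η η' : Form E X 1}

/-- The derivative at `x` of a map from a vector space to `X`, read in the preferred chart. -/
def frameAt (E : Type*) [NormedAddCommGroup E] [NormedSpace ℂ E] {X : Type*} [TopologicalSpace X]
    [ChartedSpace E X] (ψ : V → X) (x : V) : V →L[ℝ] E := fderiv ℝ (chartAt E (ψ x) ∘ ψ) x

/-- The real determinant is the square of the absolute value of the complex one. -/
theorem det_restrictScalars_nonneg {ι : Type*} [Fintype ι] [DecidableEq ι]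
    (r : Module.Basis ι ℝ E) (D : E →L[ℂ] E) :
    0 ≤ (LinearMap.toMatrix r r (D.restrictScalars ℝ : E →ₗ[ℝ] E)).det := by
  rw [LinearMap.det_toMatrix]
  have h : (D.restrictScalars ℝ : E →ₗ[ℝ] E) = (D : E →ₗ[ℂ] E).restrictScalars ℝ := rfl
  rw [h, LinearMap.det_restrictScalars, Algebra.norm_complex_apply]
  exact Complex.normSq_nonneg _

omit [FiniteDimensional ℂ E] [FiniteDimensional ℝ V] in
-- In the preferred chart ω ∧ dω' is a complex three-form, hence a multiple of the determinant.
theorem wedgeField_pull_eq (hη : η.IsHolomorphicOneForm) (hη' : η'.IsHolomorphicOneForm)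
    (bE : Module.Basis (Fin 3) ℂ E) (hψ : ContMDiff 𝓘(ℝ, V) (realModel E) ∞ ψ) (x : V) :
    ∃ f : ℂ, ∀ u v w, wedgeField (η.pull ψ) (η'.pull ψ) x u v w =
      f * bE.det ![frameAt E ψ x u, frameAt E ψ x v, frameAt E ψ x w] := by
  have he : chartAt E (ψ x) ∈ atlas E X := chart_mem_atlas E _
  have hx : ψ x ∈ (chartAt E (ψ x)).source := mem_chart_source E _
  have hy := (chartAt E (ψ x)).map_source hx
  obtain ⟨l, hl⟩ := hη.exists_coeff bE he hy
  obtain ⟨b, hb⟩ := hη'.exists_dOne_coeff bE he hy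
  refine ⟨l 0 * b 0 + l 1 * b 1 + l 2 * b 2, fun u v w => ?_⟩
  rw [← wedgeOneTwo_twoFormOfCoeff hl, wedgeField_apply]
  simp only [wedgeOneTwo, ← hb, dOne_pull_eq_comp_chart hη'.isSmooth hψ he hx,
    pull_eq_comp_chart η hψ he hx]
  rfl

omit [FiniteDimensional ℂ E] [FiniteDimensional ℝ V] in
theorem wedgeTwoTwo_dOne_pull (hη : η.IsHolomorphicOneForm) (hη' : η'.IsHolomorphicOneForm)
    (bE : Module.Basis (Fin 3) ℂ E) (hψ : ContMDiff 𝓘(ℝ, V) (realModel E) ∞ ψ) (x a b c d : V) :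
    wedgeTwoTwo (dOne (η.pull ψ) x) (dOne (η'.pull ψ) x) a b c d = 0 := by
  have he : chartAt E (ψ x) ∈ atlas E X := chart_mem_atlas E _
  have hx : ψ x ∈ (chartAt E (ψ x)).source := mem_chart_source E _
  have hy := (chartAt E (ψ x)).map_source hx
  obtain ⟨l, hl⟩ := hη.exists_dOne_coeff bE he hy
  obtain ⟨m, hm⟩ := hη'.exists_dOne_coeff bE he hy
  have h := wedgeTwoTwo_twoFormOfCoeff (bE := bE) l m (frameAt E ψ x a) (frameAt E ψ x b)
    (frameAt E ψ x c) (frameAt E ψ x d)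
  simp only [wedgeTwoTwo, ← hl, ← hm] at h
  simp only [wedgeTwoTwo, dOne_pull_eq_comp_chart hη'.isSmooth hψ he hx,
    dOne_pull_eq_comp_chart hη.isSmooth hψ he hx]
  exact h

omit [FiniteDimensional ℂ E] [FiniteDimensional ℝ V] in
theorem fderiv_comp_chart_comp {θ : OpenPartialHomeomorph X V}
    (hs : ContMDiff 𝓘(ℝ, V) (realModel E) ∞ θ.symm) (ht : θ.target = Set.univ)
    (hc : ContMDiffOn (realModel E) 𝓘(ℝ, V) ∞ θ θ.source) (he : e ∈ atlas E X) {x : V}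
    (hx : θ.symm x ∈ e.source) :
    (fderiv ℝ (θ ∘ e.symm) (e (θ.symm x))).comp (fderiv ℝ (e ∘ θ.symm) x) =
      ContinuousLinearMap.id ℝ V := by
  have hy := e.map_source hx
  have h1 : MDifferentiableAt (realModel E) 𝓘(ℝ, V) (θ ∘ e.symm) (e (θ.symm x)) := by
    refine MDifferentiableAt.comp (I' := realModel E) _ ?_ (mdifferentiableAt_real_symm he hy)
    rw [e.left_inv hx]
    exact (hc.contMDiffAt (θ.open_source.mem_nhds
      (θ.map_target (by rw [ht]; trivial)))).mdifferentiableAt (by simp)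
  have h2 := h1.differentiableAt.hasFDerivAt.comp x
    ((contDiffAt_chart_comp hs he hx).differentiableAt (by simp)).hasFDerivAt
  refine h2.unique ((hasFDerivAt_id x).congr_of_eventuallyEq ?_)
  filter_upwards [hs.continuous.continuousAt.preimage_mem_nhds (e.open_source.mem_nhds hx)] with z hz
  simp only [Function.comp_apply]
  rw [e.left_inv hz, θ.right_inv (by rw [ht]; trivial)]
  rfl

/-- The frame jumps when the preferred chart changes, so its determinant is not continuous.
Holomorphic transition maps have positive real Jacobian, however, so the sign of the determinant is
locally constant, hence constant on the vector space. The determinant at the origin serves as s. -/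
theorem exists_orientation {ι : Type*} [Fintype ι] [DecidableEq ι] (β : Module.Basis ι ℝ V)
    (r : Module.Basis ι ℝ E) {θ : OpenPartialHomeomorph X V}
    (hs : ContMDiff 𝓘(ℝ, V) (realModel E) ∞ θ.symm) (ht : θ.target = Set.univ)
    (hc : ContMDiffOn (realModel E) 𝓘(ℝ, V) ∞ θ θ.source) :
    ∃ s : ℝ, ∀ x, 0 < s * (LinearMap.toMatrix β r (frameAt E θ.symm x : V →ₗ[ℝ] E)).det := by
  set J : V → ℝ := fun x => (LinearMap.toMatrix β r (frameAt E θ.symm x : V →ₗ[ℝ] E)).det with hJ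
  have hJ0 (x : V) : J x ≠ 0 := by
    have h := fderiv_comp_chart_comp hs ht hc (chart_mem_atlas E (θ.symm x))
      (mem_chart_source E (θ.symm x))
    have h1 := congrArg (fun L : V →L[ℝ] V => (LinearMap.toMatrix β β (L : V →ₗ[ℝ] V)).det) h
    rw [ContinuousLinearMap.toLinearMap_comp, LinearMap.toMatrix_comp β r β, Matrix.det_mul,
      ContinuousLinearMap.coe_id, LinearMap.toMatrix_id, Matrix.det_one] at h1
    exact right_ne_zero_of_mul_eq_one h1
  have hloc : IsLocallyConstant (fun x => SignType.sign (J x)) := by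
    refine (IsLocallyConstant.iff_eventually_eq _).2 fun x₀ => ?_
    set e := chartAt E (θ.symm x₀)
    have he : e ∈ atlas E X := chart_mem_atlas E _
    have hx : θ.symm x₀ ∈ e.source := mem_chart_source E _
    set g : V → ℝ := fun x => (LinearMap.toMatrix β r (fderiv ℝ (e ∘ θ.symm) x : V →ₗ[ℝ] E)).det
    have hg : ContinuousAt g x₀ := by
      have h1 : ContinuousAt (fderiv ℝ (e ∘ θ.symm)) x₀ :=
        ((contDiffAt_chart_comp hs he hx).fderiv_right (m := 0) (by norm_cast)).continuousAt
      have h2 : Continuous fun L : V →L[ℝ] E => (LinearMap.toMatrix β r (L : V →ₗ[ℝ] E)).det := by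
        refine Continuous.matrix_det (LinearMap.continuous_of_finiteDimensional
          ((LinearMap.toMatrix β r).toLinearMap.comp (ContinuousLinearMap.coeLM ℝ)))
      exact h2.continuousAt.comp h1
    have hsg : ∀ᶠ x in 𝓝 x₀, SignType.sign (g x) = SignType.sign (g x₀) := by
      rcases lt_or_gt_of_ne (show g x₀ ≠ 0 from hJ0 x₀) with h | h
      · filter_upwards [hg.eventually_lt continuousAt_const h] with x hx
        rw [sign_neg h, sign_neg hx]
      · filter_upwards [continuousAt_const.eventually_lt hg h] with x hx
        rw [sign_pos h, sign_pos hx]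
    filter_upwards [hsg, hs.continuous.continuousAt.preimage_mem_nhds (e.open_source.mem_nhds hx)]
      with x h1 h2
    have hx' : e.symm (e (θ.symm x)) ∈ (chartAt E (θ.symm x)).source := by
      rw [e.left_inv h2]; exact mem_chart_source E _
    obtain ⟨hτ, D, hD⟩ := fderiv_transition he (chart_mem_atlas E (θ.symm x)) (e.map_source h2) hx'
    -- The frame in the preferred chart at θ.symm x is the frame in the fixed chart e followed by
    -- the complex linear derivative of the transition map.
    have hcomp : frameAt E θ.symm x = (D.restrictScalars ℝ).comp (fderiv ℝ (e ∘ θ.symm) x) := by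
      have a := (hτ.differentiableAt (by simp)).hasFDerivAt.comp x
        ((contDiffAt_chart_comp hs he h2).differentiableAt (by simp)).hasFDerivAt
      rw [← hD, frameAt]
      refine (a.congr_of_eventuallyEq ?_).fderiv
      filter_upwards [hs.continuous.continuousAt.preimage_mem_nhds (e.open_source.mem_nhds h2)]
        with z hz
      simp only [Function.comp_apply]
      rw [e.left_inv hz]
    have hJx : J x = (LinearMap.toMatrix r r (D.restrictScalars ℝ : E →ₗ[ℝ] E)).det * g x := by
      simp only [hJ, hcomp]
      rw [ContinuousLinearMap.toLinearMap_comp, LinearMap.toMatrix_comp β r r, Matrix.det_mul]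
    have hpos := (det_restrictScalars_nonneg r D).lt_of_ne' fun h0 => hJ0 x (by rw [hJx, h0, zero_mul])
    rw [hJx, sign_mul, sign_pos hpos, one_mul, h1]
    rfl
  refine ⟨J 0, fun x => ?_⟩
  have h := hloc.apply_eq_of_preconnectedSpace 0 x
  change 0 < J 0 * J x
  rw [← sign_eq_one_iff, sign_mul, h, ← sign_mul, sign_eq_one_iff]
  exact mul_self_pos.2 (hJ0 x)

end Orientation

/-! ### Decay at infinity, and ω ∧ dω' = 0 -/

section Antipodal

local notation "ℝ⁶" => EuclideanSpace ℝ (Fin 6)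

variable {E : Type*} [NormedAddCommGroup E] [NormedSpace ℂ E]
variable {X : Type*} [TopologicalSpace X] [ChartedSpace E X] [hX : IsManifold 𝓘(ℂ, E) ω X]
variable {θ₁ θ₂ : OpenPartialHomeomorph X ℝ⁶} {η η' : Form E X 1}

omit hX in
theorem AntipodalCharts.eventuallyEq (h : AntipodalCharts (E := E) θ₁ θ₂) {x : ℝ⁶} (hx : x ≠ 0) :
    θ₁.symm =ᶠ[𝓝 x] θ₂.symm ∘ antipodalInversion := by
  filter_upwards [isOpen_ne.mem_nhds hx] with z hz using h.symm₁ z hz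

omit hX in
theorem AntipodalCharts.pull_eq (h : AntipodalCharts (E := E) θ₁ θ₂) (η : Form E X 1) {x : ℝ⁶}
    (hx : x ≠ 0) : η.pull θ₁.symm x =
      (η.pull θ₂.symm (antipodalInversion x)).comp (fderiv ℝ antipodalInversion x) :=
  η.pull_comp (h.eventuallyEq hx) ((contDiffAt_antipodalInversion hx).differentiableAt (by simp))
    (h.contMDiff_symm₂.mdifferentiableAt (by simp))

theorem AntipodalCharts.dOne_pull_eq (h : AntipodalCharts (E := E) θ₁ θ₂) (hη : η.IsSmooth) {x : ℝ⁶}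
    (hx : x ≠ 0) (u v : ℝ⁶) : dOne (η.pull θ₁.symm) x u v = dOne (η.pull θ₂.symm)
      (antipodalInversion x) (fderiv ℝ antipodalInversion x u) (fderiv ℝ antipodalInversion x v) :=
  η.dOne_pull_comp (h.eventuallyEq hx) (contDiffAt_antipodalInversion hx)
    (.of_forall fun _ => h.contMDiff_symm₂.mdifferentiableAt (by simp))
    ((contDiff_pull hη h.contMDiff_symm₂).differentiable (by simp) _) u v

/-- The form in one chart is the pullback by the inversion of the form in the other. It takes three
vectors, each contributing a factor at most 12 / ‖x‖², while for ‖x‖ ≥ 1 the image of x stays in the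
closed ball of radius 4, where the other form is bounded. -/
theorem AntipodalCharts.exists_decay (h : AntipodalCharts (E := E) θ₁ θ₂) (hη : η.IsSmooth)
    (hη' : η'.IsSmooth) : ∃ C, ∀ x, 1 ≤ ‖x‖ →
      ‖x‖ ^ 6 * ‖wedgeField (η.pull θ₁.symm) (η'.pull θ₁.symm) x‖ ≤ C := by
  set T₂ := wedgeField (η.pull θ₂.symm) (η'.pull θ₂.symm) with hT₂
  have hcont : Continuous T₂ := (contDiff_wedgeField (contDiff_pull hη h.contMDiff_symm₂)
    (contDiff_pull hη' h.contMDiff_symm₂)).continuous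
  obtain ⟨B, hB⟩ := (isCompact_closedBall (0 : ℝ⁶) 4).exists_bound_of_continuousOn hcont.continuousOn
  refine ⟨B * 12 ^ 3, fun x hx => ?_⟩
  have hx0 : x ≠ 0 := norm_pos_iff.1 (zero_lt_one.trans_le hx)
  set L := fderiv ℝ (antipodalInversion (V := ℝ⁶)) x with hL
  set ξ := antipodalInversion x
  have hξ : ‖T₂ ξ‖ ≤ B := by
    refine hB _ (mem_closedBall_zero_iff.2 ?_)
    rw [norm_antipodalInversion hx0]
    exact mul_le_of_le_one_right (by norm_num) (inv_le_one_of_one_le₀ hx)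
  have hn : ‖wedgeField (η.pull θ₁.symm) (η'.pull θ₁.symm) x‖ ≤ ‖T₂ ξ‖ * ‖L‖ ^ 3 := by
    refine ContinuousLinearMap.opNorm_le_bound _ (by positivity) fun u =>
      ContinuousLinearMap.opNorm_le_bound _ (by positivity) fun v =>
      ContinuousLinearMap.opNorm_le_bound _ (by positivity) fun w => ?_
    have e : wedgeField (η.pull θ₁.symm) (η'.pull θ₁.symm) x u v w = T₂ ξ (L u) (L v) (L w) := by
      simp only [hT₂, wedgeField_apply, wedgeOneTwo, h.dOne_pull_eq hη' hx0, h.pull_eq η hx0]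
      rfl
    rw [e]
    calc ‖T₂ ξ (L u) (L v) (L w)‖ ≤ ‖T₂ ξ‖ * ‖L u‖ * ‖L v‖ * ‖L w‖ :=
          (ContinuousLinearMap.le_opNorm _ _).trans (by
            gcongr; exact ContinuousLinearMap.le_opNorm₂ _ _ _)
      _ ≤ ‖T₂ ξ‖ * (‖L‖ * ‖u‖) * (‖L‖ * ‖v‖) * (‖L‖ * ‖w‖) := by
          gcongr <;> exact L.le_opNorm _
      _ = _ := by ring
  calc ‖x‖ ^ 6 * ‖wedgeField (η.pull θ₁.symm) (η'.pull θ₁.symm) x‖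
      ≤ ‖x‖ ^ 6 * (‖T₂ ξ‖ * ‖L‖ ^ 3) := by gcongr
    _ = ‖T₂ ξ‖ * (‖x‖ ^ 2 * ‖L‖) ^ 3 := by ring
    _ ≤ B * 12 ^ 3 := by
        gcongr
        · exact (norm_nonneg _).trans hξ
        · exact norm_fderiv_antipodalInversion_le hx0

variable [FiniteDimensional ℂ E]

theorem AntipodalCharts.wedgeField_pull_eq_zero (h : AntipodalCharts (E := E) θ₁ θ₂)
    (bE : Module.Basis (Fin 3) ℂ E) (hη : η.IsHolomorphicOneForm) (hη' : η'.IsHolomorphicOneForm)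
    (x : ℝ⁶) : wedgeField (η.pull θ₁.symm) (η'.pull θ₁.symm) x = 0 := by
  let r : Module.Basis (Fin 6) ℝ E := (Complex.basisOneI.smulTower bE).reindex finProdFinEquiv
  let β : Module.Basis (Fin 6) ℝ ℝ⁶ := (EuclideanSpace.basisFun (Fin 6) ℝ).toBasis
  have hF := contDiff_pull hη.isSmooth h.contMDiff_symm₁
  have hG := contDiff_pull hη'.isSmooth h.contMDiff_symm₁
  obtain ⟨C, hC⟩ := h.exists_decay hη.isSmooth hη'.isSmooth
  choose f hf using wedgeField_pull_eq hη hη' bE h.contMDiff_symm₁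
  obtain ⟨s, hs⟩ := exists_orientation β r h.contMDiff_symm₁ h.target₁ h.contMDiffOn₁
  exact eq_zero_of_isClosedField_of_decay bE r β (contDiff_wedgeField hF hG)
    (isAlternating_wedgeField _ _)
    (isClosedField_wedgeField hF hG (wedgeTwoTwo_dOne_pull hη hη' bE h.contMDiff_symm₁)) hC hf hs x

theorem AntipodalCharts.wedge_eq_zero_of_mem (h : AntipodalCharts (E := E) θ₁ θ₂)
    (bE : Module.Basis (Fin 3) ℂ E) (hη : η.IsHolomorphicOneForm) (hη' : η'.IsHolomorphicOneForm)
    {e : OpenPartialHomeomorph X E} (he : e ∈ atlas E X) {y : E} (hy : y ∈ e.target)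
    (hθ : e.symm y ∈ θ₁.source) (u v w : E) :
    wedgeOneTwo (η.pull e.symm y) (dOne (η'.pull e.symm) y) u v w = 0 := by
  have hR := isManifold_realModel hX
  have hτ : ContDiffAt ℝ ∞ (θ₁ ∘ e.symm) y := by
    have h1 := (contMDiffOn_symm_of_mem_maximalAtlas (I := realModel E) (n := ∞)
      (IsManifold.subset_maximalAtlas he)).contMDiffAt (e.open_target.mem_nhds hy)
    exact ((h.contMDiffOn₁.contMDiffAt (θ₁.open_source.mem_nhds hθ)).comp y h1).contDiffAt
  have hev : e.symm =ᶠ[𝓝 y] θ₁.symm ∘ (θ₁ ∘ e.symm) := by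
    filter_upwards [(e.continuousAt_symm hy).preimage_mem_nhds (θ₁.open_source.mem_nhds hθ)]
      with z hz using (θ₁.left_inv hz).symm
  have h1 := η.pull_comp hev (hτ.differentiableAt (by simp))
    (h.contMDiff_symm₁.mdifferentiableAt (by simp))
  have h2 := η'.dOne_pull_comp hev hτ
    (.of_forall fun _ => h.contMDiff_symm₁.mdifferentiableAt (by simp))
    ((contDiff_pull hη'.isSmooth h.contMDiff_symm₁).differentiable (by simp) _)
  have h3 := h.wedgeField_pull_eq_zero bE hη hη' ((θ₁ ∘ e.symm) y)
  set D := fderiv ℝ (θ₁ ∘ e.symm) y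
  have h4 := congrArg (fun T => T (D u) (D v) (D w)) h3
  change wedgeField _ _ _ (D u) (D v) (D w) = 0 at h4
  rw [wedgeField_apply] at h4
  simp only [wedgeOneTwo, h2, h1] at h4 ⊢
  exact h4

/-- On a complex threefold diffeomorphic to the six-sphere, `ω ∧ dω' = 0` for any two holomorphic
one-forms `ω` and `ω'`. -/
theorem AntipodalCharts.wedge_eq_zero (h : AntipodalCharts (E := E) θ₁ θ₂)
    (bE : Module.Basis (Fin 3) ℂ E) (hη : η.IsHolomorphicOneForm) (hη' : η'.IsHolomorphicOneForm)
    {e : OpenPartialHomeomorph X E} (he : e ∈ atlas E X) {y : E} (hy : y ∈ e.target) (u v w : E) :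
    wedgeOneTwo (η.pull e.symm y) (dOne (η'.pull e.symm) y) u v w = 0 := by
  rcases (h.cover.symm ▸ Set.mem_univ (e.symm y) : e.symm y ∈ θ₁.source ∪ θ₂.source) with hθ | hθ
  · exact h.wedge_eq_zero_of_mem bE hη hη' he hy hθ u v w
  · exact h.swap.wedge_eq_zero_of_mem bE hη hη' he hy hθ u v w

end Antipodal

/-! ### ω, dω and ω ∧ ω' as holomorphic tensor fields -/

section Tensors

variable {E : Type*} [NormedAddCommGroup E] [NormedSpace ℂ E]
variable {X : Type*} [TopologicalSpace X] [ChartedSpace E X] [hX : IsManifold 𝓘(ℂ, E) ω X]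
variable {e e' : OpenPartialHomeomorph X E} {η η' : Form E X 1}

omit hX in
theorem hasFDerivAt_pull_apply (hη : η.IsSmooth) (he : e ∈ atlas E X) {y : E}
    (hy : y ∈ e.target) (w : E) : HasFDerivAt (fun z => η.pull e.symm z w)
      ((fderiv ℝ (η.pull e.symm) y).flip w) y := by
  have := (differentiableAt_pull_symm hη he hy).hasFDerivAt.clm_apply (hasFDerivAt_const w y)
  rwa [ContinuousLinearMap.comp_zero, zero_add] at this

omit hX in
theorem fderiv_pull_apply (hη : η.IsSmooth) (he : e ∈ atlas E X) {y : E} (hy : y ∈ e.target)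
    (u w : E) : fderiv ℝ (fun z => η.pull e.symm z w) y u = fderiv ℝ (η.pull e.symm) y u w := by
  rw [(hasFDerivAt_pull_apply hη he hy w).fderiv]; rfl

theorem Form.IsHolomorphicOneForm.differentiableOn_pull (hη : η.IsHolomorphicOneForm)
    (he : e ∈ atlas E X) (w : E) :
    DifferentiableOn ℂ (fun y => η.pull e.symm y w) e.target := fun y hy => by
  refine (differentiableAt_complex_of_real
    (hasFDerivAt_pull_apply hη.isSmooth he hy w).differentiableAt
    fun v => ?_).differentiableWithinAt
  rw [fderiv_pull_apply hη.isSmooth he hy, fderiv_pull_apply hη.isSmooth he hy,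
    hη.fderiv_I_smul he hy, smul_eq_mul]

theorem Form.IsHolomorphicOneForm.differentiableOn_dOne (hη : η.IsHolomorphicOneForm)
    (he : e ∈ atlas E X) (u v : E) :
    DifferentiableOn ℂ (fun y => dOne (η.pull e.symm) y u v) e.target := by
  have h (u v : E) : DifferentiableOn ℂ (fun y => fderiv ℝ (η.pull e.symm) y u v) e.target := by
    refine (differentiableOn_fderiv_apply_of_holomorphic e.open_target
      (g := fun z => η.pull e.symm z v) ?_ (fun y hy w => ?_) u).congr fun y hy =>
        (fderiv_pull_apply hη.isSmooth he hy u v).symm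
    · exact (contDiffOn_pull_symm hη.isSmooth he).clm_apply contDiffOn_const
    · rw [fderiv_pull_apply hη.isSmooth he hy, fderiv_pull_apply hη.isSmooth he hy,
        hη.fderiv_I_smul he hy]
  exact (h u v).sub (h v u)

theorem pull_transition (η : Form E X 1) (he : e ∈ atlas E X) (he' : e' ∈ atlas E X) {y : E}
    (hy : y ∈ e.target) (hy' : e.symm y ∈ e'.source) (u : E) :
    η.pull e.symm y u = η.pull e'.symm (e' (e.symm y)) (fderiv ℝ (e' ∘ e.symm) y u) := by
  rw [η.pull_comp (ψ' := e'.symm) (τ := e' ∘ e.symm) ?_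
    ((fderiv_transition he he' hy hy').1.differentiableAt (by simp))
    (mdifferentiableAt_real_symm he' (e'.map_source hy'))]
  · rfl
  · filter_upwards [(e.continuousAt_symm hy).preimage_mem_nhds (e'.open_source.mem_nhds hy')]
      with z hz using (e'.left_inv hz).symm

theorem dOne_pull_transition (hη : η.IsSmooth) (he : e ∈ atlas E X) (he' : e' ∈ atlas E X) {y : E}
    (hy : y ∈ e.target) (hy' : e.symm y ∈ e'.source) (u v : E) :
    dOne (η.pull e.symm) y u v = dOne (η.pull e'.symm) (e' (e.symm y))
      (fderiv ℝ (e' ∘ e.symm) y u) (fderiv ℝ (e' ∘ e.symm) y v) := by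
  refine η.dOne_pull_comp (ψ' := e'.symm) (τ := e' ∘ e.symm) ?_
    (fderiv_transition he he' hy hy').1 ?_
    (differentiableAt_pull_symm hη he' (e'.map_source hy')) u v
  · filter_upwards [(e.continuousAt_symm hy).preimage_mem_nhds (e'.open_source.mem_nhds hy')]
      with z hz using (e'.left_inv hz).symm
  · filter_upwards [e'.open_target.mem_nhds (e'.map_source hy')] with z hz
      using mdifferentiableAt_real_symm he' hz

theorem Form.IsHolomorphicOneForm.isHolomorphicTensor (hη : η.IsHolomorphicOneForm) :
    IsHolomorphicTensor (X := X) fun e y (w : Fin 1 → E) => η.pull e.symm y (w 0) where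
  differentiableOn _ he w := hη.differentiableOn_pull he (w 0)
  transition _ he _ he' _ hy hy' w := pull_transition η he he' hy hy' (w 0)

theorem Form.IsHolomorphicOneForm.isHolomorphicTensor_dOne (hη : η.IsHolomorphicOneForm) :
    IsHolomorphicTensor (X := X) fun e y (w : Fin 2 → E) => dOne (η.pull e.symm) y (w 0) (w 1) where
  differentiableOn _ he w := hη.differentiableOn_dOne he (w 0) (w 1)
  transition _ he _ he' _ hy hy' w := dOne_pull_transition hη.isSmooth he he' hy hy' (w 0) (w 1)

theorem Form.IsHolomorphicOneForm.isHolomorphicTensor_wedge (hη : η.IsHolomorphicOneForm)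
    (hη' : η'.IsHolomorphicOneForm) :
    IsHolomorphicTensor (X := X) fun e y (w : Fin 2 → E) =>
      η.pull e.symm y (w 0) * η'.pull e.symm y (w 1) -
        η.pull e.symm y (w 1) * η'.pull e.symm y (w 0) where
  differentiableOn _ he w :=
    ((hη.differentiableOn_pull he (w 0)).mul (hη'.differentiableOn_pull he (w 1))).sub
      ((hη.differentiableOn_pull he (w 1)).mul (hη'.differentiableOn_pull he (w 0)))
  transition _ he _ he' _ hy hy' w := by
    simp only [pull_transition η he he' hy hy', pull_transition η' he he' hy hy']

end Tensors

/-! ### Closed holomorphic one-forms are exact, hence zero -/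

section Closed

variable {E : Type*} [NormedAddCommGroup E] [NormedSpace ℂ E]
variable {X : Type*} [TopologicalSpace X] [ChartedSpace E X] [hX : IsManifold 𝓘(ℂ, E) ω X]
variable {η : Form E X 1}

theorem Form.eq_zero_of_pull_eq_zero (h : ∀ e ∈ atlas E X, ∀ y ∈ e.target, η.pull e.symm y = 0) :
    η = 0 := by
  have hR := isManifold_realModel hX
  have := IsManifold.of_le (I := realModel E) (M := X) (m := 1) (n := ∞) (by norm_cast)
  ext x v
  have hx := mem_chart_source E x
  have h1 := (mdifferentiable_chart (I := realModel E) x).symm_comp_deriv hx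
  have h2 := (chartAt E x).left_inv hx
  have h3 := h _ (chart_mem_atlas E x) _ ((chartAt E x).map_source hx)
  have h4 (w : E) : η.covector x w = 0 := by
    obtain ⟨w', a⟩ : ∃ w' : E,
        derivInModel (E := E) (chartAt E x).symm (chartAt E x x) w' = w :=
      ⟨(mfderiv (realModel E) (realModel E) (chartAt E x) x : E →L[ℝ] E) w,
        DFunLike.congr_fun h1 w⟩
    have b := DFunLike.congr_fun h3 w'
    rw [Form.pull, h2] at b
    rw [← a]
    exact b
  have h5 : v = fun _ => v 0 := by ext i; rw [Subsingleton.elim i 0]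
  rw [h5]
  exact h4 (v 0)

local notation "ℝ⁶" => EuclideanSpace ℝ (Fin 6)

variable {θ₁ θ₂ : OpenPartialHomeomorph X ℝ⁶}

theorem exists_primitive_pull (hη : η.IsSmooth)
    (hd : ∀ e ∈ atlas E X, ∀ y ∈ e.target, ∀ u v, dOne (η.pull e.symm) y u v = 0)
    {V : Type*} [NormedAddCommGroup V] [NormedSpace ℝ V] {ψ : V → X}
    (hψ : ContMDiff 𝓘(ℝ, V) (realModel E) ∞ ψ) :
    ∃ f : V → ℂ, ∀ x, HasFDerivAt f (η.pull ψ x) x := by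
  obtain ⟨f, hf⟩ := convex_univ.exists_forall_hasFDerivAt_of_fderiv_symmetric isOpen_univ
    ((contDiff_pull hη hψ).differentiable (by simp)).differentiableOn
    fun x _ u v => by
      have he := chart_mem_atlas E (ψ x)
      have hx := mem_chart_source E (ψ x)
      have h := dOne_pull_eq_comp_chart hη hψ he hx u v
      rw [hd _ he _ ((chartAt E (ψ x)).map_source hx)] at h
      exact sub_eq_zero.1 h
  exact ⟨f, fun x => hf x trivial⟩

/-- A primitive in one of the charts of a manifold, read in a holomorphic chart. -/
theorem hasFDerivAt_comp_symm {V : Type*} [NormedAddCommGroup V] [NormedSpace ℝ V]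
    {θ : OpenPartialHomeomorph X V} (hs : ContMDiff 𝓘(ℝ, V) (realModel E) ∞ θ.symm)
    (hc : ContMDiffOn (realModel E) 𝓘(ℝ, V) ∞ θ θ.source) {g : V → ℂ} {f : X → ℂ}
    (hg : ∀ x, HasFDerivAt g (η.pull θ.symm x) x) {c : ℂ} (hf : ∀ x ∈ θ.source, f x = g (θ x) + c)
    {e : OpenPartialHomeomorph X E} (he : e ∈ atlas E X) {y : E} (hy : y ∈ e.target)
    (hθ : e.symm y ∈ θ.source) : HasFDerivAt (f ∘ e.symm) (η.pull e.symm y) y := by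
  have hR := isManifold_realModel hX
  have hev := (e.continuousAt_symm hy).preimage_mem_nhds (θ.open_source.mem_nhds hθ)
  have hτ : DifferentiableAt ℝ (θ ∘ e.symm) y :=
    (((hc.contMDiffAt (θ.open_source.mem_nhds hθ)).mdifferentiableAt (by simp)).comp y
      (mdifferentiableAt_real_symm he hy)).differentiableAt
  rw [η.pull_comp (ψ' := θ.symm) (τ := θ ∘ e.symm)
    (by filter_upwards [hev] with z hz using (θ.left_inv hz).symm) hτ
    (hs.mdifferentiableAt (by simp))]
  refine (((hg _).comp y hτ.hasFDerivAt).add_const c).congr_of_eventuallyEq ?_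
  filter_upwards [hev] with z hz using hf _ hz

/-- Each chart domain is a vector space and carries a primitive. On the overlap the two differ by a
constant, because ℝ⁶ minus the origin is connected, and so they glue. -/
theorem AntipodalCharts.exists_primitive (h : AntipodalCharts (E := E) θ₁ θ₂) (hη : η.IsSmooth)
    (hd : ∀ e ∈ atlas E X, ∀ y ∈ e.target, ∀ u v, dOne (η.pull e.symm) y u v = 0) :
    ∃ f : X → ℂ, ∀ e ∈ atlas E X, ∀ y ∈ e.target, HasFDerivAt (f ∘ e.symm) (η.pull e.symm y) y := by
  classical
  obtain ⟨f₁, h₁⟩ := exists_primitive_pull hη hd h.contMDiff_symm₁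
  obtain ⟨f₂, h₂⟩ := exists_primitive_pull hη hd h.contMDiff_symm₂
  have hι (x : ℝ⁶) (hx : x ≠ 0) : HasFDerivAt (f₂ ∘ antipodalInversion) (η.pull θ₁.symm x) x := by
    rw [h.pull_eq η hx]
    exact (h₂ _).comp x ((contDiffAt_antipodalInversion hx).differentiableAt (by simp)).hasFDerivAt
  obtain ⟨c, hc⟩ := (isOpen_compl_singleton (x := (0 : ℝ⁶))).exists_eq_add_of_fderiv_eq (𝕜 := ℝ)
    (isConnected_compl_singleton_of_one_lt_rank
      (by rw [← Module.finrank_eq_rank, finrank_euclideanSpace_fin]; norm_num) _).isPreconnected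
    (f := f₁) (g := f₂ ∘ antipodalInversion)
    (fun x _ => (h₁ x).differentiableAt.differentiableWithinAt)
    (fun x hx => (hι x hx).differentiableAt.differentiableWithinAt)
    (fun x hx => by rw [(h₁ x).fderiv, (hι x hx).fderiv])
  have hθ (x : X) (hx₁ : x ∈ θ₁.source) (hx₂ : x ∈ θ₂.source) :
      f₁ (θ₁ x) = f₂ (θ₂ x) + c := by
    have e₂ := θ₂.left_inv hx₂
    by_cases h0 : θ₁ x = 0
    -- The origin of the first chart is the point omitted by the second one.
    · exfalso
      have e₁ := θ₁.left_inv hx₁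
      have h2 : θ₂ x ≠ 0 := fun h2 => h.symm_zero_ne
        ((congrArg θ₁.symm h0.symm).trans (e₁.trans (e₂.symm.trans (congrArg θ₂.symm h2))))
      have h3 : θ₁.symm (antipodalInversion (θ₂ x)) = θ₁.symm 0 := by
        rw [← h.symm₂ _ h2, e₂, ← h0, e₁]
      exact antipodalInversion_ne_zero h2 (θ₁.symm.injOn (by simp [h.target₁]) (by simp [h.target₁]) h3)
    · have h3 : θ₂ x = antipodalInversion (θ₁ x) := by
        refine θ₂.symm.injOn (by simp [h.target₂]) (by simp [h.target₂]) ?_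
        rw [← h.symm₁ _ h0, e₂, θ₁.left_inv hx₁]
      rw [h3]
      exact hc h0
  refine ⟨fun x => if x ∈ θ₁.source then f₁ (θ₁ x) else f₂ (θ₂ x) + c, fun e he y hy => ?_⟩
  rcases (h.cover.symm ▸ Set.mem_univ (e.symm y) : e.symm y ∈ θ₁.source ∪ θ₂.source) with hy' | hy'
  · exact hasFDerivAt_comp_symm h.contMDiff_symm₁ h.contMDiffOn₁ h₁ (c := 0)
      (fun x hx => by simp [hx]) he hy hy'
  · refine hasFDerivAt_comp_symm h.contMDiff_symm₂ h.contMDiffOn₂ h₂ (c := c)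
      (fun x hx => ?_) he hy hy'
    split_ifs with hx₁
    · exact hθ x hx₁ hx
    · rfl

/-- Closed holomorphic one-forms vanish. -/
theorem AntipodalCharts.eq_zero_of_closed [CompactSpace X] [PreconnectedSpace X]
    (h : AntipodalCharts (E := E) θ₁ θ₂) (hη : η.IsHolomorphicOneForm)
    (hd : ∀ e ∈ atlas E X, ∀ y ∈ e.target, ∀ u v, dOne (η.pull e.symm) y u v = 0) : η = 0 := by
  obtain ⟨f, hf⟩ := h.exists_primitive hη.isSmooth hd
  have := IsManifold.of_le (I := 𝓘(ℂ, E)) (M := X) (m := 1) (n := ω) le_top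
  have hm : MDifferentiable 𝓘(ℂ, E) 𝓘(ℂ, ℂ) f := by
    intro x
    have he := chart_mem_atlas E x
    have hx := mem_chart_source E x
    have hy := (chartAt E x).map_source hx
    have h1 : DifferentiableAt ℂ (f ∘ (chartAt E x).symm) (chartAt E x x) := by
      refine differentiableAt_complex_of_real (hf _ he _ hy).differentiableAt fun v => ?_
      rw [(hf _ he _ hy).fderiv, pull_symm_smul hη.isOfType he hy, smul_eq_mul]
    refine (h1.mdifferentiableAt.comp x (mdifferentiableAt_atlas he hx)).congr_of_eventuallyEq ?_
    filter_upwards [(chartAt E x).open_source.mem_nhds hx] with z hz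
    simp only [Function.comp_apply]
    rw [(chartAt E x).left_inv hz]
  obtain ⟨c, rfl⟩ := hm.exists_eq_const_of_compactSpace
  exact Form.eq_zero_of_pull_eq_zero fun e he y hy => (hf e he y hy).unique (hasFDerivAt_const c y)

end Closed

/-! ### Linear relations between two holomorphic one-forms -/

section Pencils

variable {E : Type*} [NormedAddCommGroup E] [NormedSpace ℂ E]
variable {X : Type*} [TopologicalSpace X] [ChartedSpace E X]
variable {η η' : Form E X 1}

/-- Degrees 1 + 0 and 1 agree definitionally, so the two sides speak of the same form. -/
theorem Form.isHolomorphicOneForm_iff :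
    η.IsHolomorphicOneForm ↔ (η : Form E X (1 + 0)) ∈ dbarClosed E X 1 0 :=
  ⟨fun h => ⟨⟨h.isSmooth, h.isOfType⟩, h.hasDbar⟩, fun h => ⟨h.1.1, h.1.2, h.2⟩⟩

theorem Form.IsHolomorphicOneForm.lincomb (hη : η.IsHolomorphicOneForm)
    (hη' : η'.IsHolomorphicOneForm) (a b : ℂ) : (a • η + b • η').IsHolomorphicOneForm :=
  isHolomorphicOneForm_iff.2 (add_mem (Submodule.smul_mem _ a (isHolomorphicOneForm_iff.1 hη))
    (Submodule.smul_mem _ b (isHolomorphicOneForm_iff.1 hη')))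

theorem Form.pull_lincomb {V : Type*} [NormedAddCommGroup V] [NormedSpace ℝ V] (a b : ℂ)
    (ψ : V → X) : (a • η + b • η').pull ψ = fun y => a • η.pull ψ y + b • η'.pull ψ y := by
  ext y v
  rfl

variable [hX : IsManifold 𝓘(ℂ, E) ω X]

omit hX in
theorem dOne_pull_lincomb (hη : η.IsSmooth) (hη' : η'.IsSmooth) (a b : ℂ)
    {e : OpenPartialHomeomorph X E} (he : e ∈ atlas E X) {y : E} (hy : y ∈ e.target) (u v : E) :
    dOne ((a • η + b • η').pull e.symm) y u v =
      a * dOne (η.pull e.symm) y u v + b * dOne (η'.pull e.symm) y u v := by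
  have h := ((differentiableAt_pull_symm hη he hy).hasFDerivAt.const_smul a).add
    ((differentiableAt_pull_symm hη' he hy).hasFDerivAt.const_smul b)
  have h' : HasFDerivAt ((a • η + b • η').pull e.symm)
      (a • fderiv ℝ (η.pull e.symm) y + b • fderiv ℝ (η'.pull e.symm) y) y := by
    rw [Form.pull_lincomb]; exact h
  simp only [dOne, h'.fderiv, add_apply, smul_apply, smul_eq_mul]
  ring

variable [PreconnectedSpace X]

/-- Unless the second form vanishes, the ratio of the two is a global meromorphic function, hence
constant. -/
theorem Form.IsHolomorphicOneForm.exists_relation_of_wedge_eq_zero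
    (ha : algebraicDimension E X = 0) (hη : η.IsHolomorphicOneForm) (hη' : η'.IsHolomorphicOneForm)
    (hw : ∀ e ∈ atlas E X, ∀ y ∈ e.target, ∀ u v, η.pull e.symm y u * η'.pull e.symm y v =
      η.pull e.symm y v * η'.pull e.symm y u) :
    ∃ a b : ℂ, (a ≠ 0 ∨ b ≠ 0) ∧ a • η + b • η' = 0 := by
  by_cases h0 : η' = 0
  · exact ⟨0, 1, .inr one_ne_zero, by rw [h0, smul_zero, zero_smul, add_zero]⟩
  have hB0 : ∃ e ∈ atlas E X, ∃ y ∈ e.target, ∃ w : Fin 1 → E, η'.pull e.symm y (w 0) ≠ 0 := by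
    by_contra! h
    exact h0 (Form.eq_zero_of_pull_eq_zero fun e he y hy => by ext v; exact h e he y hy fun _ => v)
  obtain ⟨c, hc⟩ := IsHolomorphicTensor.exists_eq_const_mul ha hη.isHolomorphicTensor
    hη'.isHolomorphicTensor (fun e he y hy w w' => by linear_combination hw e he y hy (w' 0) (w 0)) hB0
  refine ⟨1, -c, .inl one_ne_zero, Form.eq_zero_of_pull_eq_zero fun e he y hy => ?_⟩
  ext v
  have := hc e he y hy fun _ => v
  rw [Form.pull_lincomb]
  simp only [add_apply, smul_apply, smul_eq_mul, this]
  simp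

/-- Having zero wedge product with η and η', the two-form dζ is pointwise proportional to η ∧ η';
algebraic dimension zero makes the factor constant. -/
theorem Form.IsHolomorphicOneForm.exists_dOne_eq_const_mul
    (ha : algebraicDimension E X = 0) (bE : Module.Basis (Fin 3) ℂ E) {ζ : Form E X 1}
    (hη : η.IsHolomorphicOneForm) (hη' : η'.IsHolomorphicOneForm) (hζ : ζ.IsHolomorphicOneForm)
    (h : ∀ e ∈ atlas E X, ∀ y ∈ e.target, ∀ u v w,
      wedgeOneTwo (η.pull e.symm y) (dOne (ζ.pull e.symm) y) u v w = 0)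
    (h' : ∀ e ∈ atlas E X, ∀ y ∈ e.target, ∀ u v w,
      wedgeOneTwo (η'.pull e.symm y) (dOne (ζ.pull e.symm) y) u v w = 0)
    (hw : ∃ e ∈ atlas E X, ∃ y ∈ e.target, ∃ w : Fin 2 → E, η.pull e.symm y (w 0) *
      η'.pull e.symm y (w 1) - η.pull e.symm y (w 1) * η'.pull e.symm y (w 0) ≠ 0) :
    ∃ c : ℂ, ∀ e ∈ atlas E X, ∀ y ∈ e.target, ∀ u v, dOne (ζ.pull e.symm) y u v =
      c * (η.pull e.symm y u * η'.pull e.symm y v - η.pull e.symm y v * η'.pull e.symm y u) := by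
  obtain ⟨c, hc⟩ := IsHolomorphicTensor.exists_eq_const_mul ha hζ.isHolomorphicTensor_dOne
    (hη.isHolomorphicTensor_wedge hη') (fun e he y hy w w' => by
      obtain ⟨l, hl⟩ := hη.exists_coeff bE he hy
      obtain ⟨l', hl'⟩ := hη'.exists_coeff bE he hy
      obtain ⟨b, hb⟩ := hζ.exists_dOne_coeff bE he hy
      have hb' : dOne (ζ.pull e.symm) y = twoFormOfCoeff bE b := by ext u v; exact hb u v
      -- Evaluation on the basis itself, where the determinant is 1, reads off the vanishing of the
      -- products l · b and l' · b.
      have hdet : bE.det ![bE 0, bE 1, bE 2] = 1 := by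
        rw [show ![bE 0, bE 1, bE 2] = bE by ext i; fin_cases i <;> rfl, bE.det_self]
      have k := h e he y hy (bE 0) (bE 1) (bE 2)
      have k' := h' e he y hy (bE 0) (bE 1) (bE 2)
      rw [hb', wedgeOneTwo_twoFormOfCoeff hl, hdet, mul_one] at k
      rw [hb', wedgeOneTwo_twoFormOfCoeff hl', hdet, mul_one] at k'
      rw [hb']
      exact twoForm_proportional hl hl' k k' _ _ _ _) hw
  exact ⟨c, fun e he y hy u v => hc e he y hy ![u, v]⟩

/-- If η ∧ η' is not identically zero, dη and dη' are constant multiples c, c' of it, so some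
nontrivial combination of η and η' is closed and therefore zero. Otherwise η and η' are themselves
proportional. -/
theorem AntipodalCharts.exists_relation [FiniteDimensional ℂ E] [CompactSpace X]
    {θ₁ θ₂ : OpenPartialHomeomorph X (EuclideanSpace ℝ (Fin 6))}
    (h : AntipodalCharts (E := E) θ₁ θ₂) (ha : algebraicDimension E X = 0)
    (bE : Module.Basis (Fin 3) ℂ E) (hη : η.IsHolomorphicOneForm) (hη' : η'.IsHolomorphicOneForm) :
    ∃ a b : ℂ, (a ≠ 0 ∨ b ≠ 0) ∧ a • η + b • η' = 0 := by
  by_cases hw : ∃ e ∈ atlas E X, ∃ y ∈ e.target, ∃ w : Fin 2 → E, η.pull e.symm y (w 0) *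
      η'.pull e.symm y (w 1) - η.pull e.symm y (w 1) * η'.pull e.symm y (w 0) ≠ 0
  · obtain ⟨c, hc⟩ := hη.exists_dOne_eq_const_mul ha bE hη' hη
      (fun _ he _ hy => h.wedge_eq_zero bE hη hη he hy)
      (fun _ he _ hy => h.wedge_eq_zero bE hη' hη he hy) hw
    obtain ⟨c', hc'⟩ := hη.exists_dOne_eq_const_mul ha bE hη' hη'
      (fun _ he _ hy => h.wedge_eq_zero bE hη hη' he hy)
      (fun _ he _ hy => h.wedge_eq_zero bE hη' hη' he hy) hw
    obtain ⟨a, b, hab, h0⟩ : ∃ a b : ℂ, (a ≠ 0 ∨ b ≠ 0) ∧ a * c + b * c' = 0 := by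
      by_cases h1 : c = 0
      · exact ⟨1, 0, .inl one_ne_zero, by rw [h1]; ring⟩
      · exact ⟨-c', c, .inr h1, by ring⟩
    refine ⟨a, b, hab, h.eq_zero_of_closed (hη.lincomb hη' a b) fun e he y hy u v => ?_⟩
    rw [dOne_pull_lincomb hη.isSmooth hη'.isSmooth a b he hy, hc e he y hy, hc' e he y hy]
    linear_combination (η.pull e.symm y u * η'.pull e.symm y v -
      η.pull e.symm y v * η'.pull e.symm y u) * h0
  · push Not at hw
    exact hη.exists_relation_of_wedge_eq_zero ha hη' fun e he y hy u v =>
      sub_eq_zero.1 (hw e he y hy ![u, v])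

end Pencils

/-! ### From pairwise linear relations to the bound on the Hodge number -/

theorem rank_le_one_of_exists_relation {V : Type*} [AddCommGroup V] [Module ℂ V]
    (h : ∀ v w : V, ∃ a b : ℂ, (a ≠ 0 ∨ b ≠ 0) ∧ a • v + b • w = 0) : Module.rank ℂ V ≤ 1 := by
  refine rank_le_one_iff.2 ?_
  by_cases h0 : ∃ v : V, v ≠ 0
  · obtain ⟨v, hv⟩ := h0
    refine ⟨v, fun w => ?_⟩
    obtain ⟨a, b, hab, e⟩ := h v w
    have hb : b ≠ 0 := by
      rintro rfl
      rw [zero_smul, add_zero] at e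
      exact hv ((smul_eq_zero.1 e).resolve_left (hab.resolve_right (by simp)))
    refine ⟨-(b⁻¹ * a), ?_⟩
    rw [neg_smul, mul_smul, eq_neg_of_add_eq_zero_left e, smul_neg, neg_neg, smul_smul,
      inv_mul_cancel₀ hb, one_smul]
  · push Not at h0
    exact ⟨0, fun w => ⟨0, by rw [h0 w, smul_zero]⟩⟩

end ComplexManifold

end

theorem mainTheorem9 (X : Type*) [TopologicalSpace X]
    [ChartedSpace (EuclideanSpace ℂ (Fin 3)) X]
    [IsManifold 𝓘(ℂ, EuclideanSpace ℂ (Fin 3)) ω X]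
    (hX : Nonempty (X ≃ₘ⟮ComplexManifold.realModel (EuclideanSpace ℂ (Fin 3)), 𝓡 6⟯
      Metric.sphere (0 : EuclideanSpace ℝ (Fin 7)) 1))
    (ha : ComplexManifold.algebraicDimension (EuclideanSpace ℂ (Fin 3)) X = 0) :
    ComplexManifold.hodgeNumber (EuclideanSpace ℂ (Fin 3)) X 1 0 ≤ 1 := by
  obtain ⟨Φ⟩ := hX
  have hS : PreconnectedSpace (Metric.sphere (0 : EuclideanSpace ℝ (Fin 7)) 1) :=
    isPreconnected_iff_preconnectedSpace.1 (isPreconnected_sphere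
      (by rw [← Module.finrank_eq_rank, finrank_euclideanSpace_fin]; norm_num) _ _)
  have : CompactSpace X := Φ.toHomeomorph.symm.compactSpace
  have : PreconnectedSpace X := Φ.toHomeomorph.symm.surjective.denseRange.preconnectedSpace
    Φ.toHomeomorph.symm.continuous
  obtain ⟨θ₁, θ₂, h⟩ := ComplexManifold.exists_antipodalCharts Φ
  refine ComplexManifold.rank_le_one_of_exists_relation fun v w => ?_
  -- A relation between ∂̄-closed representatives descends to their classes, so the exact forms play
  -- no role.
  obtain ⟨η, rfl⟩ := Submodule.Quotient.mk_surjective _ v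
  obtain ⟨η', rfl⟩ := Submodule.Quotient.mk_surjective _ w
  obtain ⟨a, b, hab, e⟩ := h.exists_relation ha (EuclideanSpace.basisFun (Fin 3) ℂ).toBasis
    (ComplexManifold.Form.isHolomorphicOneForm_iff.2 η.2)
    (ComplexManifold.Form.isHolomorphicOneForm_iff.2 η'.2)
  refine ⟨a, b, hab, ?_⟩
  have e' : a • η + b • η' = 0 := Subtype.ext e
  rw [← Submodule.Quotient.mk_smul, ← Submodule.Quotient.mk_smul, ← Submodule.Quotient.mk_add, e',
    Submodule.Quotient.mk_zero]
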